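/- Let $\sigma\in(1,\infty)$, let $n$ be an integer with $n>2\sigma$, and put $m=\lfloor\sigma\rfloor$, $s=\sigma-m$, $\gamma_\sigma=\frac{n-2\sigma}{2}$, $$f_\sigma(x)=\frac{\Gamma(\frac n2+\sigma)}{\Gamma(\frac n2-\sigma)}\,|x|^{\frac{n+2\sigma}{n-2\sigma}},\qquad \mathcal A_a(t)=2^{-a}\,|\mathbb S^{n-2}|\int_{-1}^{1}(1-\zeta^2)^{\frac{n-3}{2}}\,|\cosh t-\zeta|^{-a}\,d\zeta .$$ Let $\widehat{\mathcal R}_\sigma=\frac{\Gamma(\frac n2-\sigma)}{2^{2\sigma}\pi^{n/2}\Gamma(\sigma)}\,\mathcal A_{\gamma_\sigma}$ and $\widehat{\mathcal K}_s=\frac{2^{2s}\,s\,\Gamma(\frac n2+s)}{\pi^{n/2}\Gamma(1-s)}\,\mathcal A_{\frac{n+2s}{2}}$ (the kernels of $(-\Delta)^{-\sigma}$ and of $(-\Delta)^s$ on $\mathbb R^n$ in Emden–Fowler coordinates; $\widehat{\mathcal K}_0=0$), and for $L>0$ let $\widehat{\mathcal R}_{\sigma,L}(t)=\sum_{j\in\mathbb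 Z}\widehat{\mathcal R}_\sigma(t-2jL)$ and $\widehat{\mathcal K}_{s,L}(t)=\sum_{j\in\mathbb Z}\widehat{\mathcal K}_s(t-2jL)$. Let $\mathcal C^{2\sigma}(\mathbb R)$ be the Hölder space $\mathcal C^{k,\alpha}(\mathbb R)$ with $k=\lfloor 2\sigma\rfloor$, $\alpha=2\sigma-k$, and let $H^\sigma_L$ be the space of $2L$-periodic functions $v\in\mathcal C^{2\sigma}(\mathbb R)$ for which $$\|v\|_{H^\sigma_L}^2=\sum_{\ell=0}^{m}\int_{-L}^{L}|v^{(\ell)}|^2\,dt+\int_{-L}^{L}\!\int_{-L}^{L}\bigl[v^{(m)}(t)-v^{(m)}(\tau)\bigr]^2\,\widehat{\mathcal K}_{s,L}(t-\tau)\,d\tau\,dt$$ is finite. Let $\widehat V_L(t)=\sum_{j\in\mathbb Z}\cosh(t-2jL)^{-\gamma_\sigma}$ be the standard bubble tower. Consider the periodic boundary value problem $$v(t)=\int_{-L}^{L}f_\sigma(v(\tau))\,\widehat{\mathcal R}_{\sigma,L}(t-\tau)\,d\tau\ \text{ for } t\in(-L,L),\qquad v^{(\ell)}(-L)=v^{(\ell)}(L)=0\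 \text{ for } \ell=1,3,\dots,2m-1,\tag{P}$$ and the cylindrical (Emden–Fowler) integral equation $$v(t)=\int_{-\infty}^{\infty}f_\sigma(v(\tau))\,\widehat{\mathcal R}_{\sigma}(t-\tau)\,d\tau\ \text{ for } t\in\mathbb R.\tag{E}$$ Then there are constants $L_0,\delta,C,\xi>0$, depending only on $n$ and $\sigma$, and for every $L\ge L_0$ functions $\bar v_L,\psi_L\in H^\sigma_L$ with $\bar v_L=\widehat V_L+\psi_L$ such that: 1. $\bar v_L$ is positive, even and $2L$-periodic, and it solves both (P) and (E). 2. $\|\psi_L\|_{H^\sigma_L}<\delta$, and $\bar v_L$ is unique: if $w\in H^\sigma_L$ is positive and even, solves (P) or (E), and satisfies $\|w-\widehat V_L\|_{H^\sigma_L}<\delta$, then $w=\bar v_L$. 3. $\|\psi_L\|_{H^\sigma_L}\to 0$ as $L\to+\infty$. 4. $\|\psi_L\|_{\mathcal C^{2\sigma}(\mathbb R)}\le C e^{-\gamma_\sigma L(1+\xi)}$ for every $L\ge L_0$. -/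

import Mathlib

open MeasureTheory Filter Topology
open scoped ENNReal

namespace Delaunay

noncomputable section

/-- The Fowler exponent `γ_σ = (n - 2σ) / 2`. -/
def fowlerExp (n : ℕ) (σ : ℝ) : ℝ := ((n : ℝ) - 2 * σ) / 2

/-- The dual Fowler exponent `γ'_σ = (n + 2σ) / 2`. -/
def fowlerExpDual (n : ℕ) (σ : ℝ) : ℝ := ((n : ℝ) + 2 * σ) / 2

/-- The surface measure of the unit sphere `S^{n-2}` of `ℝ^{n-1}`. -/
def sphereArea (n : ℕ) : ℝ :=
  2 * Real.pi ^ (((n : ℝ) - 1) / 2) / Real.Gamma (((n : ℝ) - 1) / 2)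

/-- `|x - y|^{-2a}` in logarithmic polar coordinates, integrated over the angular variable:
`2^{-a} |S^{n-2}| ∫_{-1}^{1} (1 - ζ²)^{(n-3)/2} |cosh t - ζ|^{-a} dζ`.
For `a = γ_σ` with `σ > 1` the integral converges for every `t`; for `a = γ'_s` it converges
for every `t ≠ 0`. -/
def angularKernel (n : ℕ) (a t : ℝ) : ℝ :=
  (2 : ℝ) ^ (-a) * sphereArea n *
    ∫ ζ in (-1 : ℝ)..1, (1 - ζ ^ 2) ^ (((n : ℝ) - 3) / 2) * |Real.cosh t - ζ| ^ (-a)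

/-- The constant for which `C |x|^{-(n-2σ)}` is the kernel of `(-Δ)^{-σ}` on `ℝⁿ`. -/
def rieszConst (n : ℕ) (σ : ℝ) : ℝ :=
  Real.Gamma ((n : ℝ) / 2 - σ) /
    ((2 : ℝ) ^ (2 * σ) * Real.pi ^ ((n : ℝ) / 2) * Real.Gamma σ)

/-- The Riesz kernel of `(-Δ)^{-σ}` in Emden–Fowler coordinates. -/
def rieszKernel (n : ℕ) (σ t : ℝ) : ℝ :=
  rieszConst n σ * angularKernel n (fowlerExp n σ) t

/-- The `2L`-periodization of the cylindrical Riesz kernel. -/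
def rieszKernelPer (n : ℕ) (σ L t : ℝ) : ℝ :=
  ∑' j : ℤ, rieszKernel n σ (t - 2 * (j : ℝ) * L)

/-- The constant of the singular integral defining `(-Δ)^s` on `ℝⁿ`, `0 ≤ s < 1`.
It vanishes at `s = 0`. -/
def fracConst (n : ℕ) (s : ℝ) : ℝ :=
  Real.pi ^ (-((n : ℝ) / 2)) * (2 : ℝ) ^ (2 * s) * s * Real.Gamma ((n : ℝ) / 2 + s) /
    Real.Gamma (1 - s)

/-- The kernel of `(-Δ)^s` in Emden–Fowler coordinates (its value at the singularity `t = 0`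
plays no role). -/
def fracKernel (n : ℕ) (s t : ℝ) : ℝ :=
  fracConst n s * angularKernel n (fowlerExpDual n s) t

/-- The `2L`-periodization of the cylindrical kernel of `(-Δ)^s`. -/
def fracKernelPer (n : ℕ) (s L t : ℝ) : ℝ≥0∞ :=
  ∑' j : ℤ, ENNReal.ofReal (fracKernel n s (t - 2 * (j : ℝ) * L))

/-- The critical nonlinearity `f_σ(x) = c_{n,σ} |x|^{(n+2σ)/(n-2σ)}` with
`c_{n,σ} = Γ(n/2 + σ) / Γ(n/2 - σ)`, the constant for which the standard bubble
`(2 / (1 + |x|²))^{γ_σ}` satisfies `(-Δ)^σ u = f_σ(u)` on `ℝⁿ`. -/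
def nonlin (n : ℕ) (σ x : ℝ) : ℝ :=
  Real.Gamma ((n : ℝ) / 2 + σ) / Real.Gamma ((n : ℝ) / 2 - σ) *
    |x| ^ (((n : ℝ) + 2 * σ) / ((n : ℝ) - 2 * σ))

/-- The bubble centred at `2jL`: `V_j(t) = cosh(t - 2jL)^{-γ_σ}`. -/
def bubble (n : ℕ) (σ L : ℝ) (j : ℤ) (t : ℝ) : ℝ :=
  Real.cosh (t - 2 * (j : ℝ) * L) ^ (-fowlerExp n σ)

/-- The standard bubble tower `∑_{j ∈ ℤ} V_j`. -/
def bubbleTower (n : ℕ) (σ L t : ℝ) : ℝ := ∑' j : ℤ, bubble n σ L j t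

/-- The norm of the Hölder space `C^{r}(ℝ) = C^{k,α}(ℝ)`, `k = ⌊r⌋`, `α = r - k`.
For integer `r` the last term is bounded by twice the supremum of `|v^{(k)}|`, so this is
equivalent to the usual `C^k` norm. -/
def holderNorm (r : ℝ) (v : ℝ → ℝ) : ℝ≥0∞ :=
  (∑ l ∈ Finset.range (⌊r⌋₊ + 1), ⨆ t : ℝ, ‖iteratedDeriv l v t‖ₑ) +
    ⨆ (t : ℝ) (τ : ℝ) (_ : t ≠ τ),
      ‖iteratedDeriv ⌊r⌋₊ v t - iteratedDeriv ⌊r⌋₊ v τ‖ₑ /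
        ENNReal.ofReal (|t - τ| ^ (r - (⌊r⌋₊ : ℝ)))

/-- Membership in the Hölder space `C^{r}(ℝ)`. -/
def MemHolder (r : ℝ) (v : ℝ → ℝ) : Prop :=
  ContDiff ℝ (⌊r⌋₊ : ℕ) v ∧ holderNorm r v < ∞

/-- The norm of `H^σ_L`: with `m = ⌊σ⌋` and `s = σ - m`, the square root of
`∑_{l ≤ m} ‖v^{(l)}‖²_{L²(-L,L)} +
  ∫_{-L}^{L} ∫_{-L}^{L} (v^{(m)}(t) - v^{(m)}(τ))² K_{s,L}(t - τ) dτ dt`. -/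
def sobolevNorm (n : ℕ) (σ L : ℝ) (v : ℝ → ℝ) : ℝ≥0∞ :=
  ((∑ l ∈ Finset.range (⌊σ⌋₊ + 1),
      ∫⁻ t in Set.Ioo (-L) L, ‖iteratedDeriv l v t‖ₑ ^ 2) +
    ∫⁻ t in Set.Ioo (-L) L, ∫⁻ τ in Set.Ioo (-L) L,
      ‖iteratedDeriv ⌊σ⌋₊ v t - iteratedDeriv ⌊σ⌋₊ v τ‖ₑ ^ 2 *
        fracKernelPer n (σ - (⌊σ⌋₊ : ℝ)) L (t - τ)) ^ (1 / 2 : ℝ)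

/-- The space `H^σ_L(ℝ)`: `2L`-periodic functions of class `C^{2σ}` with finite `H^σ_L` norm. -/
def MemSobolev (n : ℕ) (σ L : ℝ) (v : ℝ → ℝ) : Prop :=
  MemHolder (2 * σ) v ∧ Function.Periodic v (2 * L) ∧ sobolevNorm n σ L v < ∞

/-- Positive even functions in `H^σ_L(ℝ)`. -/
def IsAdmissible (n : ℕ) (σ L : ℝ) (v : ℝ → ℝ) : Prop :=
  MemSobolev n σ L v ∧ (∀ t, 0 < v t) ∧ ∀ t, v (-t) = v t

/-- Positive even solutions in `H^σ_L(ℝ)` of the periodic boundary value problem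
`v = ∫_{-L}^{L} f_σ(v(τ)) R_{σ,L}(t - τ) dτ` in `(-L, L)`, with
`v^{(l)}(-L) = v^{(l)}(L) = 0` for `l = 1, 3, …, 2m - 1`, where `m = ⌊σ⌋`. -/
def IsBoundaryValueSolution (n : ℕ) (σ L : ℝ) (v : ℝ → ℝ) : Prop :=
  IsAdmissible n σ L v ∧
    (∀ t ∈ Set.Ioo (-L) L,
      v t = ∫ τ in (-L)..L, nonlin n σ (v τ) * rieszKernelPer n σ L (t - τ)) ∧
    ∀ l : ℕ, Odd l → l ≤ 2 * ⌊σ⌋₊ - 1 →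
      iteratedDeriv l v (-L) = 0 ∧ iteratedDeriv l v L = 0

/-- Positive even `2L`-periodic solutions in `H^σ_L(ℝ)` of the cylindrical integral equation
`v = ∫_ℝ f_σ(v(τ)) R_σ(t - τ) dτ` on `ℝ`. -/
def IsCylindricalSolution (n : ℕ) (σ L : ℝ) (v : ℝ → ℝ) : Prop :=
  IsAdmissible n σ L v ∧
    ∀ t, v t = ∫ τ, nonlin n σ (v τ) * rieszKernel n σ (t - τ)

end

end Delaunay

/-! For a $2L$-periodic function, (E) unfolds to (P), since convolution with $\widehat{\mathcal
R}_\sigma$ over the line is convolution with its periodization over one period. Both problems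
therefore become the fixed-point equation of one operator, `solOp`, whose kernel is symmetrized so
that its fixed points are even. The tower $W=\widehat V_L$ is the potential of $\sum_j
f_\sigma(V_j)$, hence an approximate solution, and the true one is found near it by contraction.
This needs nondegeneracy of a single bubble $V$ among even functions, its transfer to large $L$, and
an estimate of the residual $f_\sigma(W)-\sum_j f_\sigma(V_j)$.

Nondegeneracy. The substitution $x=\tanh t$ identifies the line with the heights of points of the
sphere $\mathbb S^n$, and turns $\widehat{\mathcal R}_\sigma(t-\tau)$, up to powers of $\cosh$, into
an average of $(1-z)^{-\gamma_\sigma}$, $z$ being an inner product of unit vectors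
(`one_sub_sphereInner_tanh`). The linearization at $V$ sends $V\cdot P(\tanh)$ to $V\cdot Q(\tanh)$,
where $Q$ is $p=\frac{n+2\sigma}{n-2\sigma}$ times the normalized zonal convolution of $P$ with that
kernel. Constants have eigenvalue $p$. Differentiation intertwines this convolution with the one of
exponent $\gamma_\sigma+1$ in two more dimensions (`derivative_sphereOpPoly`), and
$p\gamma_\sigma=\frac{n+2\sigma}{2}$ makes the resulting operator on $P'$ an average. The
translation mode $P=X$ has eigenvalue $1$. If $P$ is even, however, $P'$ is odd, the minimum of the
kernel may be subtracted without changing the result, and $P'$ is contracted by `gapRate` $<1$ in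
the sup norm. Since the linearization is self-adjoint in $L^2(f_\sigma'(V)\,dt)$ and the functions
$V\cdot P(\tanh)$ are dense, this decay bounds its norm off the bubble direction
(`norm_le_of_pow_decay`). As $p\ne1$, `isUnit_one_sub_linOp` follows.

Transfer. Written with respect to the same measure, the linearizations at $W$ have uniformly bounded
kernels converging pointwise as $L\to\infty$, so they converge in Hilbert–Schmidt norm
(`exists_uniform_inverse`). Passing from $L^2$ to bounded continuous functions gives existence and
uniqueness in a sup-norm ball independent of $L$ (`exists_solution_near_tower`).

Residual. For $|t|\le L$ the interaction is of size $V^{p-1}(W-V)\lesssim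
e^{-\gamma_\sigma(2L-(2-p)|t|)}$, which yields $\xi=\min(1,p-1)$ (`derivBound_residual`). The
correction satisfies $\psi=\widehat{\mathcal R}_\sigma*(f_\sigma(W+\psi)-\sum_j f_\sigma(V_j))$, and
convolution gains a derivative, so a bootstrap bounds every derivative of $\psi$ by a multiple of
$e^{-\gamma_\sigma L(1+\xi)}$. This gives the Hölder bound, and the Sobolev bound up to a factor
$\sqrt L$. Positivity holds because $W\ge e^{-\gamma_\sigma L}$. A Sobolev embedding uniform in $L$
reduces uniqueness in $H^\sigma_L$ to uniqueness in the sup norm. -/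

namespace Delaunay

/-! ### Weighted bounds on derivatives -/

/-- `DerivBound U k u w`: on `U`, the function `u` is `k` times differentiable and its derivatives
of order at most `k` are bounded by the weight `w`. -/
def DerivBound (U : Set ℝ) : ℕ → (ℝ → ℝ) → (ℝ → ℝ) → Prop
  | 0, u, w => ∀ t ∈ U, |u t| ≤ w t
  | k + 1, u, w => (∀ t ∈ U, |u t| ≤ w t) ∧
      ∃ u' : ℝ → ℝ, (∀ t ∈ U, HasDerivAt u (u' t) t) ∧ DerivBound U k u' w

namespace DerivBound

variable {U : Set ℝ} {k : ℕ} {u v w z : ℝ → ℝ}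

lemma bound (h : DerivBound U k u w) : ∀ t ∈ U, |u t| ≤ w t := by
  cases k with
  | zero => exact h
  | succ k => exact h.1

lemma of_succ (h : DerivBound U (k + 1) u w) : DerivBound U k u w := by
  induction k generalizing u with
  | zero => exact h.1
  | succ k ih =>
    obtain ⟨hb, u', hu', h'⟩ := h
    exact ⟨hb, u', hu', ih h'⟩

lemma mono (h : DerivBound U k u w) (hw : ∀ t ∈ U, w t ≤ z t) : DerivBound U k u z := by
  induction k generalizing u with
  | zero => exact fun t ht => (h t ht).trans (hw t ht)
  | succ k ih =>
    obtain ⟨hb, u', hu', h'⟩ := h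
    exact ⟨fun t ht => (hb t ht).trans (hw t ht), u', hu', ih h'⟩

lemma mono_set {U' : Set ℝ} (h : DerivBound U k u w) (hU : U' ⊆ U) : DerivBound U' k u w := by
  induction k generalizing u with
  | zero => exact fun t ht => h t (hU ht)
  | succ k ih =>
    obtain ⟨hb, u', hu', h'⟩ := h
    exact ⟨fun t ht => hb t (hU ht), u', fun t ht => hu' t (hU ht), ih h'⟩

lemma add (hu : DerivBound U k u w) (hv : DerivBound U k v z) :
    DerivBound U k (fun t => u t + v t) (fun t => w t + z t) := by
  induction k generalizing u v with
  | zero => exact fun t ht => (abs_add_le _ _).trans (add_le_add (hu t ht) (hv t ht))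
  | succ k ih =>
    obtain ⟨hb, u', hu', h'⟩ := hu
    obtain ⟨hc, v', hv', h''⟩ := hv
    exact ⟨fun t ht => (abs_add_le _ _).trans (add_le_add (hb t ht) (hc t ht)), _,
      fun t ht => (hu' t ht).add (hv' t ht), ih h' h''⟩

lemma const_mul (c : ℝ) (hu : DerivBound U k u w) :
    DerivBound U k (fun t => c * u t) (fun t => |c| * w t) := by
  induction k generalizing u with
  | zero =>
    intro t ht
    rw [abs_mul]
    exact mul_le_mul_of_nonneg_left (hu t ht) (abs_nonneg c)
  | succ k ih =>
    obtain ⟨hb, u', hu', h'⟩ := hu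
    refine ⟨fun t ht => ?_, _, fun t ht => (hu' t ht).const_mul c, ih h'⟩
    rw [abs_mul]
    exact mul_le_mul_of_nonneg_left (hb t ht) (abs_nonneg c)

lemma sub (hu : DerivBound U k u w) (hv : DerivBound U k v z) :
    DerivBound U k (fun t => u t - v t) (fun t => w t + z t) := by
  simpa [sub_eq_add_neg] using hu.add (hv.const_mul (-1))

/-- The factor $2^k$ counts the terms produced by $k$ applications of the Leibniz rule. -/
lemma mul (hu : DerivBound U k u w) (hv : DerivBound U k v z) :
    DerivBound U k (fun t => u t * v t) (fun t => 2 ^ k * (w t * z t)) := by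
  have key : ∀ {k : ℕ} {u v : ℝ → ℝ}, DerivBound U k u w → DerivBound U k v z →
      ∀ t ∈ U, |u t * v t| ≤ 2 ^ k * (w t * z t) := by
    intro k u v hu hv t ht
    have h1 := hu.bound t ht
    have h2 := hv.bound t ht
    have h3 : |u t * v t| ≤ w t * z t := by
      rw [abs_mul]
      exact mul_le_mul h1 h2 (abs_nonneg _) ((abs_nonneg _).trans h1)
    have h4 : (1 : ℝ) ≤ 2 ^ k := one_le_pow₀ (by norm_num)
    nlinarith [(abs_nonneg _).trans h3]
  induction k generalizing u v with
  | zero => exact key hu hv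
  | succ k ih =>
    refine ⟨key hu hv, ?_⟩
    have hu0 := hu.of_succ
    have hv0 := hv.of_succ
    obtain ⟨hb, u', hu', h'⟩ := hu
    obtain ⟨hc, v', hv', h''⟩ := hv
    refine ⟨_, fun t ht => (hu' t ht).mul (hv' t ht), ?_⟩
    refine ((ih h' hv0).add (ih hu0 h'')).mono fun t _ => ?_
    rw [pow_succ]
    linarith

lemma iteratedDeriv_le (hU : IsOpen U) (h : DerivBound U k u w) {i : ℕ} (hi : i ≤ k) {t : ℝ}
    (ht : t ∈ U) : |iteratedDeriv i u t| ≤ w t := by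
  induction k generalizing u i with
  | zero =>
    obtain rfl : i = 0 := by omega
    simpa using h t ht
  | succ k ih =>
    cases i with
    | zero => simpa using h.1 t ht
    | succ i =>
      obtain ⟨-, u', hu', h'⟩ := h
      have he : deriv u =ᶠ[𝓝 t] u' := by
        filter_upwards [hU.mem_nhds ht] with y hy using (hu' y hy).deriv
      rw [iteratedDeriv_succ', he.iteratedDeriv_eq]
      exact ih h' (by omega)

lemma of_contDiff (hu : ContDiff ℝ k u) (h : ∀ i ≤ k, ∀ t ∈ U, |iteratedDeriv i u t| ≤ w t) :
    DerivBound U k u w := by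
  induction k generalizing u with
  | zero => exact fun t ht => by simpa using h 0 le_rfl t ht
  | succ k ih =>
    refine ⟨fun t ht => by simpa using h 0 (Nat.zero_le _) t ht, deriv u, fun t _ =>
      (hu.differentiable (by simp) t).hasDerivAt, ih ?_ fun i hi t ht => ?_⟩
    · exact ((contDiff_succ_iff_deriv (n := k)).1 (by exact_mod_cast hu)).2.2
    · rw [← iteratedDeriv_succ']
      exact h (i + 1) (by omega) t ht

end DerivBound

lemma abs_rpow_le_of_comparable {K x y : ℝ} (a : ℝ) (hy : 0 < y) (hx : x ≤ K * y)
    (hxy : y ≤ K * x) (hx0 : 0 < x) (hK : 0 < K) : x ^ a ≤ K ^ |a| * y ^ a := by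
  rcases le_total 0 a with ha | ha
  · rw [abs_of_nonneg ha, ← Real.mul_rpow hK.le hy.le]
    exact Real.rpow_le_rpow hx0.le hx ha
  · rw [abs_of_nonpos ha, Real.rpow_neg hK.le, inv_mul_eq_div, le_div_iff₀ (by positivity),
      ← Real.mul_rpow hx0.le hK.le]
    exact Real.rpow_le_rpow_of_nonpos hy (by linarith) ha

lemma abs_rpow_sub_rpow_le {K x y z q : ℝ} (a : ℝ) (hz : 0 < z) (hx : x ≤ K * z)
    (hzx : z ≤ K * x) (hy : y ≤ K * z) (hzy : z ≤ K * y) (hK : 0 < K) (hq : |x - y| ≤ q) :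
    |x ^ a - y ^ a| ≤ |a| * K ^ |a - 1| * (z ^ (a - 1) * q) := by
  have hpos : ∀ s ∈ Set.Icc (z / K) (K * z), 0 < s := fun s hs =>
    (div_pos hz hK).trans_le hs.1
  have hmem : ∀ s, s ≤ K * z → z ≤ K * s → s ∈ Set.Icc (z / K) (K * z) := fun s h1 h2 =>
    ⟨by rw [div_le_iff₀ hK]; linarith, h1⟩
  have h := (convex_Icc (z / K) (K * z)).norm_image_sub_le_of_norm_hasDerivWithin_le
    (f := fun s => s ^ a) (f' := fun s => a * s ^ (a - 1)) (C := |a| * K ^ |a - 1| * z ^ (a - 1))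
    (fun s hs => (Real.hasDerivAt_rpow_const (Or.inl (hpos s hs).ne')).hasDerivWithinAt)
    (fun s hs => by
      have hs0 := hpos s hs
      rw [Real.norm_eq_abs, abs_mul, abs_of_pos (Real.rpow_pos_of_pos hs0 _), mul_assoc]
      refine mul_le_mul_of_nonneg_left ?_ (abs_nonneg a)
      refine abs_rpow_le_of_comparable _ hz hs.2 ?_ hs0 hK
      have := hs.1
      rw [div_le_iff₀ hK] at this
      linarith)
    (hmem y hy hzy) (hmem x hx hzx)
  rw [Real.norm_eq_abs, Real.norm_eq_abs] at h
  refine h.trans ?_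
  rw [← mul_assoc]
  refine mul_le_mul_of_nonneg_left hq ?_
  have := Real.rpow_pos_of_pos hz (a - 1)
  have := Real.rpow_pos_of_pos hK |a - 1|
  positivity

namespace DerivBound

lemma pos_of_comparable {K x y : ℝ} (hK : 0 < K) (hx : 0 < x) (h : x ≤ K * y) : 0 < y := by
  by_contra! hy
  nlinarith

/-- Since $(v^a)'=a\,v^{a-1}v'$, the induction on $k$ must keep the exponent $a$ free. The constant
depends only on $k$, $K$ and $a$, hence not on the period when this is applied to towers. -/
lemma rpow (k : ℕ) {K : ℝ} (hK : 0 < K) : ∀ a : ℝ, ∃ C : ℝ, 0 < C ∧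
    ∀ (U : Set ℝ) (v ω : ℝ → ℝ), (∀ t ∈ U, 0 < ω t) → (∀ t ∈ U, ω t ≤ K * v t) →
      DerivBound U k v (fun t => K * ω t) →
      DerivBound U k (fun t => v t ^ a) (fun t => C * ω t ^ a) := by
  have base : ∀ (k : ℕ) (a : ℝ) (U : Set ℝ) (v ω : ℝ → ℝ), (∀ t ∈ U, 0 < ω t) →
      (∀ t ∈ U, ω t ≤ K * v t) → DerivBound U k v (fun t => K * ω t) →
      ∀ t ∈ U, |v t ^ a| ≤ K ^ |a| * ω t ^ a := by
    intro k a U v ω hω hlow hv t ht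
    have hv0 := pos_of_comparable hK (hω t ht) (hlow t ht)
    rw [abs_of_pos (Real.rpow_pos_of_pos hv0 _)]
    exact abs_rpow_le_of_comparable a (hω t ht) ((le_abs_self _).trans (hv.bound t ht))
      (hlow t ht) hv0 hK
  induction k with
  | zero =>
    intro a
    exact ⟨K ^ |a|, by positivity, fun U v ω hω hlow hv => base 0 a U v ω hω hlow hv⟩
  | succ k ih =>
    intro a
    obtain ⟨C, hC, h⟩ := ih (a - 1)
    refine ⟨max (K ^ |a|) (|a| * (2 ^ k * (C * K))), lt_max_of_lt_left (by positivity), ?_⟩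
    intro U v ω hω hlow hv
    refine ⟨fun t ht => (base _ a U v ω hω hlow hv t ht).trans ?_, ?_⟩
    · exact mul_le_mul_of_nonneg_right (le_max_left _ _) (Real.rpow_nonneg (hω t ht).le _)
    have h1 := h U v ω hω hlow hv.of_succ
    obtain ⟨-, v', hv', hv''⟩ := hv
    refine ⟨fun t => a * (v t ^ (a - 1) * v' t), fun t ht => ?_, ?_⟩
    · have hv0 := pos_of_comparable hK (hω t ht) (hlow t ht)
      convert (hv' t ht).rpow_const (p := a) (Or.inl hv0.ne') using 1
      ring
    · refine ((h1.mul hv'').const_mul a).mono fun t ht => ?_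
      have : ω t ^ a = ω t ^ (a - 1) * ω t := by
        rw [← Real.rpow_add_one (hω t ht).ne']; simp
      rw [this]
      have h0 := Real.rpow_pos_of_pos (hω t ht) (a - 1)
      have h2 := hω t ht
      calc |a| * (2 ^ k * (C * ω t ^ (a - 1) * (K * ω t)))
          = |a| * (2 ^ k * (C * K)) * (ω t ^ (a - 1) * ω t) := by ring
        _ ≤ _ := mul_le_mul_of_nonneg_right (le_max_right _ _) (by positivity)

/-- The derivative is $a\,(u^{a-1}(u'-v')+(u^{a-1}-v^{a-1})v')$. The first term is controlled by
`rpow`, the second by the induction hypothesis at exponent $a-1$. Keeping the weight $\omega^{a-1}q$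
is essential, because the functions compared are exponentially small between the bubbles. -/
lemma rpow_sub_rpow (k : ℕ) {K : ℝ} (hK : 0 < K) : ∀ a : ℝ, ∃ C : ℝ, 0 < C ∧
    ∀ (U : Set ℝ) (u v ω q : ℝ → ℝ), (∀ t ∈ U, 0 < ω t) → (∀ t ∈ U, ω t ≤ K * u t) →
      (∀ t ∈ U, ω t ≤ K * v t) →
      DerivBound U k u (fun t => K * ω t) → DerivBound U k v (fun t => K * ω t) →
      DerivBound U k (fun t => u t - v t) q →
      DerivBound U k (fun t => u t ^ a - v t ^ a) (fun t => C * (ω t ^ (a - 1) * q t)) := by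
  have base : ∀ (k : ℕ) (a : ℝ) (U : Set ℝ) (u v ω q : ℝ → ℝ), (∀ t ∈ U, 0 < ω t) →
      (∀ t ∈ U, ω t ≤ K * u t) → (∀ t ∈ U, ω t ≤ K * v t) →
      DerivBound U k u (fun t => K * ω t) → DerivBound U k v (fun t => K * ω t) →
      DerivBound U k (fun t => u t - v t) q →
      ∀ t ∈ U, |u t ^ a - v t ^ a| ≤ |a| * K ^ |a - 1| * (ω t ^ (a - 1) * q t) := by
    intro k a U u v ω q hω hu0 hv0 hu hv hq t ht
    exact abs_rpow_sub_rpow_le a (hω t ht) ((le_abs_self _).trans (hu.bound t ht)) (hu0 t ht)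
      ((le_abs_self _).trans (hv.bound t ht)) (hv0 t ht) hK (hq.bound t ht)
  induction k with
  | zero =>
    intro a
    refine ⟨|a| * K ^ |a - 1| + 1, by positivity, fun U u v ω q hω hu0 hv0 hu hv hq t ht =>
      (base 0 a U u v ω q hω hu0 hv0 hu hv hq t ht).trans ?_⟩
    have := Real.rpow_pos_of_pos (hω t ht) (a - 1)
    have := (abs_nonneg _).trans (hq.bound t ht)
    nlinarith [mul_nonneg (Real.rpow_pos_of_pos (hω t ht) (a - 1)).le this]
  | succ k ih =>
    intro a
    obtain ⟨C₁, hC₁, h₁⟩ := ih (a - 1)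
    obtain ⟨C₂, hC₂, h₂⟩ := rpow k hK (a - 1)
    refine ⟨max (|a| * K ^ |a - 1|) (|a| * (2 ^ k * C₂ + 2 ^ k * (C₁ * K))) + 1, by positivity,
      ?_⟩
    intro U u v ω q hω hu0 hv0 hu hv hq
    have hqn : ∀ t ∈ U, 0 ≤ ω t ^ (a - 1) * q t := fun t ht =>
      mul_nonneg (Real.rpow_nonneg (hω t ht).le _) ((abs_nonneg _).trans (hq.bound t ht))
    refine ⟨fun t ht => (base _ a U u v ω q hω hu0 hv0 hu hv hq t ht).trans ?_, ?_⟩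
    · refine mul_le_mul_of_nonneg_right ?_ (hqn t ht)
      exact (le_max_left _ _).trans (by linarith)
    have d := h₁ U u v ω q hω hu0 hv0 hu.of_succ hv.of_succ hq.of_succ
    have e := h₂ U u ω hω hu0 hu.of_succ
    obtain ⟨-, u', hu', -⟩ := hu
    obtain ⟨-, v', hv', hv''⟩ := hv
    obtain ⟨-, d', hd', hd''⟩ := hq
    have hd : ∀ t ∈ U, d' t = u' t - v' t := fun t ht =>
      (hd' t ht).unique ((hu' t ht).sub (hv' t ht))
    refine ⟨fun t => a * (u t ^ (a - 1) * d' t + (u t ^ (a - 1) - v t ^ (a - 1)) * v' t),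
      fun t ht => ?_, ?_⟩
    · have hu1 := pos_of_comparable hK (hω t ht) (hu0 t ht)
      have hv1 := pos_of_comparable hK (hω t ht) (hv0 t ht)
      refine (((hu' t ht).rpow_const (p := a) (Or.inl hu1.ne')).sub
        ((hv' t ht).rpow_const (p := a) (Or.inl hv1.ne'))).congr_deriv ?_
      simp only [hd t ht]
      ring
    · refine (((e.mul hd'').add (d.mul hv'')).const_mul a).mono fun t ht => ?_
      have : ω t ^ (a - 1) = ω t ^ (a - 1 - 1) * ω t := by
        rw [← Real.rpow_add_one (hω t ht).ne']; simp
      calc |a| * (2 ^ k * (C₂ * ω t ^ (a - 1) * q t) +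
            2 ^ k * (C₁ * (ω t ^ (a - 1 - 1) * q t) * (K * ω t)))
          = |a| * (2 ^ k * C₂ + 2 ^ k * (C₁ * K)) * (ω t ^ (a - 1) * q t) := by
            rw [this]; ring
        _ ≤ _ := mul_le_mul_of_nonneg_right ((le_max_right _ _).trans (by linarith)) (hqn t ht)

end DerivBound

end Delaunay


/-! ### Bubbles, towers and their derivatives -/

namespace Delaunay

section Towers

open Polynomial

lemma cosh_rpow_neg_le {a : ℝ} (ha : 0 < a) (t : ℝ) :
    Real.cosh t ^ (-a) ≤ 2 ^ a * Real.exp (-(a * |t|)) := by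
  have h : Real.exp |t| / 2 ≤ Real.cosh t := by
    rw [← Real.cosh_abs, Real.cosh_eq]
    have := Real.exp_pos (-|t|)
    linarith
  calc Real.cosh t ^ (-a) ≤ (Real.exp |t| / 2) ^ (-a) :=
        Real.rpow_le_rpow_of_nonpos (by positivity) h (by linarith)
    _ = 2 ^ a * Real.exp (-(a * |t|)) := by
        rw [Real.div_rpow (Real.exp_pos _).le (by norm_num), ← Real.exp_mul, Real.rpow_neg (by norm_num),
          div_inv_eq_mul, mul_comm]
        congr 2
        ring

lemma exp_le_cosh_rpow_neg {a : ℝ} (ha : 0 < a) (t : ℝ) :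
    Real.exp (-(a * |t|)) ≤ Real.cosh t ^ (-a) := by
  have h : Real.cosh t ≤ Real.exp |t| := by
    rw [← Real.cosh_abs, Real.cosh_eq]
    have : Real.exp (-|t|) ≤ Real.exp |t| := Real.exp_le_exp.2 (by linarith [abs_nonneg t])
    linarith
  calc Real.exp (-(a * |t|)) = (Real.exp |t|) ^ (-a) := by
        rw [← Real.exp_mul]; congr 1; ring
    _ ≤ _ := Real.rpow_le_rpow_of_nonpos (Real.cosh_pos t) h (by linarith)

lemma cosh_rpow_neg_pos (a t : ℝ) : 0 < Real.cosh t ^ (-a) :=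
  Real.rpow_pos_of_pos (Real.cosh_pos t) _

lemma cosh_rpow_neg_le_one {a : ℝ} (ha : 0 < a) (t : ℝ) : Real.cosh t ^ (-a) ≤ 1 :=
  Real.rpow_le_one_of_one_le_of_nonpos (Real.one_le_cosh t) (by linarith)

/-- The function `cosh^{-a} P(tanh)`. -/
noncomputable def coshPoly (a : ℝ) (P : ℝ[X]) (t : ℝ) : ℝ :=
  Real.cosh t ^ (-a) * P.eval (Real.tanh t)

/-- The operator on polynomials induced by differentiating `coshPoly a`. -/
noncomputable def coshPolyDeriv (a : ℝ) (P : ℝ[X]) : ℝ[X] :=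
  (1 - X ^ 2) * derivative P - C a * (X * P)

lemma hasDerivAt_tanh (t : ℝ) : HasDerivAt Real.tanh (1 - Real.tanh t ^ 2) t := by
  have h := (Real.hasDerivAt_sinh t).div (Real.hasDerivAt_cosh t) (Real.cosh_pos t).ne'
  have e : Real.tanh = fun x => Real.sinh x / Real.cosh x := funext Real.tanh_eq_sinh_div_cosh
  rw [e]
  refine h.congr_deriv ?_
  have := (Real.cosh_pos t).ne'
  field_simp

lemma abs_tanh_lt_one (t : ℝ) : |Real.tanh t| < 1 := by
  rw [Real.tanh_eq_sinh_div_cosh, abs_div, abs_of_pos (Real.cosh_pos t),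
    div_lt_one (Real.cosh_pos t)]
  have := Real.cosh_sq t
  have := Real.cosh_pos t
  exact abs_lt_of_sq_lt_sq (by linarith) this.le

/-- Because $\tanh'=1-\tanh^2$, the class $\cosh^{-a}P(\tanh)$ is stable under differentiation.
Every derivative of a bubble is thus dominated by the bubble itself. -/
lemma hasDerivAt_coshPoly (a : ℝ) (P : ℝ[X]) (t : ℝ) :
    HasDerivAt (coshPoly a P) (coshPoly a (coshPolyDeriv a P) t) t := by
  have h1 := (Real.hasDerivAt_cosh t).rpow_const (p := -a) (Or.inl (Real.cosh_pos t).ne')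
  have h2 := (P.hasDerivAt (Real.tanh t)).comp t (hasDerivAt_tanh t)
  refine (h1.mul h2).congr_deriv ?_
  have h3 : Real.cosh t ^ (-a - 1) = Real.cosh t ^ (-a) / Real.cosh t := by
    rw [Real.rpow_sub_one (Real.cosh_pos t).ne']
  have := (Real.cosh_pos t).ne'
  simp only [coshPoly, coshPolyDeriv, Function.comp, eval_sub, eval_mul, eval_C, eval_X, eval_pow,
    eval_one, h3]
  rw [Real.tanh_eq_sinh_div_cosh]
  field_simp
  ring

lemma exists_bound_eval_tanh (P : ℝ[X]) : ∃ C, 0 < C ∧ ∀ t, |P.eval (Real.tanh t)| ≤ C := by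
  obtain ⟨C, hC⟩ := (isCompact_Icc (a := (-1 : ℝ)) (b := 1)).exists_bound_of_continuousOn
    (f := fun x => P.eval x) P.continuous.continuousOn
  refine ⟨|C| + 1, by positivity, fun t => ?_⟩
  have := hC (Real.tanh t) (abs_le.1 (abs_tanh_lt_one t).le)
  rw [Real.norm_eq_abs] at this
  linarith [le_abs_self C]

lemma exists_abs_coshPoly_le (a : ℝ) (P : ℝ[X]) :
    ∃ C, 0 < C ∧ ∀ t, |coshPoly a P t| ≤ C * Real.cosh t ^ (-a) := by
  obtain ⟨C, hC, h⟩ := exists_bound_eval_tanh P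
  refine ⟨C, hC, fun t => ?_⟩
  rw [coshPoly, abs_mul, abs_of_pos (cosh_rpow_neg_pos a t), mul_comm]
  exact mul_le_mul_of_nonneg_right (h t) (cosh_rpow_neg_pos a t).le

lemma summable_exp_natAbs {a : ℝ} (ha : 0 < a) :
    Summable fun j : ℤ => Real.exp (-(a * |(j : ℝ)|)) := by
  have h : Summable fun j : ℕ => Real.exp (-(a * (j : ℝ))) := by
    have := Real.summable_exp_nat_mul_iff.2 (show -a < 0 by linarith)
    refine this.congr fun j => ?_
    congr 1; ring
  refine Summable.of_nat_of_neg ?_ ?_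
  · simpa using h
  · simpa using h

lemma exp_shift_le {a L : ℝ} (ha : 0 < a) (hL : 0 < L) (t : ℝ) (j : ℤ) :
    Real.exp (-(a * |t - 2 * (j : ℝ) * L|)) ≤
      Real.exp (a * |t|) * Real.exp (-(2 * a * L * |(j : ℝ)|)) := by
  rw [← Real.exp_add, Real.exp_le_exp]
  have h1 : |2 * (j : ℝ) * L| = 2 * L * |(j : ℝ)| := by
    rw [abs_mul, abs_mul, abs_of_pos hL, abs_two]; ring
  have h2 := abs_sub_abs_le_abs_sub (2 * (j : ℝ) * L) t
  rw [h1, abs_sub_comm] at h2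
  nlinarith

lemma cosh_shift_le {a L : ℝ} (ha : 0 < a) (hL : 0 < L) (t : ℝ) (j : ℤ) :
    Real.cosh (t - 2 * (j : ℝ) * L) ^ (-a) ≤
      2 ^ a * (Real.exp (a * |t|) * Real.exp (-(2 * a * L * |(j : ℝ)|))) :=
  (cosh_rpow_neg_le ha _).trans (mul_le_mul_of_nonneg_left (exp_shift_le ha hL t j) (by positivity))

lemma summable_cosh_shift {a L : ℝ} (ha : 0 < a) (hL : 0 < L) (t : ℝ) :
    Summable fun j : ℤ => Real.cosh (t - 2 * (j : ℝ) * L) ^ (-a) :=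
  Summable.of_nonneg_of_le (fun j => (cosh_rpow_neg_pos a _).le) (cosh_shift_le ha hL t)
    (((summable_exp_natAbs (by positivity : 0 < 2 * a * L)).mul_left _).mul_left _)

lemma summable_coshPoly_shift {a L : ℝ} (ha : 0 < a) (hL : 0 < L) (P : ℝ[X]) (t : ℝ) :
    Summable fun j : ℤ => coshPoly a P (t - 2 * (j : ℝ) * L) := by
  obtain ⟨C, hC, h⟩ := exists_abs_coshPoly_le a P
  exact Summable.of_norm_bounded ((summable_cosh_shift ha hL t).mul_left C) fun j => h _

lemma abs_tsum_le_tsum {ι : Type*} {f g : ι → ℝ} (hg : Summable g) (h : ∀ i, |f i| ≤ g i) :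
    |∑' i, f i| ≤ ∑' i, g i :=
  tsum_of_norm_bounded (f := f) hg.hasSum h

/-- The `2L`-periodization of `coshPoly a P`. -/
noncomputable def tower (a : ℝ) (P : ℝ[X]) (L t : ℝ) : ℝ :=
  ∑' j : ℤ, coshPoly a P (t - 2 * (j : ℝ) * L)

lemma coshPoly_one (a t : ℝ) : coshPoly a 1 t = Real.cosh t ^ (-a) := by simp [coshPoly]

lemma bubbleTower_eq_tower (n : ℕ) (σ L : ℝ) :
    bubbleTower n σ L = tower (fowlerExp n σ) 1 L := by
  ext t
  simp [bubbleTower, tower, bubble, coshPoly_one]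

lemma hasDerivAt_tower {a L : ℝ} (ha : 0 < a) (hL : 0 < L) (P : ℝ[X]) (t : ℝ) :
    HasDerivAt (tower a P L) (tower a (coshPolyDeriv a P) L t) t := by
  obtain ⟨C, hC, h⟩ := exists_abs_coshPoly_le a (coshPolyDeriv a P)
  have hs : Summable fun j : ℤ =>
      C * (2 ^ a * (Real.exp (a * (|t| + 1)) * Real.exp (-(2 * a * L * |(j : ℝ)|)))) :=
    (((summable_exp_natAbs (by positivity : 0 < 2 * a * L)).mul_left _).mul_left _).mul_left _
  refine hasDerivAt_tsum_of_isPreconnected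
    (g := fun (j : ℤ) (y : ℝ) => coshPoly a P (y - 2 * (j : ℝ) * L))
    (g' := fun (j : ℤ) (y : ℝ) => coshPoly a (coshPolyDeriv a P) (y - 2 * (j : ℝ) * L))
    (t := Metric.ball t 1) (y₀ := t) hs Metric.isOpen_ball
    (convex_ball t 1).isPreconnected (fun j y _ => ?_) (fun j y hy => ?_)
    (Metric.mem_ball_self one_pos) (summable_coshPoly_shift ha hL P t) (Metric.mem_ball_self one_pos)
  · exact (hasDerivAt_coshPoly a P (y - 2 * (j : ℝ) * L)).comp_sub_const y (2 * (j : ℝ) * L)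
  · rw [Real.norm_eq_abs]
    refine (h _).trans (mul_le_mul_of_nonneg_left ((cosh_shift_le ha hL y j).trans ?_) hC.le)
    have h1 : |y| ≤ |t| + 1 := by
      rw [Metric.mem_ball, Real.dist_eq] at hy
      have := abs_sub_abs_le_abs_sub y t
      linarith
    gcongr

lemma deriv_tower {a L : ℝ} (ha : 0 < a) (hL : 0 < L) (P : ℝ[X]) :
    deriv (tower a P L) = tower a (coshPolyDeriv a P) L :=
  funext fun t => (hasDerivAt_tower ha hL P t).deriv

lemma contDiff_tower {a L : ℝ} (ha : 0 < a) (hL : 0 < L) (k : ℕ) (P : ℝ[X]) :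
    ContDiff ℝ k (tower a P L) := by
  induction k generalizing P with
  | zero =>
    exact contDiff_zero.2 (continuous_iff_continuousAt.2 fun t =>
      (hasDerivAt_tower ha hL P t).continuousAt)
  | succ k ih =>
    have := (contDiff_succ_iff_deriv (n := k) (f := tower a P L)).2
      ⟨fun t => (hasDerivAt_tower ha hL P t).differentiableAt, by simp, by
        rw [deriv_tower ha hL]; exact ih _⟩
    exact_mod_cast this

lemma tower_periodic (a : ℝ) (P : ℝ[X]) (L : ℝ) : Function.Periodic (tower a P L) (2 * L) := by
  intro t
  rw [tower, tower, ← (Equiv.addRight (1 : ℤ)).tsum_eq]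
  refine tsum_congr fun j => ?_
  congr 1
  simp only [Equiv.coe_addRight]
  push_cast
  ring

lemma tower_one_even (a L t : ℝ) : tower a 1 L (-t) = tower a 1 L t := by
  rw [tower, tower, ← (Equiv.neg ℤ).tsum_eq]
  refine tsum_congr fun j => ?_
  rw [coshPoly_one, coshPoly_one, ← Real.cosh_neg]
  congr 2
  simp only [Equiv.neg_apply]
  push_cast
  ring

lemma cosh_le_tower {a L : ℝ} (ha : 0 < a) (hL : 0 < L) (t : ℝ) (j : ℤ) :
    Real.cosh (t - 2 * (j : ℝ) * L) ^ (-a) ≤ tower a 1 L t := by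
  simp only [tower, coshPoly_one]
  exact (summable_cosh_shift ha hL t).le_tsum j fun i _ => (cosh_rpow_neg_pos a _).le

lemma tower_one_pos {a L : ℝ} (ha : 0 < a) (hL : 0 < L) (t : ℝ) : 0 < tower a 1 L t :=
  (cosh_rpow_neg_pos a _).trans_le (cosh_le_tower ha hL t 0)

/-- The constant is a bound for $P$ on $[-1,1]$, so it serves all periods. The second estimate is
the first one with the central term $j=0$ removed from both sums. -/
lemma exists_abs_tower_le (a : ℝ) (P : ℝ[X]) : ∃ C, 0 < C ∧ ∀ L, 0 < L → 0 < a → ∀ t,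
    |tower a P L t| ≤ C * tower a 1 L t ∧
    |tower a P L t - coshPoly a P t| ≤ C * (tower a 1 L t - Real.cosh t ^ (-a)) := by
  obtain ⟨C, hC, h⟩ := exists_abs_coshPoly_le a P
  refine ⟨C, hC, fun L hL ha t => ⟨?_, ?_⟩⟩
  · simp only [tower, coshPoly_one]
    rw [← tsum_mul_left]
    exact abs_tsum_le_tsum ((summable_cosh_shift ha hL t).mul_left C) fun j => h _
  · have hc := summable_cosh_shift ha hL t
    have e1 := (summable_coshPoly_shift ha hL P t).tsum_eq_add_tsum_ite 0
    have e2 := hc.tsum_eq_add_tsum_ite 0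
    have f1 : tower a P L t - coshPoly a P t =
        ∑' j : ℤ, if j = 0 then 0 else coshPoly a P (t - 2 * (j : ℝ) * L) := by
      simp only [tower]
      rw [e1]
      simp
    have f2 : tower a 1 L t - Real.cosh t ^ (-a) =
        ∑' j : ℤ, if j = 0 then 0 else Real.cosh (t - 2 * (j : ℝ) * L) ^ (-a) := by
      simp only [tower, coshPoly_one]
      rw [e2]
      simp
    rw [f1, f2]
    have hs : Summable fun j : ℤ => if j = 0 then 0 else
        Real.cosh (t - 2 * (j : ℝ) * L) ^ (-a) := by
      refine Summable.of_nonneg_of_le (fun j => ?_) (fun j => ?_) hc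
      · split_ifs
        · exact le_rfl
        · exact (cosh_rpow_neg_pos a _).le
      · split_ifs
        · exact (cosh_rpow_neg_pos a _).le
        · exact le_rfl
    rw [← tsum_mul_left]
    refine abs_tsum_le_tsum (hs.mul_left C) fun j => ?_
    split_ifs
    · simp
    · exact h _

/-- The dominant neighbours are those at $\pm2L$. The further ones are summed by a geometric series
that no longer depends on $L$. -/
lemma exists_tower_sub_le {a : ℝ} (ha : 0 < a) : ∃ C, 0 < C ∧ ∀ L, 1 ≤ L → ∀ t,
    tower a 1 L t - Real.cosh t ^ (-a) ≤ C * Real.exp (-(a * (2 * L - |t|))) := by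
  have hs := summable_exp_natAbs (by positivity : 0 < 2 * a)
  refine ⟨2 ^ a * (Real.exp (2 * a) * ∑' j : ℤ, Real.exp (-(2 * a * |(j : ℝ)|))), ?_, ?_⟩
  · have := hs.tsum_pos (fun j => (Real.exp_pos _).le) 0 (Real.exp_pos _)
    positivity
  intro L hL t
  have hL0 : 0 < L := by linarith
  have hc := summable_cosh_shift ha hL0 t
  have e2 := hc.tsum_eq_add_tsum_ite 0
  have f2 : tower a 1 L t - Real.cosh t ^ (-a) =
      ∑' j : ℤ, if j = 0 then 0 else Real.cosh (t - 2 * (j : ℝ) * L) ^ (-a) := by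
    simp only [tower, coshPoly_one]
    rw [e2]
    simp
  rw [f2]
  rw [← tsum_mul_left, ← tsum_mul_left, ← tsum_mul_right]
  refine (le_abs_self _).trans (abs_tsum_le_tsum (((hs.mul_left _).mul_left _).mul_right _)
    fun j => ?_)
  split_ifs with hj
  · simp only [abs_zero]; positivity
  · rw [abs_of_pos (cosh_rpow_neg_pos a _)]
    refine (cosh_shift_le ha hL0 t j).trans ?_
    rw [mul_assoc ((2 : ℝ) ^ a)]
    refine mul_le_mul_of_nonneg_left ?_ (by positivity)
    rw [← Real.exp_add, ← Real.exp_add, ← Real.exp_add, Real.exp_le_exp]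
    have h1 : (1 : ℝ) ≤ |(j : ℝ)| := by
      exact_mod_cast Int.one_le_abs hj
    -- Twice this product is the slack in the comparison of exponents, $2L|j|\ge 2L+2|j|-2$. Here
    -- $L\ge1$ and $j\ne0$ enter.
    have : 0 ≤ a * ((L - 1) * (|(j : ℝ)| - 1)) := by
      have := sub_nonneg.2 hL
      have := sub_nonneg.2 h1
      positivity
    nlinarith

lemma exists_abs_sub_period_le {L : ℝ} (hL : 0 < L) (t : ℝ) :
    ∃ j : ℤ, |t - 2 * (j : ℝ) * L| ≤ L := by
  refine ⟨round (t / (2 * L)), ?_⟩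
  have h := abs_sub_round (t / (2 * L))
  have e : t - 2 * (round (t / (2 * L)) : ℝ) * L =
      2 * L * (t / (2 * L) - round (t / (2 * L))) := by
    field_simp
  rw [e, abs_mul, abs_of_pos (by positivity : 0 < 2 * L)]
  nlinarith

/-- Every point lies within distance $L$ of the centre of some bubble. -/
lemma exp_le_tower {a L : ℝ} (ha : 0 < a) (hL : 0 < L) (t : ℝ) :
    Real.exp (-(a * L)) ≤ tower a 1 L t := by
  obtain ⟨j, hj⟩ := exists_abs_sub_period_le hL t
  refine le_trans ?_ ((exp_le_cosh_rpow_neg ha _).trans (cosh_le_tower ha hL t j))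
  rw [Real.exp_le_exp]
  nlinarith

lemma _root_.Function.Periodic.sub_two_mul_int {α : Type*} {u : ℝ → α} {L : ℝ}
    (hu : Function.Periodic u (2 * L)) (t : ℝ) (j : ℤ) : u (t - 2 * (j : ℝ) * L) = u t := by
  have := hu.sub_zsmul_eq (x := t) j
  rw [← this]
  congr 1
  simp
  ring

lemma exists_tower_le {a : ℝ} (ha : 0 < a) : ∃ C, 0 < C ∧ ∀ L, 1 ≤ L → ∀ t,
    tower a 1 L t ≤ C := by
  obtain ⟨C, hC, h⟩ := exists_tower_sub_le ha
  refine ⟨1 + C, by positivity, fun L hL t => ?_⟩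
  obtain ⟨j, hj⟩ := exists_abs_sub_period_le (by linarith : 0 < L) t
  rw [← (tower_periodic a 1 L).sub_two_mul_int t j]
  have h1 := h L hL (t - 2 * (j : ℝ) * L)
  have h2 := cosh_rpow_neg_le_one ha (t - 2 * (j : ℝ) * L)
  have h3 : Real.exp (-(a * (2 * L - |t - 2 * (j : ℝ) * L|))) ≤ 1 := by
    rw [Real.exp_le_one_iff]
    have : 0 ≤ a * (2 * L - |t - 2 * (j : ℝ) * L|) := mul_nonneg ha.le (by linarith)
    linarith
  nlinarith

lemma derivBound_tower {a : ℝ} (ha : 0 < a) (k : ℕ) (P : ℝ[X]) : ∃ C, 0 < C ∧ ∀ L, 0 < L →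
    DerivBound Set.univ k (tower a P L) (fun t => C * tower a 1 L t) ∧
    DerivBound Set.univ k (fun t => tower a P L t - coshPoly a P t)
      (fun t => C * (tower a 1 L t - Real.cosh t ^ (-a))) ∧
    DerivBound Set.univ k (coshPoly a P) (fun t => C * Real.cosh t ^ (-a)) := by
  induction k generalizing P with
  | zero =>
    obtain ⟨C, hC, h⟩ := exists_abs_tower_le a P
    obtain ⟨C', hC', h'⟩ := exists_abs_coshPoly_le a P
    refine ⟨C + C', by positivity, fun L hL =>
      ⟨fun t _ => ((h L hL ha t).1).trans ?_, fun t _ => ((h L hL ha t).2).trans ?_,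
        fun t _ => (h' t).trans ?_⟩⟩
    · nlinarith [tower_one_pos ha hL t]
    · have := cosh_le_tower ha hL t 0
      simp only [Int.cast_zero, mul_zero, zero_mul, sub_zero] at this
      nlinarith
    · nlinarith [cosh_rpow_neg_pos a t]
  | succ k ih =>
    obtain ⟨C, hC, h⟩ := exists_abs_tower_le a P
    obtain ⟨C', hC', h'⟩ := exists_abs_coshPoly_le a P
    obtain ⟨B, hB, ih⟩ := ih (coshPolyDeriv a P)
    refine ⟨C + C' + B, by positivity, fun L hL => ?_⟩
    obtain ⟨i1, i2, i3⟩ := ih L hL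
    have p1 := fun t => tower_one_pos ha hL t
    have p2 : ∀ t, 0 ≤ tower a 1 L t - Real.cosh t ^ (-a) := fun t => by
      have := cosh_le_tower ha hL t 0
      simp only [Int.cast_zero, mul_zero, zero_mul, sub_zero] at this
      linarith
    have p3 := cosh_rpow_neg_pos a
    refine ⟨⟨fun t _ => ((h L hL ha t).1).trans ?_, _, fun t _ => hasDerivAt_tower ha hL P t,
        i1.mono fun t _ => ?_⟩, ⟨fun t _ => ((h L hL ha t).2).trans ?_, _,
        fun t _ => (hasDerivAt_tower ha hL P t).sub (hasDerivAt_coshPoly a P t),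
        i2.mono fun t _ => ?_⟩, ⟨fun t _ => (h' t).trans ?_, _,
        fun t _ => hasDerivAt_coshPoly a P t, i3.mono fun t _ => ?_⟩⟩
    · nlinarith [p1 t]
    · nlinarith [p1 t]
    · nlinarith [p2 t]
    · nlinarith [p2 t]
    · nlinarith [p3 t]
    · nlinarith [p3 t]

end Towers

end Delaunay


/-! ### The sphere in height coordinates and its exchange symmetry -/

namespace Delaunay

/-- The measure `(1 - z²)^b dz` on `(-1, 1)`. -/
noncomputable def ultraMeasure (b : ℝ) : Measure ℝ :=
  (volume.restrict (Set.Ioo (-1) 1)).withDensity fun z => ENNReal.ofReal ((1 - z ^ 2) ^ b)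

/-- The measure of the unit sphere in the coordinates `(y, ζ)`, where `y` is the height and `ζ` is
the height of the horizontal direction. -/
noncomputable def sphereMeasure (b : ℝ) : Measure (ℝ × ℝ) :=
  (ultraMeasure (b + 1 / 2)).prod (ultraMeasure b)

instance (b : ℝ) : SFinite (ultraMeasure b) := by unfold ultraMeasure; infer_instance

/-- The inner product of two unit vectors of heights `x` and `y` whose horizontal directions have
inner product `ζ`. -/
noncomputable def sphereInner (x y ζ : ℝ) : ℝ :=
  x * y + ζ * (Real.sqrt (1 - x ^ 2) * Real.sqrt (1 - y ^ 2))

@[fun_prop]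
lemma continuous_sphereInner : Continuous fun q : ℝ × ℝ × ℝ => sphereInner q.1 q.2.1 q.2.2 := by
  unfold sphereInner; fun_prop

lemma measurable_sphereInner (x : ℝ) : Measurable fun q : ℝ × ℝ => sphereInner x q.1 q.2 :=
  (continuous_sphereInner.comp (by fun_prop : Continuous fun q : ℝ × ℝ => (x, q))).measurable

lemma lintegral_ultraMeasure {b : ℝ} {f : ℝ → ℝ≥0∞} (hf : Measurable f) :
    ∫⁻ z, f z ∂ultraMeasure b =
      ∫⁻ z, (Set.Ioo (-1) 1).indicator (fun z => ENNReal.ofReal ((1 - z ^ 2) ^ b) * f z) z := by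
  rw [ultraMeasure, lintegral_withDensity_eq_lintegral_mul _ (by fun_prop) hf,
    lintegral_indicator measurableSet_Ioo]
  rfl

lemma lintegral_comp_affine {f : ℝ → ℝ≥0∞} (hf : Measurable f) {c : ℝ} (hc : 0 < c) (d : ℝ) :
    ∫⁻ ζ, f (d + ζ * c) = ENNReal.ofReal c⁻¹ * ∫⁻ z, f z := by
  have h1 : ∫⁻ ζ, f (d + ζ * c) = ∫⁻ z, f (d + z) ∂(Measure.map (fun x : ℝ => x * c) volume) :=
    (lintegral_map (f := fun z => f (d + z)) (by fun_prop) (by fun_prop)).symm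
  rw [h1, Real.map_volume_mul_right hc.ne', lintegral_smul_measure, abs_of_pos (by positivity),
    lintegral_add_left_eq_self (fun z => f z) d]
  rfl

/-- The Gram determinant of three unit vectors with pairwise inner products `x`, `y`, `z`. -/
noncomputable def gramDet (x y z : ℝ) : ℝ := 1 - x ^ 2 - y ^ 2 - z ^ 2 + 2 * x * y * z

/-- The joint density of the heights of a random point over two points with inner product `x`. -/
noncomputable def heightDensity (b x y z : ℝ) : ℝ≥0∞ :=
  if |y| < 1 ∧ 0 < gramDet x y z then
    ENNReal.ofReal (gramDet x y z ^ b * (1 - x ^ 2) ^ (-(b + 1 / 2))) else 0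

/-- The Gram determinant is symmetric and also equals $(1-y^2)(1-z^2)-(x-yz)^2$. If it is positive
and $|y|<1$, then $|z|<1$ as well, so the condition on $y$ is symmetric too. -/
lemma heightDensity_symm (b x y z : ℝ) : heightDensity b x y z = heightDensity b x z y := by
  have e : gramDet x y z = gramDet x z y := by unfold gramDet; ring
  have key : ∀ y z : ℝ, |y| < 1 → 0 < gramDet x y z → |z| < 1 := by
    intro y z hy h
    unfold gramDet at h
    rw [← sq_lt_one_iff_abs_lt_one] at hy ⊢
    nlinarith [sq_nonneg (x - y * z), sq_nonneg (z - x * y), sq_nonneg (x * y - z)]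
  unfold heightDensity
  rw [← e]
  by_cases h : 0 < gramDet x y z
  · have : |y| < 1 ↔ |z| < 1 := ⟨fun hy => key y z hy h, fun hz => key z y hz (e ▸ h)⟩
    simp only [this]
  · simp [h]

lemma measurable_heightDensity (b x : ℝ) :
    Measurable fun q : ℝ × ℝ => heightDensity b x q.1 q.2 := by
  unfold heightDensity gramDet
  refine Measurable.ite ?_ (by fun_prop) measurable_const
  have h1 : MeasurableSet {q : ℝ × ℝ | |q.1| < 1} :=
    measurableSet_lt (by fun_prop) measurable_const
  have h2 : MeasurableSet {q : ℝ × ℝ |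
      0 < 1 - x ^ 2 - q.1 ^ 2 - q.2 ^ 2 + 2 * x * q.1 * q.2} :=
    measurableSet_lt measurable_const (by fun_prop)
  exact h1.inter h2

/-- For fixed $y$, substitute $z=xy+\zeta c$ with $c=\sqrt{(1-x^2)(1-y^2)}$. Then $1-\zeta^2$ is the
Gram determinant over $c^2$. The exponent $b+\frac12$ of the height weight is exactly the one for
which all powers of $1-y^2$ cancel. -/
lemma lintegral_sphereMeasure {b x : ℝ} (hx : |x| < 1) {H : ℝ × ℝ → ℝ≥0∞} (hH : Measurable H) :
    ∫⁻ q, H (q.1, sphereInner x q.1 q.2) ∂sphereMeasure b =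
      ∫⁻ y, ∫⁻ z, heightDensity b x y z * H (y, z) := by
  have hm : Measurable fun q : ℝ × ℝ => (q.1, sphereInner x q.1 q.2) :=
    measurable_fst.prodMk (measurable_sphereInner x)
  have hHm : Measurable fun q : ℝ × ℝ => H (q.1, sphereInner x q.1 q.2) := hH.comp hm
  rw [sphereMeasure, lintegral_prod _ hHm.aemeasurable,
    lintegral_ultraMeasure hHm.lintegral_prod_right']
  refine lintegral_congr fun y => ?_
  by_cases hy : y ∈ Set.Ioo (-1 : ℝ) 1
  swap
  · rw [Set.indicator_of_notMem hy]
    have : ¬ |y| < 1 := fun h => hy (abs_lt.1 h)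
    simp [heightDensity, this]
  rw [Set.indicator_of_mem hy]
  have hy' : |y| < 1 := abs_lt.2 hy
  have hx2 : 0 < 1 - x ^ 2 := sub_pos.2 ((sq_lt_one_iff_abs_lt_one x).2 hx)
  have hy2 : 0 < 1 - y ^ 2 := sub_pos.2 ((sq_lt_one_iff_abs_lt_one y).2 hy')
  set c := Real.sqrt (1 - x ^ 2) * Real.sqrt (1 - y ^ 2) with hc
  have hc0 : 0 < c := mul_pos (Real.sqrt_pos.2 hx2) (Real.sqrt_pos.2 hy2)
  have hcsq : c ^ 2 = (1 - x ^ 2) * (1 - y ^ 2) := by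
    rw [hc, mul_pow, Real.sq_sqrt hx2.le, Real.sq_sqrt hy2.le]
  have hHy : Measurable fun z => H (y, z) := hH.comp (by fun_prop)
  have hG : Measurable fun z : ℝ => (Set.Ioo (-1 : ℝ) 1).indicator
      (fun ζ => ENNReal.ofReal ((1 - ζ ^ 2) ^ b)) ((z - x * y) / c) * H (y, z) := by
    refine Measurable.mul ?_ hHy
    exact (Measurable.indicator (by fun_prop) measurableSet_Ioo).comp (by fun_prop)
  have h1 : ∫⁻ ζ, H (y, sphereInner x y ζ) ∂ultraMeasure b =
      ENNReal.ofReal c⁻¹ * ∫⁻ z, (Set.Ioo (-1 : ℝ) 1).indicator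
        (fun ζ => ENNReal.ofReal ((1 - ζ ^ 2) ^ b)) ((z - x * y) / c) * H (y, z) := by
    rw [← lintegral_comp_affine hG hc0 (x * y),
      lintegral_ultraMeasure (f := fun ζ => H (y, sphereInner x y ζ))
        (hHm.comp (measurable_const.prodMk measurable_id))]
    refine lintegral_congr fun ζ => ?_
    have e1 : (x * y + ζ * c - x * y) / c = ζ := by field_simp; ring
    have e2 : sphereInner x y ζ = x * y + ζ * c := rfl
    rw [e1, Set.indicator_mul_left, e2]
  rw [h1, ← lintegral_const_mul _ hG, ← lintegral_const_mul _ (by fun_prop)]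
  refine lintegral_congr fun z => ?_
  rw [← mul_assoc, ← mul_assoc]
  congr 1
  have hgram : gramDet x y z = c ^ 2 - (z - x * y) ^ 2 := by rw [hcsq, gramDet]; ring
  have hiff : (z - x * y) / c ∈ Set.Ioo (-1 : ℝ) 1 ↔ 0 < gramDet x y z := by
    rw [hgram, Set.mem_Ioo, ← abs_lt, sub_pos, sq_lt_sq, abs_div, abs_of_pos hc0, div_lt_one hc0]
  by_cases h : 0 < gramDet x y z
  · rw [Set.indicator_of_mem (hiff.2 h), heightDensity, if_pos ⟨hy', h⟩,
      ← ENNReal.ofReal_mul (by positivity), ← ENNReal.ofReal_mul (by positivity)]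
    congr 1
    have e3 : 1 - ((z - x * y) / c) ^ 2 = gramDet x y z / c ^ 2 := by
      rw [hgram]; field_simp
    have e4 : c = (1 - x ^ 2) ^ (1 / 2 : ℝ) * (1 - y ^ 2) ^ (1 / 2 : ℝ) := by
      rw [hc, Real.sqrt_eq_rpow, Real.sqrt_eq_rpow]
    have e5 : (c ^ 2) ^ b = (1 - x ^ 2) ^ b * (1 - y ^ 2) ^ b := by
      rw [hcsq, Real.mul_rpow hx2.le hy2.le]
    rw [e3, Real.div_rpow h.le (by positivity), e5, Real.rpow_neg hx2.le,
      Real.rpow_add hy2, Real.rpow_add hx2]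
    have p1 := (Real.rpow_pos_of_pos hy2 b).ne'
    have p2 := (Real.rpow_pos_of_pos hx2 b).ne'
    have p3 := (Real.rpow_pos_of_pos hy2 (1 / 2)).ne'
    have p4 := (Real.rpow_pos_of_pos hx2 (1 / 2)).ne'
    rw [e4]
    field_simp
  · rw [Set.indicator_of_notMem (fun h' => h (hiff.1 h')), heightDensity,
      if_neg (fun h' => h h'.2)]
    simp

/-- This plays the role of the rotation invariance of the sphere: a reflection exchanges two points
with inner product $x$, hence the heights over them. It reduces to the symmetry of the joint
density. -/
lemma map_swap_sphereMeasure {b x : ℝ} (hx : |x| < 1) :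
    ((sphereMeasure b).map fun q => (q.1, sphereInner x q.1 q.2)).map Prod.swap =
      (sphereMeasure b).map fun q => (q.1, sphereInner x q.1 q.2) := by
  have hm : Measurable fun q : ℝ × ℝ => (q.1, sphereInner x q.1 q.2) :=
    measurable_fst.prodMk (measurable_sphereInner x)
  refine Measure.ext_of_lintegral _ fun H hH => ?_
  have hH' : Measurable fun q : ℝ × ℝ => H q.swap := hH.comp measurable_swap
  rw [lintegral_map hH measurable_swap, lintegral_map hH' hm,
    lintegral_map hH hm, lintegral_sphereMeasure hx hH',
    lintegral_sphereMeasure hx hH, lintegral_lintegral_swap]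
  · simp only [Prod.swap_prod_mk]
    refine lintegral_congr fun y => lintegral_congr fun z => ?_
    rw [heightDensity_symm]
  · exact ((measurable_heightDensity b x).mul (hH.comp measurable_swap)).aemeasurable

lemma integral_sphereMeasure_swap {b x : ℝ} (hx : |x| < 1) {F : ℝ × ℝ → ℝ} (hF : Measurable F) :
    ∫ q, F (sphereInner x q.1 q.2, q.1) ∂sphereMeasure b =
      ∫ q, F (q.1, sphereInner x q.1 q.2) ∂sphereMeasure b := by
  have hm : Measurable fun q : ℝ × ℝ => (q.1, sphereInner x q.1 q.2) :=
    measurable_fst.prodMk (measurable_sphereInner x)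
  rw [← integral_map (f := F) hm.aemeasurable hF.aestronglyMeasurable,
    ← map_swap_sphereMeasure hx, integral_map measurable_swap.aemeasurable
      hF.aestronglyMeasurable, integral_map (f := fun q => F q.swap) hm.aemeasurable
      (hF.comp measurable_swap).aestronglyMeasurable]
  rfl

lemma integrable_sphereMeasure_swap {b x : ℝ} (hx : |x| < 1) {F : ℝ × ℝ → ℝ} (hF : Measurable F)
    (h : Integrable (fun q : ℝ × ℝ => F (q.1, sphereInner x q.1 q.2)) (sphereMeasure b)) :
    Integrable (fun q : ℝ × ℝ => F (sphereInner x q.1 q.2, q.1)) (sphereMeasure b) := by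
  have hm : Measurable fun q : ℝ × ℝ => (q.1, sphereInner x q.1 q.2) :=
    measurable_fst.prodMk (measurable_sphereInner x)
  have h1 : Integrable F ((sphereMeasure b).map fun q => (q.1, sphereInner x q.1 q.2)) :=
    (integrable_map_measure hF.aestronglyMeasurable hm.aemeasurable).2 h
  rw [← map_swap_sphereMeasure hx, integrable_map_measure hF.aestronglyMeasurable
    measurable_swap.aemeasurable, integrable_map_measure
    (hF.comp measurable_swap).aestronglyMeasurable hm.aemeasurable] at h1
  exact h1

end Delaunay


/-! ### Jacobi moments and the derivative of zonal polynomials -/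

namespace Delaunay

open ProbabilityTheory Set

/-- The substitution $u=(1+z)/2$ turns the weight into a multiple of the Beta density, of total mass
one. -/
lemma lintegral_jacobi {α β : ℝ} (hα : 0 < α) (hβ : 0 < β) :
    ∫⁻ z in Ioo (-1 : ℝ) 1, ENNReal.ofReal ((1 - z) ^ (α - 1) * (1 + z) ^ (β - 1)) =
      ENNReal.ofReal (2 ^ (α + β - 1) * beta α β) := by
  have hB := beta_pos hα hβ
  have hsymm : beta β α = beta α β := by unfold beta; rw [mul_comm, add_comm]
  have hm : Measurable (betaPDF β α) := (measurable_betaPDFReal β α).ennreal_ofReal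
  have h1 := lintegral_comp_affine hm (by norm_num : (0 : ℝ) < 1 / 2) (1 / 2)
  rw [lintegral_betaPDF_eq_one hβ hα, mul_one] at h1
  have h2 : ∀ z, ENNReal.ofReal (2 ^ (α + β - 2) * beta α β) * betaPDF β α (1 / 2 + z * (1 / 2)) =
      (Ioo (-1 : ℝ) 1).indicator
        (fun z => ENNReal.ofReal ((1 - z) ^ (α - 1) * (1 + z) ^ (β - 1))) z := by
    intro z
    by_cases hz : z ∈ Ioo (-1 : ℝ) 1
    · have a1 : 0 < 1 - z := by linarith [hz.2]
      have a2 : 0 < 1 + z := by linarith [hz.1]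
      rw [indicator_of_mem hz, betaPDF_of_pos_lt_one (by linarith) (by linarith),
        ← ENNReal.ofReal_mul (by positivity), hsymm]
      congr 1
      have e1 : 1 / 2 + z * (1 / 2) = (1 + z) / 2 := by ring
      have e2 : 1 - (1 + z) / 2 = (1 - z) / 2 := by ring
      have e3 : (2 : ℝ) ^ (α + β - 2) = 2 ^ (α - 1) * 2 ^ (β - 1) := by
        rw [← Real.rpow_add (by norm_num)]; congr 1; ring
      rw [e1, e2, Real.div_rpow a1.le (by norm_num), Real.div_rpow a2.le (by norm_num), e3]
      have := (Real.rpow_pos_of_pos (two_pos : (0 : ℝ) < 2) (α - 1)).ne'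
      have := (Real.rpow_pos_of_pos (two_pos : (0 : ℝ) < 2) (β - 1)).ne'
      field_simp
    · rw [indicator_of_notMem hz]
      have : ¬ (0 < 1 / 2 + z * (1 / 2) ∧ 1 / 2 + z * (1 / 2) < 1) := fun h =>
        hz ⟨by linarith [h.1], by linarith [h.2]⟩
      rw [betaPDF_eq, if_neg this]
      simp
  have hm' : Measurable fun z => betaPDF β α (1 / 2 + z * (1 / 2)) := hm.comp (by fun_prop)
  rw [← lintegral_indicator measurableSet_Ioo, ← lintegral_congr h2,
    lintegral_const_mul _ hm', h1, ← ENNReal.ofReal_mul (by positivity)]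
  congr 1
  have : (2 : ℝ) ^ (α + β - 1) = 2 ^ (α + β - 2) * 2 := by
    rw [← Real.rpow_add_one (by norm_num)]; congr 1; ring
  rw [this]
  ring

lemma jacobi_nonneg {α β z : ℝ} (hz : z ∈ Ioo (-1 : ℝ) 1) : 0 < (1 - z) ^ α * (1 + z) ^ β :=
  mul_pos (Real.rpow_pos_of_pos (by linarith [hz.2]) _)
    (Real.rpow_pos_of_pos (by linarith [hz.1]) _)

lemma measurable_jacobi (α β : ℝ) : Measurable fun z : ℝ => (1 - z) ^ α * (1 + z) ^ β := by
  fun_prop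

lemma integrableOn_jacobi {α β : ℝ} (hα : 0 < α) (hβ : 0 < β) :
    IntegrableOn (fun z : ℝ => (1 - z) ^ (α - 1) * (1 + z) ^ (β - 1)) (Ioo (-1) 1) := by
  refine ⟨(measurable_jacobi _ _).aestronglyMeasurable, ?_⟩
  rw [hasFiniteIntegral_iff_ofReal
    (ae_restrict_of_forall_mem measurableSet_Ioo fun z hz => (jacobi_nonneg hz).le),
    lintegral_jacobi hα hβ]
  exact ENNReal.ofReal_lt_top

lemma integral_jacobi {α β : ℝ} (hα : 0 < α) (hβ : 0 < β) :
    ∫ z in Ioo (-1 : ℝ) 1, (1 - z) ^ (α - 1) * (1 + z) ^ (β - 1) =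
      2 ^ (α + β - 1) * beta α β := by
  have hB := beta_pos hα hβ
  rw [integral_eq_lintegral_of_nonneg_ae
    (ae_restrict_of_forall_mem measurableSet_Ioo fun z hz => (jacobi_nonneg hz).le)
    (measurable_jacobi _ _).aestronglyMeasurable, lintegral_jacobi hα hβ,
    ENNReal.toReal_ofReal (by positivity)]

/-- The moments of the Jacobi weight. -/
noncomputable def jacobiMoment (a : ℕ) (α β : ℝ) : ℝ :=
  ∫ z in Ioo (-1 : ℝ) 1, z ^ a * ((1 - z) ^ (α - 1) * (1 + z) ^ (β - 1))

lemma integrableOn_jacobiMoment (a : ℕ) {α β : ℝ} (hα : 0 < α) (hβ : 0 < β) :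
    IntegrableOn (fun z : ℝ => z ^ a * ((1 - z) ^ (α - 1) * (1 + z) ^ (β - 1))) (Ioo (-1) 1) := by
  refine (integrableOn_jacobi hα hβ).mono'
    (((measurable_id.pow_const a).mul (measurable_jacobi _ _)).aestronglyMeasurable)
    (ae_restrict_of_forall_mem measurableSet_Ioo fun z hz => ?_)
  rw [norm_mul, norm_pow, Real.norm_of_nonneg (jacobi_nonneg hz).le]
  refine mul_le_of_le_one_left (jacobi_nonneg hz).le (pow_le_one₀ (norm_nonneg _) ?_)
  exact (abs_lt.2 hz).le

lemma jacobiMoment_add_one_left (a : ℕ) {α β : ℝ} (hα : 0 < α) (hβ : 0 < β) :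
    jacobiMoment a (α + 1) β = jacobiMoment a α β - jacobiMoment (a + 1) α β := by
  unfold jacobiMoment
  rw [← integral_sub (integrableOn_jacobiMoment a hα hβ) (integrableOn_jacobiMoment _ hα hβ)]
  refine setIntegral_congr_fun measurableSet_Ioo fun z hz => ?_
  have h : 0 < 1 - z := by linarith [hz.2]
  have : (1 - z) ^ (α + 1 - 1) = (1 - z) ^ (α - 1) * (1 - z) := by
    rw [← Real.rpow_add_one h.ne']; congr 1; ring
  simp only [this]
  ring

lemma jacobiMoment_add_one_right (a : ℕ) {α β : ℝ} (hα : 0 < α) (hβ : 0 < β) :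
    jacobiMoment a α (β + 1) = jacobiMoment a α β + jacobiMoment (a + 1) α β := by
  unfold jacobiMoment
  rw [← integral_add (integrableOn_jacobiMoment a hα hβ) (integrableOn_jacobiMoment _ hα hβ)]
  refine setIntegral_congr_fun measurableSet_Ioo fun z hz => ?_
  have h : 0 < 1 + z := by linarith [hz.1]
  have : (1 + z) ^ (β + 1 - 1) = (1 + z) ^ (β - 1) * (1 + z) := by
    rw [← Real.rpow_add_one h.ne']; congr 1; ring
  simp only [this]
  ring

/-- Integrate the derivative of $z^a(1-z)^\alpha(1+z)^\beta$, which vanishes at both endpoints. For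
$a=0$ the truncated index $a-1$ is harmless because of the factor $a$. -/
lemma jacobiMoment_by_parts (a : ℕ) {α β : ℝ} (hα : 0 < α) (hβ : 0 < β) :
    a * jacobiMoment (a - 1) (α + 1) (β + 1) =
      α * jacobiMoment a α (β + 1) - β * jacobiMoment a (α + 1) β := by
  set f : ℝ → ℝ := fun z => z ^ a * ((1 - z) ^ α * (1 + z) ^ β) with hf
  set f' : ℝ → ℝ := fun z => a * (z ^ (a - 1) * ((1 - z) ^ (α + 1 - 1) * (1 + z) ^ (β + 1 - 1))) -
    α * (z ^ a * ((1 - z) ^ (α - 1) * (1 + z) ^ (β + 1 - 1))) +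
    β * (z ^ a * ((1 - z) ^ (α + 1 - 1) * (1 + z) ^ (β - 1))) with hf'
  have i1 := (integrableOn_jacobiMoment (a - 1) (by linarith : 0 < α + 1)
    (by linarith : 0 < β + 1)).const_mul (a : ℝ)
  have i2 := (integrableOn_jacobiMoment a hα (by linarith : 0 < β + 1)).const_mul α
  have i3 := (integrableOn_jacobiMoment a (by linarith : 0 < α + 1) hβ).const_mul β
  have hint : IntegrableOn f' (Ioo (-1) 1) := (i1.sub i2).add i3
  have h := intervalIntegral.integral_eq_sub_of_hasDerivAt_of_le (f := f) (f' := f')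
    (by norm_num : (-1 : ℝ) ≤ 1) ?_ ?_ ?_
  · rw [intervalIntegral.integral_of_le (by norm_num), integral_Ioc_eq_integral_Ioo] at h
    have h0 : f 1 - f (-1) = 0 := by
      simp [hf, Real.zero_rpow hα.ne', Real.zero_rpow hβ.ne']
    rw [h0] at h
    have h2 : ∫ z in Ioo (-1 : ℝ) 1, f' z = a * jacobiMoment (a - 1) (α + 1) (β + 1) -
        α * jacobiMoment a α (β + 1) + β * jacobiMoment a (α + 1) β := by
      simp only [hf', jacobiMoment]
      rw [← integral_const_mul, ← integral_const_mul, ← integral_const_mul]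
      refine (integral_add (i1.sub i2) i3).trans ?_
      congr 1
      exact integral_sub i1 i2
    linarith
  · refine (continuous_pow a).continuousOn.mul (ContinuousOn.mul ?_ ?_)
    · exact (continuous_const.sub continuous_id).continuousOn.rpow_const fun _ _ => Or.inr hα.le
    · exact (continuous_const.add continuous_id).continuousOn.rpow_const fun _ _ => Or.inr hβ.le
  · intro z hz
    have h1 : (1 - z) ≠ 0 := by linarith [hz.2]
    have h2 : (1 + z) ≠ 0 := by linarith [hz.1]
    have d1 := ((hasDerivAt_id z).const_sub 1).rpow_const (p := α) (Or.inl h1)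
    have d2 := ((hasDerivAt_id z).const_add 1).rpow_const (p := β) (Or.inl h2)
    refine ((hasDerivAt_pow a z).mul (d1.mul d2)).congr_deriv ?_
    simp only [hf', id, Pi.mul_apply, add_sub_cancel_right]
    ring
  · rw [intervalIntegrable_iff_integrableOn_Ioo_of_le (by norm_num)]
    exact hint

/-- The even moments of `ultraMeasure`. -/
noncomputable def ultraMoment (b : ℝ) (j : ℕ) : ℝ := jacobiMoment (2 * j) (b + 1) (b + 1)

/-- Both identities come from integration by parts with the power $z^{2j+1}$, after expanding the
extra factor $1-z^2$. -/
lemma ultraMoment_succ {b : ℝ} (hb : 0 ≤ b) (j : ℕ) :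
    (2 * j + 2 * b + 3) * ultraMoment b (j + 1) = (2 * j + 1) * ultraMoment b j ∧
    (2 * j + 2 * b + 3) * ultraMoment (b + 1) j = (2 * b + 2) * ultraMoment b j := by
  have hb1 : 0 < b + 1 := by linarith
  have h := jacobiMoment_by_parts (2 * j + 1) hb1 hb1
  have h1 : jacobiMoment (2 * j) (b + 1 + 1) (b + 1 + 1) =
      ultraMoment b j - ultraMoment b (j + 1) := by
    rw [jacobiMoment_add_one_left _ hb1 (by linarith), jacobiMoment_add_one_right _ hb1 hb1,
      jacobiMoment_add_one_right _ hb1 hb1]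
    unfold ultraMoment
    rw [show 2 * (j + 1) = 2 * j + 1 + 1 by ring]
    ring
  rw [Nat.add_sub_cancel, h1, jacobiMoment_add_one_left _ hb1 hb1,
    jacobiMoment_add_one_right _ hb1 hb1, show 2 * j + 1 + 1 = 2 * (j + 1) by ring] at h
  have h2 : jacobiMoment (2 * (j + 1)) (b + 1) (b + 1) = ultraMoment b (j + 1) := rfl
  have h3 : ultraMoment (b + 1) j = ultraMoment b j - ultraMoment b (j + 1) := h1
  rw [h2] at h
  push_cast at h
  have h4 : (2 * j + 2 * b + 3) * ultraMoment b (j + 1) = (2 * j + 1) * ultraMoment b j := by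
    linear_combination -h
  exact ⟨h4, by rw [h3]; linear_combination -h4⟩

/-- The moments of the zonal weight `(1 - z)^{-g} (1 - z²)^{b + 1/2}`. -/
noncomputable def zonalMoment (g b : ℝ) (a j : ℕ) : ℝ :=
  jacobiMoment a (j + b + 3 / 2 - g) (j + b + 3 / 2)

/-- In the integration by parts the two Jacobi exponents differ by $g$; this difference produces the
factor $g$ on the right. -/
lemma zonalMoment_rec {g b : ℝ} (hb : 0 ≤ b) (hg : g < b + 3 / 2) (a j : ℕ) :
    (2 * j + 2 * b + 3) * zonalMoment g b (a + 1) j - a * zonalMoment g b (a - 1) (j + 1) =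
      g * zonalMoment (g + 1) (b + 1) a j := by
  have hj : (0 : ℝ) ≤ j := Nat.cast_nonneg j
  have hA : 0 < j + b + 3 / 2 - g := by linarith
  have hB : 0 < j + b + 3 / 2 := by linarith
  have h := jacobiMoment_by_parts a hA hB
  unfold zonalMoment
  have e1 : ((j + 1 : ℕ) : ℝ) + b + 3 / 2 - g = j + b + 3 / 2 - g + 1 := by push_cast; ring
  have e2 : ((j + 1 : ℕ) : ℝ) + b + 3 / 2 = j + b + 3 / 2 + 1 := by push_cast; ring
  have e3 : (j : ℝ) + (b + 1) + 3 / 2 - (g + 1) = j + b + 3 / 2 - g := by ring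
  have e4 : (j : ℝ) + (b + 1) + 3 / 2 = j + b + 3 / 2 + 1 := by ring
  rw [e1, e2, e3, e4, h, jacobiMoment_add_one_left _ hA hB, jacobiMoment_add_one_right _ hA hB]
  ring

section Polynomials

open Polynomial

/-- The image of the monomial `X ^ k` under the zonal convolution operator. -/
noncomputable def zonalPoly (g b : ℝ) (k : ℕ) : ℝ[X] :=
  ∑ j ∈ Finset.range (k + 1), C ((k.choose (2 * j) : ℝ) * ultraMoment b j *
    zonalMoment g b (k - 2 * j) j) * (X ^ (k - 2 * j) * (1 - X ^ 2) ^ j)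

/-- This compares the coefficients of $X^{k-2j}(1-X^2)^j$ in `derivative_zonalPoly`. Differentiating
a basis polynomial of index $j$ contributes to the indices $j$ and $j-1$, hence the two terms on the
left. -/
lemma zonal_coeff_identity {g b : ℝ} (hb : 0 ≤ b) (hg : g < b + 3 / 2) (k j : ℕ) :
    ((k + 1).choose (2 * j) : ℝ) * ultraMoment b j * zonalMoment g b (k + 1 - 2 * j) j *
        ((k + 1 - 2 * j : ℕ) : ℝ) -
      2 * (j + 1) * (((k + 1).choose (2 * (j + 1)) : ℝ) * ultraMoment b (j + 1) *
        zonalMoment g b (k + 1 - 2 * (j + 1)) (j + 1)) =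
      g / (2 * b + 2) * (k + 1) * ((k.choose (2 * j) : ℝ) * ultraMoment (b + 1) j *
        zonalMoment (g + 1) (b + 1) (k - 2 * j) j) := by
  rcases lt_or_ge k (2 * j) with hkj | hkj
  · rw [Nat.choose_eq_zero_of_lt hkj, Nat.choose_eq_zero_of_lt (by omega : k + 1 < 2 * (j + 1)),
      Nat.sub_eq_zero_of_le (by omega : k + 1 ≤ 2 * j)]
    simp
  obtain ⟨a, rfl⟩ := Nat.exists_eq_add_of_le hkj
  have s1 : 2 * j + a + 1 - 2 * j = a + 1 := by omega
  have s2 : 2 * j + a + 1 - 2 * (j + 1) = a - 1 := by omega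
  have s3 : 2 * j + a - 2 * j = a := by omega
  rw [s1, s2, s3]
  have u1 : ((2 * j + a).choose (2 * j) : ℝ) * (2 * j + a + 1) =
      ((2 * j + a + 1).choose (2 * j) : ℝ) * (a + 1) := by
    have := Nat.choose_mul_succ_eq (2 * j + a) (2 * j)
    rw [s1] at this
    exact_mod_cast this
  have u2 : ((2 * j + a + 1 : ℕ) : ℝ) * ((2 * j + a).choose (2 * j + 1) : ℝ) =
      ((2 * j + a + 1).choose (2 * (j + 1)) : ℝ) * (2 * j + 2) := by
    have := Nat.add_one_mul_choose_eq (2 * j + a) (2 * j + 1)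
    exact_mod_cast this
  have u3 : ((2 * j + a).choose (2 * j + 1) : ℝ) * (2 * j + 1) =
      ((2 * j + a).choose (2 * j) : ℝ) * a := by
    have := Nat.choose_succ_right_eq (2 * j + a) (2 * j)
    rw [s3] at this
    exact_mod_cast this
  obtain ⟨m1, m2⟩ := ultraMoment_succ hb j
  have hz := zonalMoment_rec hb hg a j
  have hj : (0 : ℝ) ≤ j := Nat.cast_nonneg j
  have n1 : (2 * j + 2 * b + 3 : ℝ) ≠ 0 := by positivity
  have n2 : (2 * j + 1 : ℝ) ≠ 0 := by positivity
  have n3 : (2 * b + 2 : ℝ) ≠ 0 := by positivity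
  have r1 : ultraMoment b (j + 1) = (2 * j + 1) * ultraMoment b j / (2 * j + 2 * b + 3) := by
    rw [eq_div_iff n1]; linarith
  have r2 : ultraMoment (b + 1) j = (2 * b + 2) * ultraMoment b j / (2 * j + 2 * b + 3) := by
    rw [eq_div_iff n1]; linarith
  have r3 : ((2 * j + a).choose (2 * j + 1) : ℝ) =
      ((2 * j + a).choose (2 * j) : ℝ) * a / (2 * j + 1) := by
    rw [eq_div_iff n2]; linarith
  rw [r3] at u2
  rw [r1, r2]
  push_cast at u2 ⊢
  set c0 := ((2 * j + a).choose (2 * j) : ℝ)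
  set c1 := ((2 * j + a + 1).choose (2 * j) : ℝ)
  set c2 := ((2 * j + a + 1).choose (2 * (j + 1)) : ℝ)
  set M := ultraMoment b j
  set z1 := zonalMoment g b (a + 1) j
  set z2 := zonalMoment g b (a - 1) (j + 1)
  set z3 := zonalMoment (g + 1) (b + 1) a j
  have t1 : c1 * M * z1 * (a + 1) = c0 * (2 * j + a + 1) * M * z1 := by rw [u1]; ring
  have t2 : 2 * (j + 1) * (c2 * ((2 * j + 1) * M / (2 * j + 2 * b + 3)) * z2) =
      c0 * (2 * j + a + 1) * M * (a * z2) / (2 * j + 2 * b + 3) := by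
    have : 2 * (j + 1) * (c2 * ((2 * j + 1) * M / (2 * j + 2 * b + 3)) * z2) =
      (c2 * (2 * j + 2)) * ((2 * j + 1) * M / (2 * j + 2 * b + 3)) * z2 := by ring
    rw [this, ← u2]
    field_simp
  have hz' : z1 - a * z2 / (2 * j + 2 * b + 3) = g * z3 / (2 * j + 2 * b + 3) := by
    rw [← hz]
    field_simp
  have t3 : g / (2 * b + 2) * (2 * j + a + 1) *
      (c0 * ((2 * b + 2) * M / (2 * j + 2 * b + 3)) * z3) =
      c0 * (2 * j + a + 1) * M * (g * z3 / (2 * j + 2 * b + 3)) := by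
    field_simp
  rw [t1, t2, t3, ← hz']
  ring

/-- As for Gegenbauer polynomials, the derivative of a zonal function on a sphere is naturally zonal
on the sphere of two more dimensions. The exponent of the kernel rises by one at the same time. -/
lemma derivative_zonalPoly {g b : ℝ} (hb : 0 ≤ b) (hg : g < b + 3 / 2) (k : ℕ) :
    derivative (zonalPoly g b (k + 1)) =
      C (g / (2 * b + 2) * (k + 1)) * zonalPoly (g + 1) (b + 1) k := by
  set c : ℕ → ℝ := fun j => ((k + 1).choose (2 * j) : ℝ) * ultraMoment b j *
    zonalMoment g b (k + 1 - 2 * j) j with hc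
  have hd : ∀ j, derivative (C (c j) * (X ^ (k + 1 - 2 * j) * (1 - X ^ 2) ^ j)) =
      C (c j * ((k + 1 - 2 * j : ℕ) : ℝ)) * (X ^ (k - 2 * j) * (1 - X ^ 2) ^ j) -
      C (2 * j * c j) * (X ^ (k + 1 - 2 * j + 1) * (1 - X ^ 2) ^ (j - 1)) := by
    intro j
    have : k + 1 - 2 * j - 1 = k - 2 * j := by omega
    simp only [derivative_mul, derivative_C, derivative_pow, derivative_sub,
      derivative_one, map_mul, zero_mul, zero_add, this, map_natCast, derivative_X]
    simp only [map_ofNat]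
    ring
  unfold zonalPoly
  rw [derivative_sum, Finset.sum_congr rfl fun j _ => hd j, Finset.sum_sub_distrib,
    Finset.sum_range_succ, Finset.sum_range_succ' (fun j => C (2 * (j : ℝ) * c j) * _)]
  have z1 : c (k + 1) = 0 := by
    simp only [hc]
    rw [Nat.choose_eq_zero_of_lt (by omega)]
    simp
  simp only [z1, zero_mul, map_zero, add_zero, CharP.cast_eq_zero, mul_zero]
  rw [← Finset.sum_sub_distrib, Finset.mul_sum]
  refine Finset.sum_congr rfl fun j _ => ?_
  -- The truncated difference $k+1-2(j+1)$ plus one is $k-2j$ only while $2(j+1)\le k+1$; beyond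
  -- that the binomial coefficient in $c$ vanishes.
  have e : C (2 * ((j + 1 : ℕ) : ℝ) * c (j + 1)) *
      (X ^ (k + 1 - 2 * (j + 1) + 1) * (1 - X ^ 2) ^ (j + 1 - 1)) =
      C (2 * ((j + 1 : ℕ) : ℝ) * c (j + 1)) * (X ^ (k - 2 * j) * (1 - X ^ 2) ^ j : ℝ[X]) := by
    by_cases h : 2 * (j + 1) ≤ k + 1
    · rw [show k + 1 - 2 * (j + 1) + 1 = k - 2 * j by omega, Nat.add_sub_cancel]
    · have : c (j + 1) = 0 := by
        simp only [hc]
        rw [Nat.choose_eq_zero_of_lt (by omega)]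
        simp
      simp [this]
  rw [e, ← sub_mul, ← C_sub, ← mul_assoc (C (g / (2 * b + 2) * (k + 1))), ← C_mul]
  congr 2
  have := zonal_coeff_identity hb hg k j
  simp only [hc]
  push_cast at this ⊢
  exact this

end Polynomials

end Delaunay


/-! ### Zonal convolution on the sphere -/

namespace Delaunay

open Set Polynomial

lemma one_sub_sq_rpow {z : ℝ} (hz : z ∈ Ioo (-1 : ℝ) 1) (b : ℝ) :
    (1 - z ^ 2) ^ b = (1 - z) ^ b * (1 + z) ^ b := by
  rw [← Real.mul_rpow (by linarith [hz.2]) (by linarith [hz.1])]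
  congr 1
  ring

lemma one_sub_sq_pos {z : ℝ} (hz : z ∈ Ioo (-1 : ℝ) 1) : 0 < 1 - z ^ 2 := by
  nlinarith [hz.1, hz.2]

lemma integral_ultraMeasure (b : ℝ) (f : ℝ → ℝ) :
    ∫ z, f z ∂ultraMeasure b = ∫ z in Ioo (-1 : ℝ) 1, (1 - z ^ 2) ^ b * f z := by
  rw [ultraMeasure, integral_withDensity_eq_integral_toReal_smul (by fun_prop)
    (ae_of_all _ fun _ => ENNReal.ofReal_lt_top)]
  refine setIntegral_congr_fun measurableSet_Ioo fun z hz => ?_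
  simp only [smul_eq_mul]
  rw [ENNReal.toReal_ofReal (Real.rpow_nonneg (one_sub_sq_pos hz).le _)]

lemma integrable_ultraMeasure_iff (b : ℝ) (f : ℝ → ℝ) :
    Integrable f (ultraMeasure b) ↔ IntegrableOn (fun z => (1 - z ^ 2) ^ b * f z) (Ioo (-1) 1) := by
  rw [ultraMeasure, integrable_withDensity_iff_integrable_smul' (by fun_prop)
    (ae_of_all _ fun _ => ENNReal.ofReal_lt_top)]
  refine integrableOn_congr_fun (fun z hz => ?_) measurableSet_Ioo
  simp only [smul_eq_mul]
  rw [ENNReal.toReal_ofReal (Real.rpow_nonneg (one_sub_sq_pos hz).le _)]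

lemma ae_ultraMeasure (b : ℝ) : ∀ᵐ z ∂ultraMeasure b, z ∈ Ioo (-1 : ℝ) 1 :=
  (withDensity_absolutelyContinuous _ _).ae_le (ae_restrict_mem measurableSet_Ioo)

lemma ae_sphereMeasure (b : ℝ) :
    ∀ᵐ q ∂sphereMeasure b, q.1 ∈ Ioo (-1 : ℝ) 1 ∧ q.2 ∈ Ioo (-1 : ℝ) 1 := by
  have h1 := (Measure.quasiMeasurePreserving_fst (μ := ultraMeasure (b + 1 / 2))
    (ν := ultraMeasure b)).ae (ae_ultraMeasure (b + 1 / 2))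
  have h2 := (Measure.quasiMeasurePreserving_snd (μ := ultraMeasure (b + 1 / 2))
    (ν := ultraMeasure b)).ae (ae_ultraMeasure b)
  exact h1.and h2

lemma zonal_density_eq {z : ℝ} (hz : z ∈ Ioo (-1 : ℝ) 1) (g b : ℝ) (a j : ℕ) :
    (1 - z ^ 2) ^ (b + 1 / 2) * ((1 - z) ^ (-g) * (z ^ a * (1 - z ^ 2) ^ j)) =
      z ^ a * ((1 - z) ^ (j + b + 3 / 2 - g - 1) * (1 + z) ^ (j + b + 3 / 2 - 1)) := by
  have h1 : 0 < 1 - z := by linarith [hz.2]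
  have h2 : 0 < 1 + z := by linarith [hz.1]
  have e1 : (j : ℝ) + b + 3 / 2 - g - 1 = (b + 1 / 2) + (-g) + j := by ring
  have e2 : (j : ℝ) + b + 3 / 2 - 1 = (b + 1 / 2) + j := by ring
  rw [e1, e2, Real.rpow_add h1, Real.rpow_add h1, Real.rpow_add h2, Real.rpow_natCast,
    Real.rpow_natCast, one_sub_sq_rpow hz, show (1 - z ^ 2) ^ j = (1 - z) ^ j * (1 + z) ^ j by
      rw [← mul_pow]; ring]
  ring

lemma integral_zonal (g b : ℝ) (a j : ℕ) :
    ∫ z, (1 - z) ^ (-g) * (z ^ a * (1 - z ^ 2) ^ j) ∂ultraMeasure (b + 1 / 2) =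
      zonalMoment g b a j := by
  rw [integral_ultraMeasure, zonalMoment, jacobiMoment]
  exact setIntegral_congr_fun measurableSet_Ioo fun z hz => zonal_density_eq hz g b a j

lemma integrable_zonal {g b : ℝ} (hb : 0 ≤ b) (hg : g < b + 3 / 2) (a j : ℕ) :
    Integrable (fun z : ℝ => (1 - z) ^ (-g) * (z ^ a * (1 - z ^ 2) ^ j))
      (ultraMeasure (b + 1 / 2)) := by
  have hj : (0 : ℝ) ≤ j := Nat.cast_nonneg j
  rw [integrable_ultraMeasure_iff, integrableOn_congr_fun
    (fun z hz => zonal_density_eq hz g b a j) measurableSet_Ioo]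
  exact integrableOn_jacobiMoment a (by linarith) (by linarith)

lemma integrable_pow_ultraMeasure {b : ℝ} (hb : 0 ≤ b) (a : ℕ) :
    Integrable (fun z : ℝ => z ^ a) (ultraMeasure b) := by
  rw [integrable_ultraMeasure_iff]
  refine (integrableOn_jacobiMoment a (by linarith : 0 < b + 1) (by linarith : 0 < b + 1)).congr_fun
    (fun z hz => ?_) measurableSet_Ioo
  simp only [add_sub_cancel_right]
  rw [one_sub_sq_rpow hz]
  ring

lemma integral_even_pow_ultraMeasure (b : ℝ) (j : ℕ) :
    ∫ z, z ^ (2 * j) ∂ultraMeasure b = ultraMoment b j := by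
  rw [integral_ultraMeasure, ultraMoment, jacobiMoment]
  refine setIntegral_congr_fun measurableSet_Ioo fun z hz => ?_
  simp only [add_sub_cancel_right]
  rw [one_sub_sq_rpow hz]
  ring

lemma isFiniteMeasure_ultraMeasure {b : ℝ} (hb : 0 ≤ b) : IsFiniteMeasure (ultraMeasure b) := by
  have := integrable_pow_ultraMeasure hb 0
  simpa [integrable_const_iff] using this

lemma map_neg_ultraMeasure (b : ℝ) : (ultraMeasure b).map (fun z => -z) = ultraMeasure b := by
  refine Measure.ext_of_lintegral _ fun f hf => ?_
  rw [lintegral_map hf measurable_neg, lintegral_ultraMeasure (f := fun z => f (-z)) (by fun_prop),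
    lintegral_ultraMeasure hf, ← lintegral_neg_eq_self]
  refine lintegral_congr fun z => ?_
  have : -z ∈ Ioo (-1 : ℝ) 1 ↔ z ∈ Ioo (-1 : ℝ) 1 := by
    simp only [mem_Ioo]; constructor <;> rintro ⟨h1, h2⟩ <;> constructor <;> linarith
  simp only [indicator, this, neg_neg, neg_sq]

lemma integral_odd_pow_ultraMeasure (b : ℝ) (j : ℕ) :
    ∫ z, z ^ (2 * j + 1) ∂ultraMeasure b = 0 := by
  have h := integral_map (μ := ultraMeasure b) (φ := fun z => -z) (f := fun z : ℝ => z ^ (2 * j + 1))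
    measurable_neg.aemeasurable (by fun_prop)
  rw [map_neg_ultraMeasure] at h
  have h2 : ∀ z : ℝ, (-z) ^ (2 * j + 1) = -(z ^ (2 * j + 1)) := fun z => Odd.neg_pow ⟨j, rfl⟩ z
  simp only [h2] at h
  rw [integral_neg] at h
  linarith

/-- Zonal convolution with `(1 - z)^{-g}` on the unit sphere. -/
noncomputable def sphereOp (g b : ℝ) (G : ℝ → ℝ) (x : ℝ) : ℝ :=
  ∫ q, (1 - q.1) ^ (-g) * G (sphereInner x q.1 q.2) ∂sphereMeasure b

/-- The integral of `(1 - z)^{-g}` over the unit sphere. -/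
noncomputable def sphereMass (g b : ℝ) : ℝ := zonalMoment g b 0 0 * ultraMoment b 0

lemma abs_sphereInner_le {x y ζ : ℝ} (hx : |x| ≤ 1) (hy : |y| ≤ 1) (hζ : |ζ| ≤ 1) :
    |sphereInner x y ζ| ≤ 1 := by
  have hx2 : 0 ≤ 1 - x ^ 2 := sub_nonneg.2 ((sq_le_one_iff_abs_le_one x).2 hx)
  have hy2 : 0 ≤ 1 - y ^ 2 := sub_nonneg.2 ((sq_le_one_iff_abs_le_one y).2 hy)
  set X := Real.sqrt (1 - x ^ 2) with hX
  set Y := Real.sqrt (1 - y ^ 2) with hY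
  have hXs : X ^ 2 = 1 - x ^ 2 := Real.sq_sqrt hx2
  have hYs : Y ^ 2 = 1 - y ^ 2 := Real.sq_sqrt hy2
  have hXY : 0 ≤ X * Y := mul_nonneg (Real.sqrt_nonneg _) (Real.sqrt_nonneg _)
  have h1 : |ζ * (X * Y)| ≤ X * Y := by
    rw [abs_mul, abs_of_nonneg hXY]
    exact mul_le_of_le_one_left hXY hζ
  have h2 : |x * y| ≤ (x ^ 2 + y ^ 2) / 2 := by
    rw [abs_le]; constructor <;> nlinarith [sq_nonneg (x - y), sq_nonneg (x + y)]
  have h3 : X * Y ≤ (X ^ 2 + Y ^ 2) / 2 := by nlinarith [sq_nonneg (X - Y)]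
  calc |sphereInner x y ζ| ≤ |x * y| + |ζ * (X * Y)| := abs_add_le _ _
    _ ≤ 1 := by linarith

lemma sum_range_two_mul (f : ℕ → ℝ) (N : ℕ) :
    ∑ i ∈ Finset.range (2 * N), f i = ∑ j ∈ Finset.range N, (f (2 * j) + f (2 * j + 1)) := by
  induction N with
  | zero => simp
  | succ N ih =>
    rw [show 2 * (N + 1) = 2 * N + 1 + 1 by ring, Finset.sum_range_succ, Finset.sum_range_succ, ih,
      Finset.sum_range_succ]
    ring

lemma sphereInner_pow {x y ζ : ℝ} (k : ℕ) : sphereInner x y ζ ^ k =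
    ∑ m ∈ Finset.range (2 * (k + 1)), ((k.choose m : ℝ) *
      (Real.sqrt (1 - x ^ 2) ^ m * x ^ (k - m))) *
      (y ^ (k - m) * Real.sqrt (1 - y ^ 2) ^ m * ζ ^ m) := by
  rw [sphereInner, add_comm, add_pow]
  refine Finset.sum_subset_zero_on_sdiff (Finset.range_subset_range.2 (by omega)) ?_ ?_
  · intro m hm
    rw [Finset.mem_sdiff, Finset.mem_range, Finset.mem_range] at hm
    rw [Nat.choose_eq_zero_of_lt (by omega)]
    simp
  · intro m _
    rw [mul_pow, mul_pow, mul_pow]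
    ring

lemma integrable_kernel_mul {g b : ℝ} (hb : 0 ≤ b) (hg : g < b + 3 / 2) :
    Integrable (fun q : ℝ × ℝ => (1 - q.1) ^ (-g)) (sphereMeasure b) := by
  have h1 := integrable_zonal hb hg 0 0
  have h2 := integrable_pow_ultraMeasure hb 0
  simp only [pow_zero, mul_one] at h1 h2
  simpa [sphereMeasure] using h1.mul_prod h2

lemma integrable_sphereOp {g b x M : ℝ} (hb : 0 ≤ b) (hg : g < b + 3 / 2) {G : ℝ → ℝ}
    (hG : Measurable G) (hM : ∀ y, |y| ≤ 1 → |G y| ≤ M) (hx : |x| ≤ 1) :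
    Integrable (fun q : ℝ × ℝ => (1 - q.1) ^ (-g) * G (sphereInner x q.1 q.2))
      (sphereMeasure b) := by
  refine (integrable_kernel_mul hb hg).mul_bdd (c := M)
    (hG.comp (measurable_sphereInner x)).aestronglyMeasurable ?_
  filter_upwards [ae_sphereMeasure b] with q hq
  exact hM _ (abs_sphereInner_le hx (abs_lt.2 hq.1).le (abs_lt.2 hq.2).le)

/-- In the binomial expansion of the inner product, odd powers of $\zeta$ integrate to zero. The
square roots therefore survive only to even powers, and the result is a polynomial in $x$. -/
lemma sphereOp_pow {g b x : ℝ} (hb : 0 ≤ b) (hg : g < b + 3 / 2) (hx : |x| ≤ 1) (k : ℕ) :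
    sphereOp g b (fun y => y ^ k) x = (zonalPoly g b k).eval x := by
  have hx2 : 0 ≤ 1 - x ^ 2 := sub_nonneg.2 ((sq_le_one_iff_abs_le_one x).2 hx)
  have e : ∀ q : ℝ × ℝ, (1 - q.1) ^ (-g) * sphereInner x q.1 q.2 ^ k =
      ∑ m ∈ Finset.range (2 * (k + 1)), ((k.choose m : ℝ) *
      (Real.sqrt (1 - x ^ 2) ^ m * x ^ (k - m))) *
      (((1 - q.1) ^ (-g) * (q.1 ^ (k - m) * Real.sqrt (1 - q.1 ^ 2) ^ m)) * q.2 ^ m) := by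
    intro q
    rw [sphereInner_pow, Finset.mul_sum]
    refine Finset.sum_congr rfl fun m _ => ?_
    ring
  have hi : ∀ m, Integrable (fun z : ℝ => (1 - z) ^ (-g) *
      (z ^ (k - m) * Real.sqrt (1 - z ^ 2) ^ m)) (ultraMeasure (b + 1 / 2)) := by
    intro m
    have h1 := integrable_zonal hb hg 0 0
    simp only [pow_zero, mul_one] at h1
    refine h1.mul_bdd (c := 1) (by fun_prop) ?_
    filter_upwards [ae_ultraMeasure (b + 1 / 2)] with z hz
    rw [norm_mul, norm_pow, norm_pow]
    have h2 : ‖z‖ ≤ 1 := (abs_lt.2 hz).le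
    have h3 : ‖Real.sqrt (1 - z ^ 2)‖ ≤ 1 := by
      rw [Real.norm_of_nonneg (Real.sqrt_nonneg _), Real.sqrt_le_iff]
      exact ⟨zero_le_one, by nlinarith [sq_nonneg z]⟩
    exact mul_le_one₀ (pow_le_one₀ (norm_nonneg _) h2) (by positivity)
      (pow_le_one₀ (norm_nonneg _) h3)
  have hint : ∀ m, ∫ q, ((1 - q.1) ^ (-g) * (q.1 ^ (k - m) * Real.sqrt (1 - q.1 ^ 2) ^ m)) *
      q.2 ^ m ∂sphereMeasure b = (∫ z, (1 - z) ^ (-g) * (z ^ (k - m) *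
        Real.sqrt (1 - z ^ 2) ^ m) ∂ultraMeasure (b + 1 / 2)) * ∫ ζ, ζ ^ m ∂ultraMeasure b :=
    fun m => integral_prod_mul (fun z : ℝ => (1 - z) ^ (-g) *
      (z ^ (k - m) * Real.sqrt (1 - z ^ 2) ^ m)) (fun ζ : ℝ => ζ ^ m)
  have hj : ∀ m, Integrable (fun q : ℝ × ℝ => ((k.choose m : ℝ) *
      (Real.sqrt (1 - x ^ 2) ^ m * x ^ (k - m))) * (((1 - q.1) ^ (-g) *
        (q.1 ^ (k - m) * Real.sqrt (1 - q.1 ^ 2) ^ m)) * q.2 ^ m)) (sphereMeasure b) :=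
    fun m => ((hi m).mul_prod (integrable_pow_ultraMeasure hb m)).const_mul _
  rw [sphereOp]
  simp only [e]
  rw [integral_finsetSum _ fun m _ => hj m]
  simp only [integral_const_mul, hint]
  rw [sum_range_two_mul, zonalPoly, eval_finsetSum]
  refine Finset.sum_congr rfl fun j _ => ?_
  rw [integral_odd_pow_ultraMeasure, mul_zero, mul_zero, add_zero, integral_even_pow_ultraMeasure]
  have e2 : ∫ z, (1 - z) ^ (-g) * (z ^ (k - 2 * j) * Real.sqrt (1 - z ^ 2) ^ (2 * j))
      ∂ultraMeasure (b + 1 / 2) = zonalMoment g b (k - 2 * j) j := by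
    rw [← integral_zonal]
    refine integral_congr_ae ?_
    filter_upwards [ae_ultraMeasure (b + 1 / 2)] with z hz
    rw [pow_mul, Real.sq_sqrt (one_sub_sq_pos hz).le]
  rw [e2, pow_mul, Real.sq_sqrt hx2]
  simp only [eval_mul, eval_C, eval_pow, eval_X, eval_sub, eval_one]
  ring

/-- `sphereOp` on polynomials. -/
noncomputable def sphereOpPoly (g b : ℝ) : ℝ[X] →ₗ[ℝ] ℝ[X] :=
  Polynomial.lsum fun k => LinearMap.toSpanSingleton ℝ ℝ[X] (zonalPoly g b k)

lemma sphereOpPoly_monomial (g b : ℝ) (k : ℕ) (a : ℝ) :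
    sphereOpPoly g b (monomial k a) = C a * zonalPoly g b k := by
  simp [sphereOpPoly, Polynomial.lsum_apply, Polynomial.sum_monomial_index, smul_eq_C_mul]

lemma exists_abs_eval_le (P : ℝ[X]) : ∃ M, 0 ≤ M ∧ ∀ y, |y| ≤ 1 → |P.eval y| ≤ M := by
  obtain ⟨M, hM⟩ := (isCompact_Icc (a := (-1 : ℝ)) (b := 1)).exists_bound_of_continuousOn
    (f := fun x => P.eval x) P.continuous.continuousOn
  exact ⟨|M|, abs_nonneg _, fun y hy => (hM y (abs_le.1 hy)).trans (le_abs_self M)⟩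

lemma eval_sphereOpPoly {g b x : ℝ} (hb : 0 ≤ b) (hg : g < b + 3 / 2) (hx : |x| ≤ 1) (P : ℝ[X]) :
    (sphereOpPoly g b P).eval x = sphereOp g b (fun y => P.eval y) x := by
  induction P using Polynomial.induction_on' with
  | add P Q hP hQ =>
    obtain ⟨M, -, hM⟩ := exists_abs_eval_le P
    obtain ⟨M', -, hM'⟩ := exists_abs_eval_le Q
    rw [map_add, eval_add, hP, hQ, sphereOp, sphereOp, sphereOp, ← integral_add
      (integrable_sphereOp hb hg P.continuous.measurable hM hx)
      (integrable_sphereOp hb hg Q.continuous.measurable hM' hx)]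
    simp only [eval_add, mul_add]
  | monomial k a =>
    rw [sphereOpPoly_monomial, eval_mul, eval_C, ← sphereOp_pow hb hg hx, sphereOp, sphereOp,
      ← integral_const_mul]
    refine integral_congr_ae (ae_of_all _ fun q => ?_)
    simp only [eval_monomial]
    ring

/-- This identity carries the spectral gap: it replaces an analysis by spherical harmonics with a
sup-norm estimate on derivatives. -/
lemma derivative_sphereOpPoly {g b : ℝ} (hb : 0 ≤ b) (hg : g < b + 3 / 2) (P : ℝ[X]) :
    derivative (sphereOpPoly g b P) =
      C (g / (2 * b + 2)) * sphereOpPoly (g + 1) (b + 1) (derivative P) := by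
  induction P using Polynomial.induction_on' with
  | add P Q hP hQ => simp only [map_add, hP, hQ, mul_add]
  | monomial k a =>
    rw [sphereOpPoly_monomial, derivative_monomial, sphereOpPoly_monomial, derivative_C_mul]
    cases k with
    | zero => simp [zonalPoly]
    | succ k =>
      rw [derivative_zonalPoly hb hg, Nat.add_sub_cancel, ← mul_assoc, ← mul_assoc, ← C_mul,
        ← C_mul]
      congr 2
      push_cast
      ring

lemma integral_kernel (g b : ℝ) : ∫ q, (1 - q.1) ^ (-g) ∂sphereMeasure b = sphereMass g b := by
  have := integral_prod_mul (μ := ultraMeasure (b + 1 / 2)) (ν := ultraMeasure b)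
    (fun z : ℝ => (1 - z) ^ (-g)) (fun ζ : ℝ => ζ ^ (2 * 0))
  rw [integral_even_pow_ultraMeasure] at this
  have h2 := integral_zonal g b 0 0
  simp only [pow_zero, mul_one] at h2
  rw [h2] at this
  rw [sphereMass, ← this]
  simp [sphereMeasure]

lemma jacobiMoment_zero {α β : ℝ} (hα : 0 < α) (hβ : 0 < β) :
    jacobiMoment 0 α β = 2 ^ (α + β - 1) * ProbabilityTheory.beta α β := by
  rw [← integral_jacobi hα hβ, jacobiMoment]
  simp

lemma jacobiMoment_zero_pos {α β : ℝ} (hα : 0 < α) (hβ : 0 < β) : 0 < jacobiMoment 0 α β := by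
  rw [jacobiMoment_zero hα hβ]
  exact mul_pos (by positivity) (ProbabilityTheory.beta_pos hα hβ)

lemma sphereMass_pos {g b : ℝ} (hb : 0 ≤ b) (hg : g < b + 3 / 2) : 0 < sphereMass g b := by
  refine mul_pos (jacobiMoment_zero_pos ?_ ?_) (jacobiMoment_zero_pos ?_ ?_) <;>
    norm_num <;> linarith

/-- The ratio of the masses of the kernels in consecutive dimensions. -/
lemma sphereMass_succ {g b : ℝ} (hb : 0 ≤ b) (hg : g < b + 3 / 2) :
    (2 * (b + 3 / 2) - g) * (g / (2 * b + 2) * sphereMass (g + 1) (b + 1)) =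
      g * sphereMass g b := by
  have hA : 0 < b + 3 / 2 - g := by linarith
  have hB : 0 < b + 3 / 2 := by linarith
  have h1 := (ultraMoment_succ hb 0).2
  have h3 := jacobiMoment_by_parts 0 hA hB
  rw [jacobiMoment_add_one_left 0 hA hB] at h3
  have h4 := jacobiMoment_add_one_right 0 hA hB
  have e1 : zonalMoment (g + 1) (b + 1) 0 0 = jacobiMoment 0 (b + 3 / 2 - g) (b + 3 / 2 + 1) := by
    unfold zonalMoment; congr 1 <;> push_cast <;> ring
  have e2 : zonalMoment g b 0 0 = jacobiMoment 0 (b + 3 / 2 - g) (b + 3 / 2) := by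
    unfold zonalMoment; congr 1 <;> push_cast <;> ring
  unfold sphereMass
  rw [e1, e2]
  simp only [Nat.cast_zero, zero_mul, mul_zero, zero_add] at h1 h3
  set J := jacobiMoment 0 (b + 3 / 2 - g) (b + 3 / 2)
  set J' := jacobiMoment 0 (b + 3 / 2 - g) (b + 3 / 2 + 1)
  set J1 := jacobiMoment 1 (b + 3 / 2 - g) (b + 3 / 2)
  have h5 : (2 * (b + 3 / 2) - g) * J' = (2 * b + 3) * J := by
    linear_combination -h3 + (b + 3 / 2) * h4
  have n2 : (2 * b + 2) ≠ 0 := by positivity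
  have n3 : (2 * b + 3) ≠ 0 := by positivity
  have r : ultraMoment (b + 1) 0 = (2 * b + 2) * ultraMoment b 0 / (2 * b + 3) := by
    rw [eq_div_iff n3]; linarith
  rw [r]
  field_simp
  linear_combination g * ultraMoment b 0 * h5

/-- The antipodal map $(y,\zeta)\mapsto(-y,-\zeta)$ preserves the measure and changes the sign of
the inner product. -/
lemma integral_odd_sphereMeasure {b x : ℝ} {G : ℝ → ℝ} (hG : Measurable G)
    (hodd : ∀ y, G (-y) = -G y) : ∫ q, G (sphereInner x q.1 q.2) ∂sphereMeasure b = 0 := by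
  have : SFinite ((ultraMeasure (b + 1 / 2)).map fun z => -z) := by
    rw [map_neg_ultraMeasure]; infer_instance
  have hmap : (sphereMeasure b).map (Prod.map (fun z => -z) fun z => -z) = sphereMeasure b := by
    rw [sphereMeasure, ← Measure.map_prod_map _ _ measurable_neg measurable_neg,
      map_neg_ultraMeasure, map_neg_ultraMeasure]
  have h := integral_map (μ := sphereMeasure b) (φ := Prod.map (fun z => -z) fun z => -z)
    (f := fun q => G (sphereInner x q.1 q.2)) (measurable_neg.prodMap measurable_neg).aemeasurable
    (hG.comp (measurable_sphereInner x)).aestronglyMeasurable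
  rw [hmap] at h
  have e : ∀ q : ℝ × ℝ, G (sphereInner x (Prod.map (fun z => -z) (fun z => -z) q).1
      (Prod.map (fun z => -z) (fun z => -z) q).2) = -G (sphereInner x q.1 q.2) := by
    intro q
    rw [← hodd]
    congr 1
    simp [sphereInner]
    ring
  simp only [e] at h
  rw [integral_neg] at h
  linarith

/-- An odd function is orthogonal to constants, so the lower bound $2^{-g}$ of the kernel, its value
at $z=-1$, can be subtracted. The remaining kernel is still nonnegative and has strictly smaller
mass when $b\ge0$. -/
lemma abs_sphereOp_le_of_odd {g b x M : ℝ} (hb : 0 ≤ b) (hg0 : 0 ≤ g) (hg : g < b + 3 / 2)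
    {G : ℝ → ℝ} (hG : Measurable G) (hM : ∀ y, |y| ≤ 1 → |G y| ≤ M)
    (hodd : ∀ y, G (-y) = -G y) (hx : |x| ≤ 1) :
    |sphereOp g b G x| ≤ (sphereMass g b - 2 ^ (-g) * sphereMass 0 b) * M := by
  have i0 := integrable_kernel_mul (g := 0) hb (by linarith)
  have i1 := integrable_kernel_mul hb hg
  have j0 := integrable_sphereOp (g := 0) hb (by linarith) hG hM hx
  have j1 := integrable_sphereOp hb hg hG hM hx
  have e : sphereOp g b G x = ∫ q, ((1 - q.1) ^ (-g) - 2 ^ (-g) * (1 - q.1) ^ (-(0 : ℝ))) *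
      G (sphereInner x q.1 q.2) ∂sphereMeasure b := by
    have h0 := integral_odd_sphereMeasure (b := b) (x := x) hG hodd
    have : ∀ q : ℝ × ℝ, ((1 - q.1) ^ (-g) - 2 ^ (-g) * (1 - q.1) ^ (-(0 : ℝ))) *
      G (sphereInner x q.1 q.2) = (1 - q.1) ^ (-g) * G (sphereInner x q.1 q.2) -
        2 ^ (-g) * ((1 - q.1) ^ (-(0 : ℝ)) * G (sphereInner x q.1 q.2)) := fun q => by ring
    simp only [this]
    rw [integral_sub j1 (j0.const_mul _), integral_const_mul]
    simp [h0, sphereOp]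
  rw [e, ← integral_kernel, ← integral_kernel, ← integral_const_mul, ← integral_sub i1
    (i0.const_mul _), ← integral_mul_const, ← Real.norm_eq_abs]
  refine norm_integral_le_of_norm_le ((i1.sub (i0.const_mul _)).mul_const M) ?_
  filter_upwards [ae_sphereMeasure b] with q hq
  have h0 : 0 ≤ (1 - q.1) ^ (-g) - 2 ^ (-g) * (1 - q.1) ^ (-(0 : ℝ)) := by
    rw [neg_zero, Real.rpow_zero, mul_one, sub_nonneg]
    exact Real.rpow_le_rpow_of_nonpos (by linarith [hq.1.2]) (by linarith [hq.1.1]) (by linarith)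
  rw [norm_mul, Real.norm_of_nonneg h0]
  exact mul_le_mul_of_nonneg_left
    (hM _ (abs_sphereInner_le hx (abs_lt.2 hq.1).le (abs_lt.2 hq.2).le)) h0

end Delaunay


/-! ### The Riesz kernel as a zonal kernel, and the linearization on polynomials -/

namespace Delaunay

open Set Polynomial

/-- The exponent `(n - 3) / 2` of the angular weight. -/
noncomputable def angExp (n : ℕ) : ℝ := ((n : ℝ) - 3) / 2

/-- The constant in front of the angular integral in the Riesz kernel. -/
noncomputable def rieszFactor (n : ℕ) (σ : ℝ) : ℝ :=
  rieszConst n σ * ((2 : ℝ) ^ (-fowlerExp n σ) * sphereArea n)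

/-- The constant in the nonlinearity. -/
noncomputable def nonlinConst (n : ℕ) (σ : ℝ) : ℝ :=
  Real.Gamma ((n : ℝ) / 2 + σ) / Real.Gamma ((n : ℝ) / 2 - σ)

/-- The critical exponent. -/
noncomputable def critExp (n : ℕ) (σ : ℝ) : ℝ := ((n : ℝ) + 2 * σ) / ((n : ℝ) - 2 * σ)

section Parameters

variable {n : ℕ} {σ : ℝ}

lemma three_le_dim (hσ : 1 < σ) (hn : 2 * σ < n) : (3 : ℝ) ≤ n := by
  have : 2 < n := by exact_mod_cast (by linarith : (2 : ℝ) < n)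
  exact_mod_cast this

lemma angExp_nonneg (hσ : 1 < σ) (hn : 2 * σ < n) : 0 ≤ angExp n := by
  have := three_le_dim hσ hn
  unfold angExp; linarith

lemma fowlerExp_pos (hn : 2 * σ < n) : 0 < fowlerExp n σ := by unfold fowlerExp; linarith

lemma fowlerExp_lt (hσ : 1 < σ) : fowlerExp n σ < angExp n + 3 / 2 := by
  unfold fowlerExp angExp; linarith

lemma critExp_mul (hn : 2 * σ < n) : critExp n σ * fowlerExp n σ = fowlerExpDual n σ := by
  have : (n : ℝ) - 2 * σ ≠ 0 := by linarith
  unfold critExp fowlerExp fowlerExpDual; field_simp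

lemma one_lt_critExp (hσ : 1 < σ) (hn : 2 * σ < n) : 1 < critExp n σ := by
  unfold critExp
  rw [one_lt_div (by linarith)]
  linarith

lemma nonlinConst_pos (hσ : 1 < σ) (hn : 2 * σ < n) : 0 < nonlinConst n σ :=
  div_pos (Real.Gamma_pos_of_pos (by linarith)) (Real.Gamma_pos_of_pos (by linarith))

lemma rieszFactor_pos (hσ : 1 < σ) (hn : 2 * σ < n) : 0 < rieszFactor n σ := by
  have h3 := three_le_dim hσ hn
  have h1 : 0 < Real.Gamma ((n : ℝ) / 2 - σ) := Real.Gamma_pos_of_pos (by linarith)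
  have h2 : 0 < Real.Gamma σ := Real.Gamma_pos_of_pos (by linarith)
  have h4 : 0 < Real.Gamma (((n : ℝ) - 1) / 2) := Real.Gamma_pos_of_pos (by linarith)
  have := Real.pi_pos
  unfold rieszFactor rieszConst sphereArea
  positivity

/-- This is the normalization under which the bubble with coefficient one is an exact solution. The
two factors of the mass are Beta integrals. -/
lemma nonlinConst_mul_rieszFactor_mul_sphereMass (hσ : 1 < σ) (hn : 2 * σ < n) :
    nonlinConst n σ * rieszFactor n σ * sphereMass (fowlerExp n σ) (angExp n) = 1 := by
  have h3 := three_le_dim hσ hn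
  have g1 := (Real.Gamma_pos_of_pos (by linarith : 0 < (n : ℝ) / 2 - σ)).ne'
  have g2 := (Real.Gamma_pos_of_pos (by linarith : 0 < σ)).ne'
  have g3 := (Real.Gamma_pos_of_pos (by linarith : 0 < ((n : ℝ) - 1) / 2)).ne'
  have g4 := (Real.Gamma_pos_of_pos (by linarith : 0 < (n : ℝ) / 2 + σ)).ne'
  have g5 := (Real.Gamma_pos_of_pos (by linarith : 0 < (n : ℝ) / 2)).ne'
  have g6 := (Real.Gamma_pos_of_pos (by linarith : 0 < (n : ℝ) - 1)).ne'
  have e1 : zonalMoment (fowlerExp n σ) (angExp n) 0 0 = 2 ^ (σ + n / 2 - 1) *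
      (Real.Gamma σ * Real.Gamma (n / 2) / Real.Gamma (n / 2 + σ)) := by
    have a1 : ((0 : ℕ) : ℝ) + angExp n + 3 / 2 - fowlerExp n σ = σ := by
      unfold angExp fowlerExp; push_cast; ring
    have a2 : ((0 : ℕ) : ℝ) + angExp n + 3 / 2 = n / 2 := by unfold angExp; push_cast; ring
    rw [zonalMoment, a1, a2, jacobiMoment_zero (by linarith) (by linarith), ProbabilityTheory.beta,
      add_comm σ (n / 2 : ℝ)]
  -- Legendre's duplication formula removes $\Gamma(n-1)$ from the mass of the weight
  -- $(1-\zeta^2)^{(n-3)/2}$.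
  have dup := Real.Gamma_mul_Gamma_add_half (((n : ℝ) - 1) / 2)
  rw [show ((n : ℝ) - 1) / 2 + 1 / 2 = n / 2 by ring, show 2 * (((n : ℝ) - 1) / 2) = n - 1 by ring]
    at dup
  have e2 : ultraMoment (angExp n) 0 * Real.Gamma (n / 2) =
      Real.Gamma (((n : ℝ) - 1) / 2) * Real.sqrt Real.pi := by
    have a1 : angExp n + 1 = ((n : ℝ) - 1) / 2 := by unfold angExp; ring
    rw [ultraMoment, a1, mul_zero, jacobiMoment_zero (by linarith) (by linarith),
      ProbabilityTheory.beta, show ((n : ℝ) - 1) / 2 + ((n : ℝ) - 1) / 2 = n - 1 by ring]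
    have a2 : (2 : ℝ) ^ ((n : ℝ) - 1 - 1) * 2 ^ (1 - ((n : ℝ) - 1)) = 1 := by
      rw [← Real.rpow_add (by norm_num)]; ring_nf; simp
    field_simp
    linear_combination (2 : ℝ) ^ ((n : ℝ) - 1 - 1) * dup + Real.Gamma ((n : ℝ) - 1) *
      Real.sqrt Real.pi * a2
  have e3 : ultraMoment (angExp n) 0 =
      Real.Gamma (((n : ℝ) - 1) / 2) * Real.sqrt Real.pi / Real.Gamma (n / 2) := by
    rw [eq_div_iff g5, e2]
  have p1 : Real.pi ^ ((n : ℝ) / 2) = Real.pi ^ (((n : ℝ) - 1) / 2) * Real.sqrt Real.pi := by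
    rw [Real.sqrt_eq_rpow, ← Real.rpow_add Real.pi_pos]; congr 1; ring
  have p2 : (2 : ℝ) ^ (2 * σ) = 2 ^ (-fowlerExp n σ) * 2 * 2 ^ (σ + (n : ℝ) / 2 - 1) := by
    have h2 : (2 : ℝ) ^ (-fowlerExp n σ) * 2 * 2 ^ (σ + (n : ℝ) / 2 - 1) =
      2 ^ (-fowlerExp n σ) * 2 ^ (1 : ℝ) * 2 ^ (σ + (n : ℝ) / 2 - 1) := by rw [Real.rpow_one]
    rw [h2, ← Real.rpow_add (by norm_num), ← Real.rpow_add (by norm_num)]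
    congr 1; unfold fowlerExp; ring
  have q1 := (Real.rpow_pos_of_pos Real.pi_pos (((n : ℝ) - 1) / 2)).ne'
  have q2 := (Real.sqrt_pos.2 Real.pi_pos).ne'
  have q3 := (Real.rpow_pos_of_pos (two_pos : (0 : ℝ) < 2) (-fowlerExp n σ)).ne'
  have q4 := (Real.rpow_pos_of_pos (two_pos : (0 : ℝ) < 2) (σ + (n : ℝ) / 2 - 1)).ne'
  rw [sphereMass, e1, e3, nonlinConst, rieszFactor, rieszConst, sphereArea, p1, p2]
  generalize Real.Gamma ((n : ℝ) / 2 - σ) = G at g1 ⊢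
  field_simp

lemma rieszKernel_eq (t : ℝ) : rieszKernel n σ t =
    rieszFactor n σ * ∫ ζ, |Real.cosh t - ζ| ^ (-fowlerExp n σ) ∂ultraMeasure (angExp n) := by
  rw [rieszKernel, angularKernel, rieszFactor, integral_ultraMeasure,
    intervalIntegral.integral_of_le (by norm_num), integral_Ioc_eq_integral_Ioo, angExp]
  ring

lemma sqrt_one_sub_tanh_sq (t : ℝ) : Real.sqrt (1 - Real.tanh t ^ 2) = (Real.cosh t)⁻¹ := by
  have hc := Real.cosh_pos t
  have : 1 - Real.tanh t ^ 2 = ((Real.cosh t)⁻¹) ^ 2 := by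
    rw [Real.tanh_eq_sinh_div_cosh]
    field_simp
    linarith [Real.cosh_sq t]
  rw [this, Real.sqrt_sq (inv_nonneg.2 hc.le)]

/-- For unit vectors, $1-z$ is half the squared chordal distance. The identity is the conformal
equivalence of cylinder and sphere, with conformal factors $1/\cosh$. -/
lemma one_sub_sphereInner_tanh (t τ ζ : ℝ) :
    1 - sphereInner (Real.tanh t) (Real.tanh τ) ζ =
      (Real.cosh (t - τ) - ζ) / (Real.cosh t * Real.cosh τ) := by
  have h1 := (Real.cosh_pos t).ne'
  have h2 := (Real.cosh_pos τ).ne'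
  rw [sphereInner, sqrt_one_sub_tanh_sq, sqrt_one_sub_tanh_sq, Real.tanh_eq_sinh_div_cosh,
    Real.tanh_eq_sinh_div_cosh, Real.cosh_sub]
  field_simp
  ring

lemma one_sub_tanh_sq (t : ℝ) : 1 - Real.tanh t ^ 2 = Real.cosh t ^ (-2 : ℝ) := by
  have hc := Real.cosh_pos t
  rw [Real.tanh_eq_sinh_div_cosh, Real.rpow_neg hc.le, Real.rpow_two]
  field_simp
  linarith [Real.cosh_sq t]

lemma rieszKernel_sub_eq (t τ : ℝ) : rieszKernel n σ (t - τ) =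
    rieszFactor n σ * (Real.cosh t ^ (-fowlerExp n σ) * Real.cosh τ ^ (-fowlerExp n σ) *
      ∫ ζ, (1 - sphereInner (Real.tanh t) (Real.tanh τ) ζ) ^ (-fowlerExp n σ)
        ∂ultraMeasure (angExp n)) := by
  rw [rieszKernel_eq]
  congr 1
  rw [← integral_const_mul]
  refine integral_congr_ae ?_
  filter_upwards [ae_ultraMeasure (angExp n)] with ζ hζ
  have h1 := Real.cosh_pos t
  have h2 := Real.cosh_pos τ
  have h3 : 0 < Real.cosh (t - τ) - ζ := by linarith [Real.one_le_cosh (t - τ), hζ.2]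
  rw [one_sub_sphereInner_tanh, Real.div_rpow h3.le (by positivity), Real.mul_rpow h1.le h2.le,
    abs_of_pos h3]
  have q1 := (Real.rpow_pos_of_pos h1 (-fowlerExp n σ)).ne'
  have q2 := (Real.rpow_pos_of_pos h2 (-fowlerExp n σ)).ne'
  field_simp

lemma range_tanh : range Real.tanh = Ioo (-1) 1 := by
  rw [← image_univ]
  exact Real.tanh_bijOn.image_eq

/-- Conformal covariance of the potential: after $y=\tanh\tau$, convolution on the line becomes
zonal convolution on the sphere, acting on polynomials. -/
lemma integral_rieszKernel_mul_polynomial (hσ : 1 < σ) (hn : 2 * σ < n) (P : ℝ[X]) (t : ℝ) :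
    ∫ τ, rieszKernel n σ (t - τ) * (Real.cosh τ ^ (-fowlerExpDual n σ) * P.eval (Real.tanh τ)) =
      rieszFactor n σ * (Real.cosh t ^ (-fowlerExp n σ) *
        (sphereOpPoly (fowlerExp n σ) (angExp n) P).eval (Real.tanh t)) := by
  have hb := angExp_nonneg hσ hn
  have hg := fowlerExp_lt (n := n) hσ
  set g := fowlerExp n σ with hgdef
  set b := angExp n with hbdef
  set x := Real.tanh t with hx
  have hx1 : |x| < 1 := abs_tanh_lt_one t
  obtain ⟨M, hM0, hM⟩ := exists_abs_eval_le P
  set F : ℝ × ℝ → ℝ := fun q => (1 - q.1) ^ (-g) * P.eval q.2 with hF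
  have hFm : Measurable F := by
    refine Measurable.mul (by fun_prop) (P.continuous.measurable.comp measurable_snd)
  set h : ℝ → ℝ := fun y => (1 - y ^ 2) ^ (b + 1 / 2) *
    ∫ ζ, F (sphereInner x y ζ, y) ∂ultraMeasure b with hh
  have e1 : ∀ τ, rieszKernel n σ (t - τ) *
      (Real.cosh τ ^ (-fowlerExpDual n σ) * P.eval (Real.tanh τ)) =
      rieszFactor n σ * Real.cosh t ^ (-g) * (|1 - Real.tanh τ ^ 2| • h (Real.tanh τ)) := by
    intro τ
    have hc := Real.cosh_pos τ
    rw [rieszKernel_sub_eq, abs_of_nonneg (by rw [one_sub_tanh_sq]; positivity), smul_eq_mul, hh]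
    simp only [hF, integral_mul_const]
    rw [one_sub_tanh_sq, ← Real.rpow_mul hc.le, ← hgdef, ← hbdef]
    -- The total exponent on either side is $-n$. On the right it splits into the Jacobian
    -- $\cosh^{-2}$ of $\tanh$ and the height weight $(1-y^2)^{b+1/2}$.
    have : Real.cosh τ ^ (-g) * Real.cosh τ ^ (-fowlerExpDual n σ) =
        Real.cosh τ ^ (-2 : ℝ) * Real.cosh τ ^ (-2 * (b + 1 / 2)) := by
      rw [← Real.rpow_add hc, ← Real.rpow_add hc]
      congr 1
      rw [hgdef, hbdef]
      unfold fowlerExp fowlerExpDual angExp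
      ring
    linear_combination rieszFactor n σ * Real.cosh t ^ (-g) *
      (∫ ζ, (1 - sphereInner x (Real.tanh τ) ζ) ^ (-g) ∂ultraMeasure b) * P.eval (Real.tanh τ) *
        this
  have e2 : ∫ τ, |1 - Real.tanh τ ^ 2| • h (Real.tanh τ) = ∫ y in Ioo (-1 : ℝ) 1, h y := by
    have := integral_image_eq_integral_abs_deriv_smul (s := univ) MeasurableSet.univ
      (fun τ _ => (hasDerivAt_tanh τ).hasDerivWithinAt) Real.tanh_injective.injOn h
    rw [image_univ, range_tanh, Measure.restrict_univ] at this
    exact this.symm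
  have hint1 : Integrable (fun q : ℝ × ℝ => F (q.1, sphereInner x q.1 q.2)) (sphereMeasure b) :=
    integrable_sphereOp hb hg P.continuous.measurable hM hx1.le
  have hint2 := integrable_sphereMeasure_swap hx1 hFm hint1
  have e3 : ∫ y in Ioo (-1 : ℝ) 1, h y = sphereOp g b (fun y => P.eval y) x := by
    have : sphereOp g b (fun y => P.eval y) x =
        ∫ q, F (q.1, sphereInner x q.1 q.2) ∂sphereMeasure b := rfl
    -- The line integral has the polynomial at the height and the kernel at the inner product;
    -- `sphereOp` has the opposite arrangement. The exchange symmetry reconciles them.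
    rw [this, ← integral_sphereMeasure_swap hx1 hFm]
    have h5 := integral_prod (μ := ultraMeasure (b + 1 / 2)) (ν := ultraMeasure b) _ hint2
    rw [sphereMeasure, h5, integral_ultraMeasure]
  simp only [e1]
  rw [integral_const_mul, e2, e3, eval_sphereOpPoly hb hg hx1.le]
  ring

/-- The linearized operator at the bubble, acting on polynomials in `tanh` times the bubble. -/
noncomputable def linPoly (n : ℕ) (σ : ℝ) (P : ℝ[X]) : ℝ[X] :=
  C (critExp n σ / sphereMass (fowlerExp n σ) (angExp n)) *
    sphereOpPoly (fowlerExp n σ) (angExp n) P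

lemma integral_rieszKernel_mul_coshPoly (hσ : 1 < σ) (hn : 2 * σ < n) (P : ℝ[X]) (t : ℝ) :
    ∫ τ, rieszKernel n σ (t - τ) * (nonlinConst n σ * critExp n σ *
      (Real.cosh τ ^ (-(2 * σ)) * coshPoly (fowlerExp n σ) P τ)) =
      coshPoly (fowlerExp n σ) (linPoly n σ P) t := by
  have h1 := integral_rieszKernel_mul_polynomial hσ hn P t
  have h2 := nonlinConst_mul_rieszFactor_mul_sphereMass hσ hn
  have hM := (sphereMass_pos (angExp_nonneg hσ hn) (fowlerExp_lt (n := n) hσ)).ne'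
  have e : ∀ τ, rieszKernel n σ (t - τ) * (nonlinConst n σ * critExp n σ *
      (Real.cosh τ ^ (-(2 * σ)) * coshPoly (fowlerExp n σ) P τ)) = nonlinConst n σ * critExp n σ *
      (rieszKernel n σ (t - τ) *
        (Real.cosh τ ^ (-fowlerExpDual n σ) * P.eval (Real.tanh τ))) := by
    intro τ
    have : Real.cosh τ ^ (-fowlerExpDual n σ) =
        Real.cosh τ ^ (-(2 * σ)) * Real.cosh τ ^ (-fowlerExp n σ) := by
      rw [← Real.rpow_add (Real.cosh_pos τ)]
      congr 1
      unfold fowlerExp fowlerExpDual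
      ring
    rw [this, coshPoly]
    ring
  simp only [e]
  rw [integral_const_mul, h1, coshPoly, linPoly, eval_mul, eval_C]
  field_simp
  linear_combination critExp n σ *
    (sphereOpPoly (fowlerExp n σ) (angExp n) P).eval (Real.tanh t) * h2

lemma sphereOpPoly_one (g b : ℝ) : sphereOpPoly g b 1 = C (sphereMass g b) := by
  have : (1 : ℝ[X]) = monomial 0 1 := by simp
  rw [this, sphereOpPoly_monomial]
  simp [zonalPoly, sphereMass, mul_comm]

lemma linPoly_one (hσ : 1 < σ) (hn : 2 * σ < n) : linPoly n σ 1 = C (critExp n σ) := by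
  have hM := (sphereMass_pos (angExp_nonneg hσ hn) (fowlerExp_lt (n := n) hσ)).ne'
  rw [linPoly, sphereOpPoly_one, ← C_mul]
  congr 1
  field_simp

/-- The bubble solves the integral equation on the line. -/
lemma integral_rieszKernel_mul_bubble (hσ : 1 < σ) (hn : 2 * σ < n) (t : ℝ) :
    ∫ τ, rieszKernel n σ (t - τ) * (nonlinConst n σ * Real.cosh τ ^ (-fowlerExpDual n σ)) =
      Real.cosh t ^ (-fowlerExp n σ) := by
  have h1 := integral_rieszKernel_mul_polynomial hσ hn 1 t
  have h2 := nonlinConst_mul_rieszFactor_mul_sphereMass hσ hn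
  rw [sphereOpPoly_one] at h1
  simp only [eval_one, mul_one, eval_C] at h1
  have e : ∀ τ, rieszKernel n σ (t - τ) * (nonlinConst n σ * Real.cosh τ ^ (-fowlerExpDual n σ)) =
    nonlinConst n σ * (rieszKernel n σ (t - τ) * Real.cosh τ ^ (-fowlerExpDual n σ)) :=
    fun τ => by ring
  simp only [e]
  rw [integral_const_mul, h1]
  linear_combination Real.cosh t ^ (-fowlerExp n σ) * h2

/-- The contraction rate of the linearized operator on derivatives of even functions. -/
noncomputable def gapRate (n : ℕ) (σ : ℝ) : ℝ :=
  1 - 2 ^ (-(fowlerExp n σ + 1)) * sphereMass 0 (angExp n + 1) /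
    sphereMass (fowlerExp n σ + 1) (angExp n + 1)

lemma gapRate_lt_one (hσ : 1 < σ) (hn : 2 * σ < n) : gapRate n σ < 1 := by
  have hb := angExp_nonneg hσ hn
  have hg := fowlerExp_lt (n := n) hσ
  have h1 := sphereMass_pos (g := 0) (b := angExp n + 1) (by linarith) (by linarith)
  have h2 := sphereMass_pos (g := fowlerExp n σ + 1) (b := angExp n + 1) (by linarith) (by linarith)
  unfold gapRate
  have : 0 < (2 : ℝ) ^ (-(fowlerExp n σ + 1)) * sphereMass 0 (angExp n + 1) /
    sphereMass (fowlerExp n σ + 1) (angExp n + 1) := by positivity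
  linarith

/-- After differentiation the operator acts on $P'$ as the zonal average of exponent
$\gamma_\sigma+1$ in two more dimensions, normalized to mass one. Oddness of $P'$ then lowers the
norm from $1$ to `gapRate`. -/
lemma abs_derivative_linPoly_le (hσ : 1 < σ) (hn : 2 * σ < n) {P : ℝ[X]} {M : ℝ}
    (hM : ∀ y, |y| ≤ 1 → |(derivative P).eval y| ≤ M)
    (heven : ∀ y, (derivative P).eval (-y) = -(derivative P).eval y) {x : ℝ} (hx : |x| ≤ 1) :
    |(derivative (linPoly n σ P)).eval x| ≤ gapRate n σ * M := by
  have hb := angExp_nonneg hσ hn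
  have hg := fowlerExp_lt (n := n) hσ
  have hg0 := fowlerExp_pos hn
  have h1 := sphereMass_pos hb hg
  have h2 := sphereMass_pos (g := fowlerExp n σ + 1) (b := angExp n + 1) (by linarith) (by linarith)
  have hr := sphereMass_succ hb hg
  have hp := critExp_mul hn
  have h3 := abs_sphereOp_le_of_odd (b := angExp n + 1) (g := fowlerExp n σ + 1) (by linarith)
    (by linarith) (by linarith) (derivative P).continuous.measurable hM heven hx
  -- The normalization is exact because $p\gamma_\sigma=\frac{n+2\sigma}{2}$ is the coefficient in
  -- `sphereMass_succ`.
  have e1 : critExp n σ / sphereMass (fowlerExp n σ) (angExp n) *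
      (fowlerExp n σ / (2 * angExp n + 2)) =
      (sphereMass (fowlerExp n σ + 1) (angExp n + 1))⁻¹ := by
    have e2 : 2 * (angExp n + 3 / 2) - fowlerExp n σ = fowlerExpDual n σ := by
      unfold angExp fowlerExp fowlerExpDual; ring
    rw [e2, ← hp] at hr
    have e3 : critExp n σ * (fowlerExp n σ / (2 * angExp n + 2) *
        sphereMass (fowlerExp n σ + 1) (angExp n + 1)) =
        sphereMass (fowlerExp n σ) (angExp n) := by
      refine mul_left_cancel₀ hg0.ne' ?_
      linear_combination hr
    refine eq_inv_of_mul_eq_one_left ?_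
    rw [div_mul_eq_mul_div, div_mul_eq_mul_div,
      div_eq_one_iff_eq h1.ne']
    linear_combination e3
  rw [linPoly, derivative_C_mul, derivative_sphereOpPoly hb hg, ← mul_assoc, ← C_mul, e1, eval_mul,
    eval_C, eval_sphereOpPoly (by linarith) (by linarith) hx, abs_mul,
    abs_of_pos (inv_pos.2 h2)]
  calc _ ≤ (sphereMass (fowlerExp n σ + 1) (angExp n + 1))⁻¹ * _ :=
        mul_le_mul_of_nonneg_left h3 (inv_pos.2 h2).le
    _ = gapRate n σ * M := by unfold gapRate; field_simp

end Parameters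

end Delaunay


/-! ### Convolution on the line and its smoothing -/

namespace Delaunay

open Set

/-- Convolution on the line. -/
noncomputable def lineConv (k F : ℝ → ℝ) (t : ℝ) : ℝ := ∫ τ, F τ * k (t - τ)

lemma lineConv_eq (k F : ℝ → ℝ) (t : ℝ) : lineConv k F t = ∫ s, F (t - s) * k s := by
  rw [lineConv, ← integral_sub_left_eq_self (fun τ => F τ * k (t - τ)) volume t]
  simp

section Smoothing

variable {k k' F : ℝ → ℝ} {M : ℝ}

lemma integrable_lineConv (hk : Integrable k) (hF : Continuous F) (hM : ∀ t, |F t| ≤ M) (t : ℝ) :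
    Integrable fun τ => F τ * k (t - τ) :=
  (hk.comp_sub_left t).bdd_mul (c := M) hF.aestronglyMeasurable (ae_of_all _ hM)

lemma abs_lineConv_le (hk : Integrable k) (hM : ∀ t, |F t| ≤ M) (t : ℝ) :
    |lineConv k F t| ≤ (∫ s, |k s|) * M := by
  rw [lineConv_eq, mul_comm, ← integral_const_mul, ← Real.norm_eq_abs]
  refine norm_integral_le_of_norm_le (hk.abs.const_mul M) (ae_of_all _ fun s => ?_)
  rw [norm_mul]
  exact mul_le_mul_of_nonneg_right (hM _) (abs_nonneg _)

lemma continuous_lineConv (hk : Integrable k) (hF : Continuous F) (hM : ∀ t, |F t| ≤ M) :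
    Continuous (lineConv k F) := by
  rw [funext (lineConv_eq k F)]
  refine continuous_of_dominated (bound := fun s => M * |k s|) (fun t => ?_) (fun t => ?_)
    (hk.abs.const_mul M) (ae_of_all _ fun s => by fun_prop)
  · exact (by fun_prop : Continuous fun s => F (t - s)).aestronglyMeasurable.mul
      hk.aestronglyMeasurable
  · refine ae_of_all _ fun s => ?_
    rw [norm_mul]
    exact mul_le_mul_of_nonneg_right (hM _) (abs_nonneg _)

lemma hasDerivAt_lineConv_right {F' : ℝ → ℝ} {M' : ℝ} (hk : Integrable k)
    (hF : ∀ t, HasDerivAt F (F' t) t) (hF' : Continuous F')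
    (hM : ∀ t, |F t| ≤ M) (hM' : ∀ t, |F' t| ≤ M') (t : ℝ) :
    HasDerivAt (lineConv k F) (lineConv k F' t) t := by
  have hFc : Continuous F := continuous_iff_continuousAt.2 fun t => (hF t).continuousAt
  rw [funext (lineConv_eq k F), lineConv_eq]
  refine (hasDerivAt_integral_of_dominated_loc_of_deriv_le (s := univ)
    (F := fun t s => F (t - s) * k s) (F' := fun t s => F' (t - s) * k s)
    (bound := fun s => M' * |k s|) univ_mem (Eventually.of_forall fun t => ?_) ?_ ?_ ?_
    (hk.abs.const_mul M') ?_).2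
  · exact (by fun_prop : Continuous fun s => F (t - s)).aestronglyMeasurable.mul
      hk.aestronglyMeasurable
  · exact hk.bdd_mul (c := M) (by fun_prop : Continuous fun s => F (t - s)).aestronglyMeasurable
      (ae_of_all _ fun s => hM _)
  · exact (by fun_prop : Continuous fun s => F' (t - s)).aestronglyMeasurable.mul
      hk.aestronglyMeasurable
  · refine ae_of_all _ fun s t _ => ?_
    rw [norm_mul]
    exact mul_le_mul_of_nonneg_right (hM' _) (abs_nonneg _)
  · refine ae_of_all _ fun s t _ => ?_
    exact ((hF (t - s)).comp_sub_const t s).mul_const (k s)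

/-- The kernel may have a corner at the origin and $F$ is merely continuous, so differentiation
under the integral is unavailable. Instead, the increment of the kernel is written as an integral of
$k'$, the integrals are exchanged, and the fundamental theorem is applied to the continuous function
`lineConv k' F`. -/
lemma hasDerivAt_lineConv_left (hkc : Continuous k) (hk : Integrable k) (hk' : Integrable k')
    (hd : ∀ s, s ≠ 0 → HasDerivAt k (k' s) s) (hF : Continuous F) (hM : ∀ t, |F t| ≤ M) (t : ℝ) :
    HasDerivAt (lineConv k F) (lineConv k' F t) t := by
  have hcont := continuous_lineConv hk' hF hM
  have hM0 : 0 ≤ M := (abs_nonneg _).trans (hM 0)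
  have hftc : ∀ t τ, k (t - τ) - k (0 - τ) = ∫ s in (0 : ℝ)..t, k' (s - τ) := by
    intro t τ
    refine (MeasureTheory.integral_eq_of_hasDerivAt_off_countable (fun s => k (s - τ))
      (fun s => k' (s - τ)) (countable_singleton τ) (by fun_prop) (fun s hs => ?_)
      (hk'.comp_sub_right τ).intervalIntegrable).symm
    exact (hd (s - τ) (sub_ne_zero.2 hs.2)).comp_sub_const s τ
  have hprod : ∀ t, Integrable (fun q : ℝ × ℝ => F q.1 * k' (q.2 - q.1))
      (volume.prod (volume.restrict (uIoc 0 t))) := by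
    intro t
    have hmeas : AEStronglyMeasurable (fun q : ℝ × ℝ => F q.1 * k' (q.2 - q.1))
        (volume.prod (volume.restrict (uIoc 0 t))) := by
      refine (hF.comp continuous_fst).aestronglyMeasurable.mul ?_
      have h1 : Measure.QuasiMeasurePreserving (fun q : ℝ × ℝ => q.2 - q.1) (volume.prod volume) volume :=
        (quasiMeasurePreserving_sub volume volume).comp
          Measure.measurePreserving_swap.quasiMeasurePreserving
      refine (hk'.aestronglyMeasurable.comp_quasiMeasurePreserving h1).mono_measure ?_
      exact Measure.prod_mono le_rfl Measure.restrict_le_self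
    rw [integrable_prod_iff' hmeas]
    refine ⟨ae_of_all _ fun s => ?_, ?_⟩
    · exact integrable_lineConv hk' hF hM s
    · refine Integrable.mono' (g := fun _ => (∫ s, |k' s|) * M) ?_ ?_ ?_
      · rw [integrable_const_iff]
        right
        exact ⟨by rw [Measure.restrict_apply_univ, uIoc]; exact measure_Ioc_lt_top⟩
      · exact hmeas.norm.prod_swap.integral_prod_right'
      · refine ae_of_all _ fun s => ?_
        have h := abs_lineConv_le (k := fun s => |k' s|) (F := fun s => |F s|) hk'.abs
          (M := M) (fun t => by rw [abs_abs]; exact hM t) s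
        simpa [lineConv, abs_mul] using h
  have key : ∀ t, lineConv k F t = lineConv k F 0 + ∫ s in (0 : ℝ)..t, lineConv k' F s := by
    intro t
    have h1 : lineConv k F t - lineConv k F 0 = ∫ τ, ∫ s in (0 : ℝ)..t, F τ * k' (s - τ) := by
      rw [lineConv, lineConv, ← integral_sub (integrable_lineConv hk hF hM t)
        (integrable_lineConv hk hF hM 0)]
      refine integral_congr_ae (ae_of_all _ fun τ => ?_)
      simp only
      rw [intervalIntegral.integral_const_mul, ← hftc]
      ring
    have h2 : ∫ τ, ∫ s in (0 : ℝ)..t, F τ * k' (s - τ) = ∫ s in (0 : ℝ)..t, lineConv k' F s := by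
      simp only [intervalIntegral.intervalIntegral_eq_integral_uIoc, integral_smul]
      congr 1
      exact integral_integral_swap (hprod t)
    linarith
  have h3 := intervalIntegral.integral_hasDerivAt_right (hcont.intervalIntegrable 0 t)
    (hcont.stronglyMeasurableAtFilter _ _) hcont.continuousAt
  exact (h3.const_add (lineConv k F 0)).congr_of_eventuallyEq (Eventually.of_forall key)

/-- The available derivatives fall on $F$ and one more falls on the kernel; this gain of one order
drives the bootstrap. -/
lemma contDiff_lineConv (hkc : Continuous k) (hk : Integrable k) (hk' : Integrable k')
    (hd : ∀ s, s ≠ 0 → HasDerivAt k (k' s) s) (j : ℕ) {F : ℝ → ℝ} (hF : ContDiff ℝ j F)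
    (hM : ∀ i ≤ j, ∀ t, |iteratedDeriv i F t| ≤ M) :
    ContDiff ℝ (j + 1 : ℕ) (lineConv k F) ∧ ∀ i ≤ j + 1, ∀ t,
      |iteratedDeriv i (lineConv k F) t| ≤ ((∫ s, |k s|) + ∫ s, |k' s|) * M := by
  have hM0 : 0 ≤ M := (abs_nonneg _).trans (hM 0 (Nat.zero_le _) 0)
  have p1 : 0 ≤ ∫ s, |k s| := integral_nonneg fun s => abs_nonneg _
  have p2 : 0 ≤ ∫ s, |k' s| := integral_nonneg fun s => abs_nonneg _
  induction j generalizing F with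
  | zero =>
    have hFc : Continuous F := hF.continuous
    have hb : ∀ t, |F t| ≤ M := by simpa using hM 0 le_rfl
    have hder := hasDerivAt_lineConv_left hkc hk hk' hd hFc hb
    have hderiv : deriv (lineConv k F) = lineConv k' F := funext fun t => (hder t).deriv
    refine ⟨?_, ?_⟩
    · have : ContDiff ℝ ((0 : ℕ) + 1) (lineConv k F) := by
        rw [contDiff_succ_iff_deriv]
        refine ⟨fun t => (hder t).differentiableAt, by simp, ?_⟩
        rw [hderiv]
        exact contDiff_zero.2 (continuous_lineConv hk' hFc hb)
      exact_mod_cast this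
    · intro i hi t
      interval_cases i
      · have := abs_lineConv_le hk hb t
        rw [iteratedDeriv_zero]
        nlinarith
      · have := abs_lineConv_le hk' hb t
        rw [iteratedDeriv_one, hderiv]
        nlinarith
  | succ j ih =>
    have hFd : ∀ t, HasDerivAt F (deriv F t) t := fun t =>
      (hF.differentiable (by simp) t).hasDerivAt
    have hF' : ContDiff ℝ j (deriv F) :=
      ((contDiff_succ_iff_deriv (n := j)).1 (by exact_mod_cast hF)).2.2
    have hb : ∀ t, |F t| ≤ M := by simpa using hM 0 (Nat.zero_le _)
    have hb' : ∀ i ≤ j, ∀ t, |iteratedDeriv i (deriv F) t| ≤ M := fun i hi t => by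
      rw [← iteratedDeriv_succ']; exact hM (i + 1) (by omega) t
    have hder := hasDerivAt_lineConv_right hk hFd hF'.continuous hb
      (by simpa using hb' 0 (Nat.zero_le _))
    have hderiv : deriv (lineConv k F) = lineConv k (deriv F) := funext fun t => (hder t).deriv
    obtain ⟨c1, c2⟩ := ih hF' hb'
    refine ⟨?_, ?_⟩
    · have : ContDiff ℝ ((j + 1 : ℕ) + 1) (lineConv k F) := by
        rw [contDiff_succ_iff_deriv]
        refine ⟨fun t => (hder t).differentiableAt, by simp, ?_⟩
        rw [hderiv]
        exact c1
      exact_mod_cast this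
    · intro i hi t
      cases i with
      | zero =>
        have := abs_lineConv_le hk hb t
        rw [iteratedDeriv_zero]
        nlinarith
      | succ i =>
        rw [iteratedDeriv_succ', hderiv]
        exact c2 i (by omega) t

end Smoothing

/-! ### Decay and regularity of the cylindrical Riesz kernel -/

section Kernel

variable {n : ℕ} {σ : ℝ}

/-- At $\zeta=1$ the total exponent is $\sigma-\frac32>-1$. -/
lemma integrable_singular_kernel (hσ : 1 < σ) (hn : 2 * σ < n) :
    Integrable (fun ζ : ℝ => (1 - ζ) ^ (-fowlerExp n σ)) (ultraMeasure (angExp n)) := by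
  have h3 := three_le_dim hσ hn
  rw [integrable_ultraMeasure_iff]
  have h1 : 0 < angExp n + 1 - fowlerExp n σ := by unfold angExp fowlerExp; linarith
  have h2 : 0 < angExp n + 1 := by unfold angExp; linarith
  refine (integrableOn_jacobi h1 h2).congr_fun (fun z hz => ?_) measurableSet_Ioo
  have h4 : 0 < 1 - z := by linarith [hz.2]
  simp only [add_sub_cancel_right]
  rw [one_sub_sq_rpow hz, show angExp n + 1 - fowlerExp n σ - 1 = angExp n + -fowlerExp n σ by ring,
    Real.rpow_add h4]
  ring

/-- From $\cosh t-\zeta\ge\frac14e^{|t|}(1-\zeta)$. One majorant handles both the singularity at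
$t=0$, $\zeta=1$ and the decay in $t$. -/
lemma abs_cosh_sub_rpow_le {g : ℝ} (hg : 0 < g) {ζ : ℝ} (hζ : ζ ∈ Ioo (-1 : ℝ) 1) (t : ℝ) :
    |Real.cosh t - ζ| ^ (-g) ≤ 4 ^ g * Real.exp (-(g * |t|)) * (1 - ζ) ^ (-g) := by
  have h1 : 0 < 1 - ζ := by linarith [hζ.2]
  have hc := Real.one_le_cosh t
  have h2 : Real.exp |t| ≤ 2 * Real.cosh t := by
    rw [← Real.cosh_abs, Real.cosh_eq]
    have := Real.exp_pos (-|t|)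
    linarith
  have h3 : Real.exp |t| * (1 - ζ) / 4 ≤ Real.cosh t - ζ := by
    nlinarith [hζ.1, hζ.2, mul_nonneg (sub_nonneg.2 hc) (by linarith [hζ.1] : 0 ≤ 1 + ζ)]
  have h4 : 0 < Real.exp |t| * (1 - ζ) / 4 := by positivity
  rw [abs_of_pos (h4.trans_le h3)]
  refine (Real.rpow_le_rpow_of_nonpos h4 h3 (by linarith)).trans_eq ?_
  rw [Real.div_rpow (by positivity) (by norm_num), Real.mul_rpow (Real.exp_pos _).le h1.le,
    ← Real.exp_mul, Real.rpow_neg (by norm_num : (0 : ℝ) ≤ 4), div_inv_eq_mul]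
  rw [show |t| * -g = -(g * |t|) by ring]
  ring

lemma integrable_cosh_kernel (hσ : 1 < σ) (hn : 2 * σ < n) (t : ℝ) :
    Integrable (fun ζ : ℝ => |Real.cosh t - ζ| ^ (-fowlerExp n σ)) (ultraMeasure (angExp n)) := by
  refine ((integrable_singular_kernel hσ hn).const_mul
    (4 ^ fowlerExp n σ * Real.exp (-(fowlerExp n σ * |t|)))).mono'
      (Measurable.aestronglyMeasurable (by fun_prop)) ?_
  filter_upwards [ae_ultraMeasure (angExp n)] with ζ hζ
  rw [Real.norm_of_nonneg (Real.rpow_nonneg (abs_nonneg _) _)]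
  exact abs_cosh_sub_rpow_le (fowlerExp_pos hn) hζ t

lemma rieszKernel_nonneg (hσ : 1 < σ) (hn : 2 * σ < n) (t : ℝ) : 0 ≤ rieszKernel n σ t := by
  rw [rieszKernel_eq]
  exact mul_nonneg (rieszFactor_pos hσ hn).le
    (integral_nonneg fun ζ => Real.rpow_nonneg (abs_nonneg _) _)

lemma rieszKernel_pos (hσ : 1 < σ) (hn : 2 * σ < n) (t : ℝ) : 0 < rieszKernel n σ t := by
  rw [rieszKernel_eq]
  refine mul_pos (rieszFactor_pos hσ hn) ?_
  rw [integral_pos_iff_support_of_nonneg (fun ζ => Real.rpow_nonneg (abs_nonneg _) _)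
    (integrable_cosh_kernel hσ hn t)]
  have h1 : ultraMeasure (angExp n) univ ≠ 0 := by
    intro h0
    have h2 := integral_even_pow_ultraMeasure (angExp n) 0
    have hb := angExp_nonneg hσ hn
    have h3 : 0 < ultraMoment (angExp n) 0 := jacobiMoment_zero_pos (by linarith) (by linarith)
    rw [Measure.measure_univ_eq_zero.1 h0] at h2
    simp at h2
    linarith
  refine lt_of_lt_of_le (pos_iff_ne_zero.2 h1) ?_
  refine measure_mono_ae ?_
  filter_upwards [ae_ultraMeasure (angExp n)] with ζ hζ _
  have : 0 < Real.cosh t - ζ := by linarith [Real.one_le_cosh t, hζ.2]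
  exact (Real.rpow_pos_of_pos (abs_pos.2 this.ne') _).ne'

lemma rieszKernel_neg (t : ℝ) : rieszKernel n σ (-t) = rieszKernel n σ t := by
  rw [rieszKernel_eq, rieszKernel_eq, Real.cosh_neg]

lemma continuous_rieszKernel (hσ : 1 < σ) (hn : 2 * σ < n) : Continuous (rieszKernel n σ) := by
  rw [funext (rieszKernel_eq (n := n) (σ := σ))]
  have hg := fowlerExp_pos hn
  refine continuous_const.mul (continuous_of_dominated
    (bound := fun ζ => 4 ^ fowlerExp n σ * (1 - ζ) ^ (-fowlerExp n σ))
    (fun t => Measurable.aestronglyMeasurable (by fun_prop)) (fun t => ?_) ((integrable_singular_kernel hσ hn).const_mul _) ?_)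
  · filter_upwards [ae_ultraMeasure (angExp n)] with ζ hζ
    rw [Real.norm_of_nonneg (Real.rpow_nonneg (abs_nonneg _) _)]
    refine (abs_cosh_sub_rpow_le hg hζ t).trans ?_
    have h1 : 0 ≤ (1 - ζ) ^ (-fowlerExp n σ) := Real.rpow_nonneg (by linarith [hζ.2]) _
    have h2 : Real.exp (-(fowlerExp n σ * |t|)) ≤ 1 := by
      rw [Real.exp_le_one_iff]
      have := mul_nonneg hg.le (abs_nonneg t)
      linarith
    refine mul_le_mul_of_nonneg_right ?_ h1
    exact mul_le_of_le_one_right (by positivity) h2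
  · filter_upwards [ae_ultraMeasure (angExp n)] with ζ hζ
    refine Continuous.rpow_const (by fun_prop) fun t => Or.inl ?_
    have : 0 < Real.cosh t - ζ := by linarith [Real.one_le_cosh t, hζ.2]
    exact (abs_pos.2 this.ne').ne'

lemma exists_rieszKernel_le (hσ : 1 < σ) (hn : 2 * σ < n) :
    ∃ C, 0 < C ∧ ∀ t, rieszKernel n σ t ≤ C * Real.cosh t ^ (-fowlerExp n σ) := by
  have hg := fowlerExp_pos hn
  have hK := rieszFactor_pos hσ hn
  refine ⟨4 ^ fowlerExp n σ * rieszKernel n σ 0, mul_pos (by positivity)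
    (rieszKernel_pos hσ hn 0), fun t => ?_⟩
  refine le_trans ?_ (mul_le_mul_of_nonneg_left (exp_le_cosh_rpow_neg hg t)
    (mul_nonneg (by positivity) (rieszKernel_nonneg hσ hn 0)))
  have h0 : rieszKernel n σ 0 = rieszFactor n σ * ∫ ζ, (1 - ζ) ^ (-fowlerExp n σ)
      ∂ultraMeasure (angExp n) := by
    rw [rieszKernel_eq]
    congr 1
    refine integral_congr_ae ?_
    filter_upwards [ae_ultraMeasure (angExp n)] with ζ hζ
    rw [Real.cosh_zero, abs_of_pos (by linarith [hζ.2])]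
  have h1 : ∫ ζ, |Real.cosh t - ζ| ^ (-fowlerExp n σ) ∂ultraMeasure (angExp n) ≤
      ∫ ζ, 4 ^ fowlerExp n σ * Real.exp (-(fowlerExp n σ * |t|)) * (1 - ζ) ^ (-fowlerExp n σ)
        ∂ultraMeasure (angExp n) := by
    refine integral_mono_ae (integrable_cosh_kernel hσ hn t)
      ((integrable_singular_kernel hσ hn).const_mul _) ?_
    filter_upwards [ae_ultraMeasure (angExp n)] with ζ hζ
    exact abs_cosh_sub_rpow_le hg hζ t
  rw [integral_const_mul] at h1
  rw [h0, rieszKernel_eq]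
  calc _ ≤ rieszFactor n σ * _ := mul_le_mul_of_nonneg_left h1 hK.le
    _ = _ := by ring

lemma integrable_exp_neg_abs {a : ℝ} (ha : 0 < a) :
    Integrable fun t : ℝ => Real.exp (-(a * |t|)) := by
  have h1 : IntegrableOn (fun t : ℝ => Real.exp (-(a * |t|))) (Ioi 0) := by
    refine (integrableOn_exp_mul_Ioi (neg_lt_zero.2 ha) 0).congr_fun (fun t ht => ?_)
      measurableSet_Ioi
    rw [mem_Ioi] at ht
    simp only [abs_of_pos ht, neg_mul]
  have h2 : IntegrableOn (fun t : ℝ => Real.exp (-(a * |t|))) (Iio 0) := by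
    simpa [Function.comp_def] using h1.comp_neg
  rw [← integrableOn_univ, ← Iio_union_Ici (a := (0 : ℝ)), integrableOn_union,
    integrableOn_Ici_iff_integrableOn_Ioi]
  exact ⟨h2, h1⟩

lemma integrable_cosh_rpow {a : ℝ} (ha : 0 < a) :
    Integrable fun t : ℝ => Real.cosh t ^ (-a) := by
  refine ((integrable_exp_neg_abs ha).const_mul (2 ^ a)).mono' ?_ (ae_of_all _ fun t => ?_)
  · exact (Real.continuous_cosh.rpow_const fun t =>
      Or.inl (Real.cosh_pos t).ne').aestronglyMeasurable
  · rw [Real.norm_of_nonneg (cosh_rpow_neg_pos a t).le]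
    exact cosh_rpow_neg_le ha t

lemma integrable_rieszKernel (hσ : 1 < σ) (hn : 2 * σ < n) : Integrable (rieszKernel n σ) := by
  obtain ⟨C, hC, h⟩ := exists_rieszKernel_le hσ hn
  refine ((integrable_cosh_rpow (fowlerExp_pos hn)).const_mul C).mono'
    (continuous_rieszKernel hσ hn).aestronglyMeasurable (ae_of_all _ fun t => ?_)
  rw [Real.norm_of_nonneg (rieszKernel_nonneg hσ hn t)]
  exact h t

/-- The derivative of the Riesz kernel away from the origin. -/
noncomputable def rieszKernelDeriv (n : ℕ) (σ t : ℝ) : ℝ :=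
  rieszFactor n σ * ((∫ ζ, -fowlerExp n σ * |Real.cosh t - ζ| ^ (-fowlerExp n σ - 1)
    ∂ultraMeasure (angExp n)) * Real.sinh t)

lemma hasDerivAt_rieszKernel (hσ : 1 < σ) (hn : 2 * σ < n) {t : ℝ} (ht : t ≠ 0) :
    HasDerivAt (rieszKernel n σ) (rieszKernelDeriv n σ t) t := by
  have hb := angExp_nonneg hσ hn
  have hg := fowlerExp_pos hn
  have := isFiniteMeasure_ultraMeasure hb
  have hc : 1 < Real.cosh t := Real.one_lt_cosh.2 ht
  set d := (Real.cosh t - 1) / 2 with hd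
  have hd0 : 0 < d := by rw [hd]; linarith
  have hlow : ∀ c ∈ Metric.ball (Real.cosh t) d, ∀ ζ ∈ Ioo (-1 : ℝ) 1, d ≤ c - ζ := by
    intro c hc' ζ hζ
    rw [Metric.mem_ball, Real.dist_eq, abs_lt] at hc'
    linarith [hc'.1, hζ.2]
  have key : HasDerivAt (fun c : ℝ => ∫ ζ, |c - ζ| ^ (-fowlerExp n σ) ∂ultraMeasure (angExp n))
      (∫ ζ, -fowlerExp n σ * |Real.cosh t - ζ| ^ (-fowlerExp n σ - 1) ∂ultraMeasure (angExp n))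
      (Real.cosh t) := by
    refine (hasDerivAt_integral_of_dominated_loc_of_deriv_le (s := Metric.ball (Real.cosh t) d)
      (F := fun c ζ => |c - ζ| ^ (-fowlerExp n σ))
      (F' := fun c ζ => -fowlerExp n σ * |c - ζ| ^ (-fowlerExp n σ - 1))
      (bound := fun _ => fowlerExp n σ * d ^ (-fowlerExp n σ - 1))
      (Metric.ball_mem_nhds _ hd0) (Eventually.of_forall fun c => Measurable.aestronglyMeasurable (by fun_prop))
      (integrable_cosh_kernel hσ hn t) (Measurable.aestronglyMeasurable (by fun_prop)) ?_
      (integrable_const _) ?_).2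
    · filter_upwards [ae_ultraMeasure (angExp n)] with ζ hζ c hc'
      have h1 := hlow c hc' ζ hζ
      rw [norm_mul, norm_neg, Real.norm_of_nonneg hg.le,
        Real.norm_of_nonneg (Real.rpow_nonneg (abs_nonneg _) _), abs_of_pos (by linarith)]
      exact mul_le_mul_of_nonneg_left (Real.rpow_le_rpow_of_nonpos hd0 h1 (by linarith)) hg.le
    · filter_upwards [ae_ultraMeasure (angExp n)] with ζ hζ c hc'
      have h1 := hlow c hc' ζ hζ
      have h2 : 0 < c - ζ := by linarith
      have h3 := ((hasDerivAt_id c).sub_const ζ).rpow_const (p := -fowlerExp n σ) (Or.inl h2.ne')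
      rw [abs_of_pos h2]
      refine (h3.congr_of_eventuallyEq ?_).congr_deriv (by simp)
      filter_upwards [lt_mem_nhds (by linarith : ζ < c)] with y hy
      rw [abs_of_pos (by linarith)]
      rfl
  have h := (key.comp t (Real.hasDerivAt_cosh t)).const_mul (rieszFactor n σ)
  exact h.congr_of_eventuallyEq (Eventually.of_forall rieszKernel_eq)

lemma rieszKernelDeriv_nonpos (hσ : 1 < σ) (hn : 2 * σ < n) {t : ℝ} (ht : 0 ≤ t) :
    rieszKernelDeriv n σ t ≤ 0 := by
  refine mul_nonpos_of_nonneg_of_nonpos (rieszFactor_pos hσ hn).le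
    (mul_nonpos_of_nonpos_of_nonneg (integral_nonpos fun ζ => ?_) (Real.sinh_nonneg_iff.2 ht))
  have := mul_nonneg (fowlerExp_pos hn).le
    (Real.rpow_nonneg (abs_nonneg (Real.cosh t - ζ)) (-fowlerExp n σ - 1))
  simp only [Pi.zero_apply]
  linarith

lemma rieszKernelDeriv_neg (t : ℝ) : rieszKernelDeriv n σ (-t) = -rieszKernelDeriv n σ t := by
  simp [rieszKernelDeriv]

lemma tendsto_rieszKernel (hσ : 1 < σ) (hn : 2 * σ < n) :
    Tendsto (rieszKernel n σ) atTop (𝓝 0) := by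
  obtain ⟨C, hC, h⟩ := exists_rieszKernel_le hσ hn
  have hg := fowlerExp_pos hn
  have h1 : Tendsto (fun t : ℝ => C * (2 ^ fowlerExp n σ * Real.exp (-(fowlerExp n σ * |t|)))) atTop
      (𝓝 (C * (2 ^ fowlerExp n σ * 0))) := by
    refine ((Real.tendsto_exp_neg_atTop_nhds_zero.comp ?_).const_mul _).const_mul _
    exact (tendsto_abs_atTop_atTop).const_mul_atTop hg
  rw [mul_zero, mul_zero] at h1
  exact squeeze_zero (rieszKernel_nonneg hσ hn) (fun t => (h t).trans
    (mul_le_mul_of_nonneg_left (cosh_rpow_neg_le hg t) hC.le)) h1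

/-- On the half-line the kernel decreases from a finite value to $0$, so its derivative has finite
integral. No estimate of the derivative near the origin is needed. -/
lemma integrable_rieszKernelDeriv (hσ : 1 < σ) (hn : 2 * σ < n) :
    Integrable (rieszKernelDeriv n σ) := by
  have h1 : IntegrableOn (rieszKernelDeriv n σ) (Ioi 0) :=
    integrableOn_Ioi_deriv_of_nonpos (continuous_rieszKernel hσ hn).continuousWithinAt
      (fun t ht => hasDerivAt_rieszKernel hσ hn (ne_of_gt ht))
      (fun t ht => rieszKernelDeriv_nonpos hσ hn (le_of_lt ht)) (tendsto_rieszKernel hσ hn)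
  have h2 : IntegrableOn (rieszKernelDeriv n σ) (Iio 0) := by
    have := (h1.comp_neg).neg
    simpa [Function.comp_def, rieszKernelDeriv_neg] using this
  rw [← integrableOn_univ, ← Iio_union_Ici (a := (0 : ℝ)), integrableOn_union,
    integrableOn_Ici_iff_integrableOn_Ioi]
  exact ⟨h2, h1⟩

end Kernel

end Delaunay


/-! ### Periodization -/

namespace Delaunay

open Set

section Periodization

lemma hasSum_intervalIntegral_shift {L : ℝ} (hL : 0 < L) {f : ℝ → ℝ} (hf : Integrable f) :
    HasSum (fun j : ℤ => ∫ τ in (-L)..L, f (τ + 2 * (j : ℝ) * L)) (∫ τ, f τ) := by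
  have hp : 0 < 2 * L := by linarith
  have h := hasSum_integral_iUnion (f := f) (μ := volume)
    (s := fun j : ℤ => Ioc (-L + j • (2 * L)) (-L + (j + 1) • (2 * L)))
    (fun _ => measurableSet_Ioc) (pairwise_disjoint_Ioc_add_zsmul (-L) (2 * L))
    (by rw [iUnion_Ioc_add_zsmul hp]; exact hf.integrableOn)
  rw [iUnion_Ioc_add_zsmul hp, Measure.restrict_univ] at h
  have e : ∀ j : ℤ, ∫ τ in (-L)..L, f (τ + 2 * (j : ℝ) * L) =
      ∫ τ in Ioc (-L + j • (2 * L)) (-L + (j + 1) • (2 * L)), f τ := by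
    intro j
    have e1 : -L + j • (2 * L) = -L + 2 * (j : ℝ) * L := by simp; ring
    have e2 : -L + (j + 1) • (2 * L) = L + 2 * (j : ℝ) * L := by simp; ring
    rw [intervalIntegral.integral_comp_add_right, intervalIntegral.integral_of_le (by linarith), e1,
      e2]
  simpa only [e] using h

variable {n : ℕ} {σ : ℝ}

lemma summable_rieszKernel_shift (hσ : 1 < σ) (hn : 2 * σ < n) {L : ℝ} (hL : 0 < L) (t : ℝ) :
    Summable fun j : ℤ => rieszKernel n σ (t - 2 * (j : ℝ) * L) := by
  obtain ⟨C, hC, h⟩ := exists_rieszKernel_le hσ hn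
  exact Summable.of_nonneg_of_le (fun j => rieszKernel_nonneg hσ hn _) (fun j => h _)
    ((summable_cosh_shift (fowlerExp_pos hn) hL t).mul_left C)

lemma rieszKernelPer_pos (hσ : 1 < σ) (hn : 2 * σ < n) {L : ℝ} (hL : 0 < L) (t : ℝ) :
    0 < rieszKernelPer n σ L t :=
  (summable_rieszKernel_shift hσ hn hL t).tsum_pos (fun _ => rieszKernel_nonneg hσ hn _) 0
    (rieszKernel_pos hσ hn _)

lemma rieszKernelPer_neg (L t : ℝ) : rieszKernelPer n σ L (-t) = rieszKernelPer n σ L t := by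
  rw [rieszKernelPer, rieszKernelPer, ← (Equiv.neg ℤ).tsum_eq]
  refine tsum_congr fun j => ?_
  rw [← rieszKernel_neg]
  congr 1
  simp only [Equiv.neg_apply]
  push_cast
  ring

lemma rieszKernelPer_periodic (L : ℝ) : Function.Periodic (rieszKernelPer n σ L) (2 * L) := by
  intro t
  rw [rieszKernelPer, rieszKernelPer, ← (Equiv.addRight (1 : ℤ)).tsum_eq]
  refine tsum_congr fun j => ?_
  congr 1
  simp only [Equiv.coe_addRight]
  push_cast
  ring

lemma continuous_rieszKernelPer (hσ : 1 < σ) (hn : 2 * σ < n) {L : ℝ} (hL : 0 < L) :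
    Continuous (rieszKernelPer n σ L) := by
  obtain ⟨C, hC, h⟩ := exists_rieszKernel_le hσ hn
  have hg := fowlerExp_pos hn
  refine continuous_iff_continuousAt.2 fun t => ?_
  have hc : ContinuousOn (rieszKernelPer n σ L) (Metric.ball t 1) := by
    refine continuousOn_tsum (u := fun j : ℤ => C * (2 ^ fowlerExp n σ *
      (Real.exp (fowlerExp n σ * (|t| + 1)) *
        Real.exp (-(2 * fowlerExp n σ * L * |(j : ℝ)|))))) (fun j => ?_) ?_ fun j y hy => ?_
    · exact ((continuous_rieszKernel hσ hn).comp (by fun_prop)).continuousOn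
    · exact (((summable_exp_natAbs (by positivity)).mul_left _).mul_left _).mul_left _
    · rw [Real.norm_of_nonneg (rieszKernel_nonneg hσ hn _)]
      refine (h _).trans (mul_le_mul_of_nonneg_left ((cosh_shift_le hg hL y j).trans ?_) hC.le)
      have h1 : |y| ≤ |t| + 1 := by
        rw [Metric.mem_ball, Real.dist_eq] at hy
        have := abs_sub_abs_le_abs_sub y t
        linarith
      gcongr
  exact hc.continuousAt (Metric.ball_mem_nhds t one_pos)

lemma exists_rieszKernelPer_le (hσ : 1 < σ) (hn : 2 * σ < n) :
    ∃ C, 0 < C ∧ ∀ L, 1 ≤ L → ∀ t, rieszKernelPer n σ L t ≤ C := by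
  obtain ⟨C, hC, h⟩ := exists_rieszKernel_le hσ hn
  have hg := fowlerExp_pos hn
  obtain ⟨B, hB, hB'⟩ := exists_tower_le hg
  refine ⟨C * B, by positivity, fun L hL t => ?_⟩
  have hL0 : 0 < L := by linarith
  calc rieszKernelPer n σ L t ≤ C * tower (fowlerExp n σ) 1 L t := by
        simp only [tower, coshPoly_one]
        rw [← tsum_mul_left]
        exact (summable_rieszKernel_shift hσ hn hL0 t).tsum_le_tsum (fun j => h _)
          ((summable_cosh_shift hg hL0 t).mul_left C)
    _ ≤ C * B := mul_le_mul_of_nonneg_left (hB' L hL t) hC.le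

lemma tendsto_exp_period {a : ℝ} (ha : 0 < a) (s : ℝ) :
    Tendsto (fun L : ℝ => Real.exp (-(a * (2 * L - s)))) atTop (𝓝 0) := by
  refine Real.tendsto_exp_neg_atTop_nhds_zero.comp (Tendsto.const_mul_atTop ha ?_)
  exact tendsto_atTop_add_const_right _ (-s) (tendsto_id.const_mul_atTop two_pos)

lemma tendsto_tower {a : ℝ} (ha : 0 < a) (t : ℝ) :
    Tendsto (fun L => tower a 1 L t) atTop (𝓝 (Real.cosh t ^ (-a))) := by
  obtain ⟨C, hC, h⟩ := exists_tower_sub_le ha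
  have h1 := (tendsto_exp_period ha |t|).const_mul C
  rw [mul_zero] at h1
  refine tendsto_of_tendsto_of_tendsto_of_le_of_le' tendsto_const_nhds
    (by simpa using h1.const_add (Real.cosh t ^ (-a))) ?_ ?_
  · filter_upwards [eventually_gt_atTop 0] with L hL
    simpa using cosh_le_tower ha hL t 0
  · filter_upwards [eventually_ge_atTop 1] with L hL
    linarith [h L hL t]

lemma tendsto_rieszKernelPer (hσ : 1 < σ) (hn : 2 * σ < n) (t : ℝ) :
    Tendsto (fun L => rieszKernelPer n σ L t) atTop (𝓝 (rieszKernel n σ t)) := by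
  obtain ⟨C, hC, h⟩ := exists_rieszKernel_le hσ hn
  have hg := fowlerExp_pos hn
  have h1 := ((tendsto_tower hg t).sub_const (Real.cosh t ^ (-fowlerExp n σ))).const_mul C
  rw [sub_self, mul_zero] at h1
  have key : ∀ L, 0 < L → |rieszKernelPer n σ L t - rieszKernel n σ t| ≤
      C * (tower (fowlerExp n σ) 1 L t - Real.cosh t ^ (-fowlerExp n σ)) := by
    intro L hL
    have hc := summable_cosh_shift hg hL t
    have e1 := (summable_rieszKernel_shift hσ hn hL t).tsum_eq_add_tsum_ite 0
    have e2 := hc.tsum_eq_add_tsum_ite 0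
    have f1 : rieszKernelPer n σ L t - rieszKernel n σ t =
        ∑' j : ℤ, if j = 0 then 0 else rieszKernel n σ (t - 2 * (j : ℝ) * L) := by
      rw [rieszKernelPer, e1]
      simp
    have f2 : tower (fowlerExp n σ) 1 L t - Real.cosh t ^ (-fowlerExp n σ) =
        ∑' j : ℤ, if j = 0 then 0 else
          Real.cosh (t - 2 * (j : ℝ) * L) ^ (-fowlerExp n σ) := by
      simp only [tower, coshPoly_one]
      rw [e2]
      simp
    rw [f1, f2, ← tsum_mul_left]
    refine abs_tsum_le_tsum (Summable.mul_left C (Summable.of_nonneg_of_le (fun j => ?_)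
      (fun j => ?_) hc)) fun j => ?_
    · split_ifs
      · exact le_rfl
      · exact (cosh_rpow_neg_pos _ _).le
    · split_ifs
      · exact (cosh_rpow_neg_pos _ _).le
      · exact le_rfl
    · split_ifs
      · simp
      · rw [abs_of_nonneg (rieszKernel_nonneg hσ hn _)]
        exact h _
  rw [tendsto_iff_norm_sub_tendsto_zero]
  refine squeeze_zero' (Eventually.of_forall fun L => norm_nonneg _) ?_ h1
  filter_upwards [eventually_gt_atTop 0] with L hL using key L hL

/-- Cutting the line into translates of $(-L,L]$ and using the periodicity of $F$ moves the
translations onto the kernel. This is the equivalence of (P) and (E) for periodic functions. -/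
lemma lineConv_eq_intervalIntegral (hσ : 1 < σ) (hn : 2 * σ < n) {L M : ℝ} (hL : 0 < L) {F : ℝ → ℝ}
    (hF : Continuous F) (hM : ∀ t, |F t| ≤ M) (hper : Function.Periodic F (2 * L)) (t : ℝ) :
    lineConv (rieszKernel n σ) F t =
      ∫ τ in (-L)..L, F τ * rieszKernelPer n σ L (t - τ) := by
  have hcR := continuous_rieszKernel hσ hn
  have hint := integrable_lineConv (integrable_rieszKernel hσ hn) hF hM t
  have e : ∀ (j : ℤ) (τ : ℝ), F (τ + 2 * (j : ℝ) * L) *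
      rieszKernel n σ (t - (τ + 2 * (j : ℝ) * L)) =
      F τ * rieszKernel n σ (t - τ - 2 * (j : ℝ) * L) := by
    intro j τ
    rw [← hper.sub_two_mul_int (τ + 2 * (j : ℝ) * L) j]
    congr 2 <;> ring
  have h1 := hasSum_intervalIntegral_shift hL hint
  have h2 := hasSum_intervalIntegral_shift hL hint.norm
  simp only [e] at h1 h2
  have hle : -L ≤ L := by linarith
  simp only [intervalIntegral.integral_of_le hle] at h1 h2 ⊢
  have h3 := hasSum_integral_of_summable_integral_norm
    (μ := volume.restrict (Ioc (-L) L))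
    (F := fun (j : ℤ) τ => F τ * rieszKernel n σ (t - τ - 2 * (j : ℝ) * L))
    (fun j => ((by fun_prop : Continuous fun τ => F τ * rieszKernel n σ
      (t - τ - 2 * (j : ℝ) * L)).integrableOn_Icc.mono_set Ioc_subset_Icc_self)) h2.summable
  rw [lineConv, h1.unique h3]
  refine integral_congr_ae (ae_of_all _ fun τ => ?_)
  simp only [rieszKernelPer]
  rw [tsum_mul_left]

/-- The bubble tower is the potential of the sum of the nonlinearities of the bubbles. -/
lemma lineConv_tower (hσ : 1 < σ) (hn : 2 * σ < n) {L : ℝ} (hL : 0 < L) (t : ℝ) :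
    lineConv (rieszKernel n σ) (fun τ => nonlinConst n σ * tower (fowlerExpDual n σ) 1 L τ) t =
      tower (fowlerExp n σ) 1 L t := by
  have hc := nonlinConst_pos hσ hn
  have hg' : 0 < fowlerExpDual n σ := by unfold fowlerExpDual; linarith
  have hb : ∀ (j : ℤ), ∫ τ, nonlinConst n σ * Real.cosh (τ - 2 * (j : ℝ) * L) ^
      (-fowlerExpDual n σ) * rieszKernel n σ (t - τ) =
      Real.cosh (t - 2 * (j : ℝ) * L) ^ (-fowlerExp n σ) := by
    intro j
    rw [← integral_rieszKernel_mul_bubble hσ hn, ← integral_add_right_eq_self _ (2 * (j : ℝ) * L)]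
    refine integral_congr_ae (ae_of_all _ fun τ => ?_)
    simp only [add_sub_cancel_right]
    rw [mul_comm]
    congr 2
    ring
  have hcont : ∀ j : ℤ, Continuous fun τ => nonlinConst n σ * Real.cosh (τ - 2 * (j : ℝ) * L) ^
      (-fowlerExpDual n σ) := fun j => continuous_const.mul
    ((by fun_prop : Continuous fun τ : ℝ => Real.cosh (τ - 2 * (j : ℝ) * L)).rpow_const
      fun τ => Or.inl (Real.cosh_pos _).ne')
  have hnn : ∀ (j : ℤ) τ, 0 ≤ nonlinConst n σ * Real.cosh (τ - 2 * (j : ℝ) * L) ^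
      (-fowlerExpDual n σ) * rieszKernel n σ (t - τ) := fun j τ =>
    mul_nonneg (mul_nonneg hc.le (cosh_rpow_neg_pos _ _).le) (rieszKernel_nonneg hσ hn _)
  have h3 := hasSum_integral_of_summable_integral_norm (μ := volume)
    (F := fun (j : ℤ) τ => nonlinConst n σ * Real.cosh (τ - 2 * (j : ℝ) * L) ^
      (-fowlerExpDual n σ) * rieszKernel n σ (t - τ))
    (fun j => integrable_lineConv (M := nonlinConst n σ) (integrable_rieszKernel hσ hn) (hcont j)
      (fun τ => by
        rw [abs_of_nonneg (mul_nonneg hc.le (cosh_rpow_neg_pos _ _).le)]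
        exact mul_le_of_le_one_right hc.le (cosh_rpow_neg_le_one hg' _)) t)
    (by
      simp only [Real.norm_of_nonneg (hnn _ _), hb]
      exact summable_cosh_shift (fowlerExp_pos hn) hL t)
  simp only [hb] at h3
  have e : lineConv (rieszKernel n σ) (fun τ => nonlinConst n σ *
      tower (fowlerExpDual n σ) 1 L τ) t = ∫ τ, ∑' j : ℤ, nonlinConst n σ *
      Real.cosh (τ - 2 * (j : ℝ) * L) ^ (-fowlerExpDual n σ) * rieszKernel n σ (t - τ) := by
    rw [lineConv]
    refine integral_congr_ae (ae_of_all _ fun τ => ?_)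
    simp only [tower, coshPoly_one]
    rw [tsum_mul_right, tsum_mul_left]
  rw [e, ← h3.tsum_eq]
  simp only [tower, coshPoly_one]

end Periodization

end Delaunay


/-! ### Operators with bounded kernels on $L^2$ of a finite measure -/

namespace Delaunay

open scoped RealInnerProductSpace

section KernelOperators

variable {α : Type*} [MeasurableSpace α] {μ : Measure α}

/-- A bounded measurable kernel on `α × α`. -/
def IsBddKernel (κ : α → α → ℝ) : Prop :=
  Measurable (Function.uncurry κ) ∧ ∃ M, ∀ t τ, |κ t τ| ≤ M

/-- The function `t ↦ ∫ κ(t, τ) φ(τ) dμ(τ)`. -/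
noncomputable def kerFun (μ : Measure α) (κ : α → α → ℝ) (φ : α → ℝ) (t : α) : ℝ :=
  ∫ τ, κ t τ * φ τ ∂μ

variable {κ κ' : α → α → ℝ} {φ ψ : α → ℝ}

lemma IsBddKernel.measurable_left (hκ : IsBddKernel κ) (t : α) : Measurable (κ t) :=
  hκ.1.comp measurable_prodMk_left

lemma IsBddKernel.sub (hκ : IsBddKernel κ) (hκ' : IsBddKernel κ') :
    IsBddKernel (fun t τ => κ t τ - κ' t τ) := by
  obtain ⟨M, hM⟩ := hκ.2
  obtain ⟨M', hM'⟩ := hκ'.2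
  exact ⟨hκ.1.sub hκ'.1, M + M', fun t τ =>
    (abs_sub _ _).trans (add_le_add (hM t τ) (hM' t τ))⟩

lemma IsBddKernel.integrable_mul (hκ : IsBddKernel κ) (hφ : Integrable φ μ) (t : α) :
    Integrable (fun τ => κ t τ * φ τ) μ := by
  obtain ⟨M, hM⟩ := hκ.2
  exact hφ.bdd_mul (hκ.measurable_left t).aestronglyMeasurable (c := M)
    (.of_forall fun τ => hM t τ)

lemma kerFun_congr (h : φ =ᵐ[μ] ψ) : kerFun μ κ φ = kerFun μ κ ψ := by
  funext t
  exact integral_congr_ae (h.mono fun τ hτ => by simp only [hτ])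

lemma kerFun_add (hκ : IsBddKernel κ) (hφ : Integrable φ μ) (hψ : Integrable ψ μ) (t : α) :
    kerFun μ κ (fun τ => φ τ + ψ τ) t = kerFun μ κ φ t + kerFun μ κ ψ t := by
  simp only [kerFun, mul_add]
  exact integral_add (hκ.integrable_mul hφ t) (hκ.integrable_mul hψ t)

lemma kerFun_sub (hκ : IsBddKernel κ) (hφ : Integrable φ μ) (hψ : Integrable ψ μ) (t : α) :
    kerFun μ κ (fun τ => φ τ - ψ τ) t = kerFun μ κ φ t - kerFun μ κ ψ t := by
  simp only [kerFun, mul_sub]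
  exact integral_sub (hκ.integrable_mul hφ t) (hκ.integrable_mul hψ t)

lemma kerFun_const_mul (c : ℝ) (t : α) :
    kerFun μ κ (fun τ => c * φ τ) t = c * kerFun μ κ φ t := by
  simp only [kerFun, ← integral_const_mul]
  exact integral_congr_ae (.of_forall fun τ => by ring)

lemma kerFun_kernel_sub (hκ : IsBddKernel κ) (hκ' : IsBddKernel κ') (hφ : Integrable φ μ) (t : α) :
    kerFun μ (fun t τ => κ t τ - κ' t τ) φ t = kerFun μ κ φ t - kerFun μ κ' φ t := by
  simp only [kerFun, sub_mul]
  exact integral_sub (hκ.integrable_mul hφ t) (hκ'.integrable_mul hφ t)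

lemma integral_sq_eq_norm_sq (φ : Lp ℝ 2 μ) : ∫ t, φ t ^ 2 ∂μ = ‖φ‖ ^ 2 := by
  rw [← real_inner_self_eq_norm_sq, L2.inner_def]
  exact integral_congr_ae (.of_forall fun t => by simp [sq])

variable [IsFiniteMeasure μ]

lemma stronglyMeasurable_kerFun (hκ : IsBddKernel κ) (hφ : StronglyMeasurable φ) :
    StronglyMeasurable (kerFun μ κ φ) := by
  refine StronglyMeasurable.integral_prod_right (f := fun t τ => κ t τ * φ τ) ?_
  exact (hκ.1.mul (hφ.measurable.comp measurable_snd)).stronglyMeasurable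

lemma integrable_coeFn (φ : Lp ℝ 2 μ) : Integrable φ μ :=
  (Lp.memLp φ).integrable one_le_two

lemma memLp_of_abs_le {M : ℝ} (hφ : AEStronglyMeasurable φ μ) (hM : ∀ t, |φ t| ≤ M) :
    MemLp φ 2 μ :=
  MemLp.of_bound hφ M (.of_forall hM)

/-- Cauchy–Schwarz for the values of a kernel operator. -/
lemma sq_kerFun_le (hκ : IsBddKernel κ) (φ : Lp ℝ 2 μ) (t : α) :
    kerFun μ κ φ t ^ 2 ≤ (∫ τ, κ t τ ^ 2 ∂μ) * ‖φ‖ ^ 2 := by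
  obtain ⟨M, hM⟩ := hκ.2
  have hk : MemLp (κ t) 2 μ := memLp_of_abs_le (hκ.measurable_left t).aestronglyMeasurable (hM t)
  have h1 : kerFun μ κ φ t = ⟪hk.toLp, φ⟫ := by
    rw [L2.inner_def]
    refine integral_congr_ae (hk.coeFn_toLp.mono fun τ hτ => ?_)
    simp only [hτ, RCLike.inner_apply, conj_trivial]
    ring
  have h2 : ∫ τ, κ t τ ^ 2 ∂μ = ‖hk.toLp‖ ^ 2 := by
    rw [← integral_sq_eq_norm_sq]
    exact integral_congr_ae (hk.coeFn_toLp.mono fun τ hτ => by simp only [hτ])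
  rw [h1, h2, ← mul_pow, ← sq_abs]
  exact pow_le_pow_left₀ (abs_nonneg _) (abs_real_inner_le_norm _ _) 2

lemma abs_kerFun_le {M : ℝ} (hκ : IsBddKernel κ) (hM : ∀ t τ, |κ t τ| ≤ M) (φ : Lp ℝ 2 μ) (t : α) :
    |kerFun μ κ φ t| ≤ Real.sqrt (μ.real Set.univ) * M * ‖φ‖ := by
  have hM0 : 0 ≤ M := (abs_nonneg _).trans (hM t t)
  have h : kerFun μ κ φ t ^ 2 ≤ (Real.sqrt (μ.real Set.univ) * M * ‖φ‖) ^ 2 := by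
    refine (sq_kerFun_le hκ φ t).trans ?_
    rw [mul_pow, mul_pow, Real.sq_sqrt measureReal_nonneg]
    gcongr
    calc ∫ τ, κ t τ ^ 2 ∂μ ≤ ∫ _, M ^ 2 ∂μ := by
          refine integral_mono_of_nonneg (.of_forall fun _ => sq_nonneg _) (integrable_const _)
            (.of_forall fun τ => ?_)
          show κ t τ ^ 2 ≤ M ^ 2
          rw [← sq_abs]
          exact pow_le_pow_left₀ (abs_nonneg _) (hM t τ) 2
      _ = _ := by rw [integral_const, smul_eq_mul]
  exact abs_le_of_sq_le_sq h (by positivity)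

lemma memLp_kerFun (hκ : IsBddKernel κ) (φ : Lp ℝ 2 μ) : MemLp (kerFun μ κ φ) 2 μ := by
  obtain ⟨M, hM⟩ := hκ.2
  exact memLp_of_abs_le (stronglyMeasurable_kerFun hκ (Lp.stronglyMeasurable φ)).aestronglyMeasurable
    (abs_kerFun_le hκ hM φ)

lemma norm_toLp_kerFun_le (hκ : IsBddKernel κ) (φ : Lp ℝ 2 μ) :
    ‖(memLp_kerFun hκ φ).toLp‖ ≤ Real.sqrt (∫ t, ∫ τ, κ t τ ^ 2 ∂μ ∂μ) * ‖φ‖ := by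
  obtain ⟨M, hM⟩ := hκ.2
  have h0 : 0 ≤ ∫ t, ∫ τ, κ t τ ^ 2 ∂μ ∂μ :=
    integral_nonneg fun t => integral_nonneg fun τ => sq_nonneg _
  refine abs_le_of_sq_le_sq' ?_ (by positivity) |>.2
  rw [mul_pow, Real.sq_sqrt h0, ← integral_sq_eq_norm_sq, ← integral_mul_const]
  rw [integral_congr_ae ((memLp_kerFun hκ φ).coeFn_toLp.mono fun t ht => by
    show _ = (kerFun μ κ φ t) ^ 2
    rw [ht])]
  refine integral_mono_of_nonneg (.of_forall fun _ => sq_nonneg _) ?_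
    (.of_forall fun t => sq_kerFun_le hκ φ t)
  refine Integrable.mul_const (Integrable.of_bound (C := μ.real Set.univ * M ^ 2) ?_
    (.of_forall fun t => ?_)) _
  · refine (StronglyMeasurable.integral_prod_right (f := fun t τ => κ t τ ^ 2)
      (hκ.1.pow_const 2).stronglyMeasurable).aestronglyMeasurable
  · rw [Real.norm_eq_abs, abs_of_nonneg (integral_nonneg fun τ => sq_nonneg _)]
    calc ∫ τ, κ t τ ^ 2 ∂μ ≤ ∫ _, M ^ 2 ∂μ := by
          refine integral_mono_of_nonneg (.of_forall fun _ => sq_nonneg _) (integrable_const _)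
            (.of_forall fun τ => ?_)
          show κ t τ ^ 2 ≤ M ^ 2
          rw [← sq_abs]
          exact pow_le_pow_left₀ (abs_nonneg _) (hM t τ) 2
      _ = _ := by rw [integral_const, smul_eq_mul]

/-- The operator on `L²(μ)` with a bounded measurable kernel. -/
noncomputable def kerOp (μ : Measure α) [IsFiniteMeasure μ] (hκ : IsBddKernel κ) :
    Lp ℝ 2 μ →L[ℝ] Lp ℝ 2 μ :=
  LinearMap.mkContinuous
    { toFun := fun φ => (memLp_kerFun hκ φ).toLp
      map_add' := fun φ ψ => by
        rw [← MemLp.toLp_add]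
        refine MemLp.toLp_congr _ _ (.of_forall fun t => ?_)
        rw [kerFun_congr (Lp.coeFn_add φ ψ)]
        exact kerFun_add hκ (integrable_coeFn φ) (integrable_coeFn ψ) t
      map_smul' := fun c φ => by
        rw [RingHom.id_apply, ← MemLp.toLp_const_smul]
        refine MemLp.toLp_congr _ _ (.of_forall fun t => ?_)
        rw [kerFun_congr (Lp.coeFn_smul c φ)]
        exact kerFun_const_mul c t }
    (Real.sqrt (∫ t, ∫ τ, κ t τ ^ 2 ∂μ ∂μ)) (norm_toLp_kerFun_le hκ)

lemma coeFn_kerOp (hκ : IsBddKernel κ) (φ : Lp ℝ 2 μ) : kerOp μ hκ φ =ᵐ[μ] kerFun μ κ φ :=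
  (memLp_kerFun hκ φ).coeFn_toLp

lemma kerOp_toLp (hκ : IsBddKernel κ) (hφ : MemLp φ 2 μ) (hψ : MemLp ψ 2 μ)
    (h : ∀ t, kerFun μ κ φ t = ψ t) : kerOp μ hκ hφ.toLp = hψ.toLp := by
  refine Lp.ext ((coeFn_kerOp hκ _).trans (.trans ?_ hψ.coeFn_toLp.symm))
  rw [kerFun_congr hφ.coeFn_toLp]
  exact .of_forall h

/-- The operator norm is at most the Hilbert–Schmidt norm. -/
lemma norm_kerOp_le (hκ : IsBddKernel κ) :
    ‖kerOp μ hκ‖ ≤ Real.sqrt (∫ t, ∫ τ, κ t τ ^ 2 ∂μ ∂μ) :=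
  LinearMap.mkContinuous_norm_le _ (Real.sqrt_nonneg _) _

lemma kerOp_sub (hκ : IsBddKernel κ) (hκ' : IsBddKernel κ') :
    kerOp μ hκ - kerOp μ hκ' = kerOp μ (hκ.sub hκ') := by
  ext1 φ
  refine Lp.ext ?_
  filter_upwards [Lp.coeFn_sub (kerOp μ hκ φ) (kerOp μ hκ' φ), coeFn_kerOp hκ φ, coeFn_kerOp hκ' φ,
    coeFn_kerOp (hκ.sub hκ') φ] with t h1 h2 h3 h4
  rw [sub_apply, h1, Pi.sub_apply, h2, h3, h4,
    kerFun_kernel_sub hκ hκ' (integrable_coeFn φ)]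

lemma inner_kerOp_comm (hκ : IsBddKernel κ) (hs : ∀ t τ, κ t τ = κ τ t) (φ ψ : Lp ℝ 2 μ) :
    ⟪kerOp μ hκ φ, ψ⟫ = ⟪φ, kerOp μ hκ ψ⟫ := by
  obtain ⟨M, hM⟩ := hκ.2
  have hint : Integrable (Function.uncurry fun t τ => ψ t * (κ t τ * φ τ)) (μ.prod μ) := by
    have h := ((integrable_coeFn ψ).mul_prod (integrable_coeFn φ)).bdd_mul
      hκ.1.aestronglyMeasurable (c := M) (.of_forall fun z => hM z.1 z.2)
    refine h.congr (.of_forall fun z => ?_)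
    simp only [Function.uncurry]
    ring
  have h1 : ⟪kerOp μ hκ φ, ψ⟫ = ∫ t, ∫ τ, ψ t * (κ t τ * φ τ) ∂μ ∂μ := by
    rw [L2.inner_def]
    refine integral_congr_ae ((coeFn_kerOp hκ φ).mono fun t ht => ?_)
    simp only [ht, RCLike.inner_apply, conj_trivial, kerFun, integral_const_mul]
  have h2 : ⟪φ, kerOp μ hκ ψ⟫ = ∫ τ, ∫ t, ψ t * (κ t τ * φ τ) ∂μ ∂μ := by
    rw [L2.inner_def]
    refine integral_congr_ae ((coeFn_kerOp hκ ψ).mono fun τ hτ => ?_)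
    simp only [hτ, RCLike.inner_apply, conj_trivial, kerFun, ← integral_mul_const]
    refine integral_congr_ae (.of_forall fun t => ?_)
    simp only [hs t τ]
    ring
  rw [h1, h2, integral_integral_swap hint]

/-- Dominated convergence makes the Hilbert–Schmidt norm of the difference tend to zero: the measure
is finite and the kernels are uniformly bounded. -/
lemma tendsto_norm_kerOp_sub {ι : Type*} {l : Filter ι} [l.IsCountablyGenerated]
    {κ' : ι → α → α → ℝ} (hκ : IsBddKernel κ) (hκ' : ∀ i, IsBddKernel (κ' i)) {M : ℝ}
    (hM : ∀ᶠ i in l, ∀ t τ, |κ' i t τ| ≤ M)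
    (hlim : ∀ t τ, Tendsto (fun i => κ' i t τ) l (𝓝 (κ t τ))) :
    Tendsto (fun i => ‖kerOp μ (hκ' i) - kerOp μ hκ‖) l (𝓝 0) := by
  obtain ⟨M₀, hM₀⟩ := hκ.2
  have hint : Tendsto (fun i => ∫ z, (κ' i z.1 z.2 - κ z.1 z.2) ^ 2 ∂(μ.prod μ)) l (𝓝 0) := by
    have h := tendsto_integral_filter_of_dominated_convergence (μ := μ.prod μ) (l := l)
      (F := fun i z => (κ' i z.1 z.2 - κ z.1 z.2) ^ 2) (f := fun _ => (0 : ℝ))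
      (fun _ => (M + M₀) ^ 2)
      (.of_forall fun i => ((((hκ' i).sub hκ).1).pow_const 2).aestronglyMeasurable)
      (hM.mono fun i hi => .of_forall fun z => ?_) (integrable_const _)
      (.of_forall fun z => ?_)
    · simpa using h
    · rw [Real.norm_eq_abs, abs_pow]
      exact pow_le_pow_left₀ (abs_nonneg _)
        ((abs_sub _ _).trans (add_le_add (hi _ _) (hM₀ _ _))) 2
    · simpa using ((hlim z.1 z.2).sub_const (κ z.1 z.2)).pow 2
  refine squeeze_zero (fun i => norm_nonneg _) (fun i => ?_)
    (by simpa using (Real.continuous_sqrt.tendsto _).comp hint)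
  rw [kerOp_sub]
  refine (norm_kerOp_le _).trans (le_of_eq ?_)
  simp only [Function.comp]
  congr 1
  obtain ⟨M', hM'⟩ := ((hκ' i).sub hκ).2
  refine (integral_prod (fun z : α × α => (κ' i z.1 z.2 - κ z.1 z.2) ^ 2)
    (Integrable.of_bound (C := M' ^ 2) ((((hκ' i).sub hκ).1).pow_const 2).aestronglyMeasurable
      (.of_forall fun z => ?_))).symm
  rw [Real.norm_eq_abs, abs_pow]
  exact pow_le_pow_left₀ (abs_nonneg _) (hM' _ _) 2

end KernelOperators

/-! ### Self-adjoint operators with decaying powers, and rank-one corrections -/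

section SelfAdjoint

variable {H : Type*} [NormedAddCommGroup H] [InnerProductSpace ℝ H]

/-- Self-adjointness gives $\|S^mx\|^2=\langle x,S^{2m}x\rangle\le\|x\|\,\|S^{2m}x\|$; iterate along
$m=2^k$. -/
lemma norm_apply_pow_le (S : H →L[ℝ] H) (hS : ∀ x y, ⟪S x, y⟫ = ⟪x, S y⟫) (x : H) (k : ℕ) :
    ‖S x‖ ^ 2 ^ k * ‖x‖ ≤ ‖(S ^ 2 ^ k) x‖ * ‖x‖ ^ 2 ^ k := by
  have hpow : ∀ (j : ℕ) (x y : H), ⟪(S ^ j) x, y⟫ = ⟪x, (S ^ j) y⟫ := by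
    intro j
    induction j with
    | zero => intro x y; simp
    | succ j ih =>
      intro x y
      rw [pow_succ, mul_apply_eq_comp, ih, hS, ← mul_apply_eq_comp,
        ← pow_succ', pow_succ]
  rcases eq_or_ne x 0 with rfl | hx
  · simp
  have hx' : 0 < ‖x‖ := norm_pos_iff.2 hx
  induction k with
  | zero => simp
  | succ k ih =>
    have h1 : ‖(S ^ 2 ^ k) x‖ ^ 2 ≤ ‖x‖ * ‖(S ^ 2 ^ (k + 1)) x‖ := by
      rw [← real_inner_self_eq_norm_sq, hpow, ← mul_apply_eq_comp, ← pow_add,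
        ← two_mul, ← pow_succ']
      exact real_inner_le_norm _ _
    have h2 : (‖S x‖ ^ 2 ^ k * ‖x‖) ^ 2 ≤ (‖(S ^ 2 ^ k) x‖ * ‖x‖ ^ 2 ^ k) ^ 2 :=
      pow_le_pow_left₀ (by positivity) ih 2
    rw [mul_pow, mul_pow, ← pow_mul, ← pow_mul, ← pow_succ] at h2
    refine le_of_mul_le_mul_right ?_ hx'
    calc ‖S x‖ ^ 2 ^ (k + 1) * ‖x‖ * ‖x‖ = ‖S x‖ ^ 2 ^ (k + 1) * ‖x‖ ^ 2 := by ring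
      _ ≤ ‖(S ^ 2 ^ k) x‖ ^ 2 * ‖x‖ ^ 2 ^ (k + 1) := h2
      _ ≤ ‖x‖ * ‖(S ^ 2 ^ (k + 1)) x‖ * ‖x‖ ^ 2 ^ (k + 1) := by gcongr
      _ = _ := by ring

/-- A self-adjoint operator whose powers decay like `θ ^ k` on a dense set has norm at most `θ`. -/
lemma norm_le_of_pow_decay {θ : ℝ} (hθ : 0 < θ) (S : H →L[ℝ] H) (hS : ∀ x y, ⟪S x, y⟫ = ⟪x, S y⟫)
    {D : Set H} (hD : Dense D) (hdec : ∀ x ∈ D, ∃ C, ∀ k : ℕ, ‖(S ^ (k + 1)) x‖ ≤ C * θ ^ k) :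
    ‖S‖ ≤ θ := by
  have key : ∀ x ∈ D, ‖S x‖ ≤ θ * ‖x‖ := by
    intro x hx
    obtain ⟨C, hC⟩ := hdec x hx
    rcases eq_or_ne x 0 with rfl | hx0
    · simp
    have hx' : 0 < ‖x‖ := norm_pos_iff.2 hx0
    by_contra! hlt
    -- If $\|Sx\|>\theta\|x\|$, the powers $2^k$ of this ratio would be unbounded, whereas the
    -- assumed decay bounds them by a constant.
    have hq : 1 < ‖S x‖ / (θ * ‖x‖) := by rwa [one_lt_div (by positivity)]
    have hbound : ∀ k : ℕ, (‖S x‖ / (θ * ‖x‖)) ^ 2 ^ k ≤ C / θ / ‖x‖ := by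
      intro k
      have h1 := norm_apply_pow_le S hS x k
      have h2 : ‖(S ^ 2 ^ k) x‖ ≤ C / θ * θ ^ 2 ^ k := by
        obtain ⟨j, hj⟩ : ∃ j, 2 ^ k = j + 1 := ⟨2 ^ k - 1, by
          have := Nat.one_le_two_pow (n := k); omega⟩
        rw [hj]
        refine (hC j).trans (le_of_eq ?_)
        rw [pow_succ]
        field_simp
      rw [div_pow, mul_pow, div_le_iff₀ (by positivity)]
      refine le_of_mul_le_mul_right ?_ hx'
      refine h1.trans ((mul_le_mul_of_nonneg_right h2 (by positivity)).trans (le_of_eq ?_))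
      field_simp
    have htend := (tendsto_pow_atTop_atTop_of_one_lt hq).comp
      (tendsto_pow_atTop_atTop_of_one_lt (one_lt_two (α := ℕ)))
    obtain ⟨k, hk⟩ := (htend.eventually_gt_atTop (C / θ / ‖x‖)).exists
    exact absurd (hbound k) (not_le.2 hk)
  refine S.opNorm_le_bound hθ.le fun x => ?_
  exact hD.induction (P := fun x => ‖S x‖ ≤ θ * ‖x‖) key
    (isClosed_le (by fun_prop) (by fun_prop)) x

/-- As $SQ=0$, the operator factors as $(1-S)(1-pQ)$. The first factor is inverted by a Neumann
series and the second has inverse $1+\frac{p}{1-p}Q$. -/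
lemma isUnit_one_sub_of_rank_one_perturbation [CompleteSpace H] {S Q : H →L[ℝ] H} {p : ℝ}
    (hS : ‖S‖ < 1) (hQ : Q * Q = Q) (hSQ : S * Q = 0) (hp : p ≠ 1) :
    IsUnit (1 - (S + p • Q)) := by
  have h1 : IsUnit (1 - S) := isUnit_one_sub_of_norm_lt_one hS
  have hp' : 1 - p ≠ 0 := sub_ne_zero.2 hp.symm
  have h2 : IsUnit (1 - p • Q) := by
    have e : p / (1 - p) - p - p * (p / (1 - p)) = 0 := by field_simp; ring
    have e1 : (1 - p • Q) * (1 + (p / (1 - p)) • Q) = 1 + (p / (1 - p) - p - p * (p / (1 - p))) • Q := by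
      simp only [sub_mul, mul_add, one_mul, mul_one, smul_mul_assoc, mul_smul_comm, hQ]
      module
    have e2 : (1 + (p / (1 - p)) • Q) * (1 - p • Q) = 1 + (p / (1 - p) - p - p * (p / (1 - p))) • Q := by
      simp only [mul_sub, add_mul, one_mul, mul_one, smul_mul_assoc, mul_smul_comm, hQ]
      module
    rw [e, zero_smul, add_zero] at e1 e2
    exact ⟨⟨_, _, e1, e2⟩, rfl⟩
  have h3 : 1 - (S + p • Q) = (1 - S) * (1 - p • Q) := by
    simp only [sub_mul, mul_sub, one_mul, mul_one, mul_smul_comm, hSQ]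
    module
  rw [h3]
  exact h1.mul h2

end SelfAdjoint

end Delaunay


/-! ### The spectral gap of the linearization at the bubble -/

namespace Delaunay

open Polynomial Set
open scoped RealInnerProductSpace

section SpectralGap

variable {n : ℕ} {σ : ℝ}

/-- The derivative of the nonlinearity along the standard bubble. -/
noncomputable def linWeight (n : ℕ) (σ t : ℝ) : ℝ :=
  nonlinConst n σ * critExp n σ * Real.cosh t ^ (-(2 * σ))

/-- The measure with density `linWeight`. -/
noncomputable def linMeasure (n : ℕ) (σ : ℝ) : Measure ℝ :=
  volume.withDensity fun t => ENNReal.ofReal (linWeight n σ t)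

lemma linWeight_pos (hσ : 1 < σ) (hn : 2 * σ < n) (t : ℝ) : 0 < linWeight n σ t :=
  mul_pos (mul_pos (nonlinConst_pos hσ hn) (by linarith [one_lt_critExp hσ hn]))
    (cosh_rpow_neg_pos _ _)

lemma continuous_linWeight : Continuous (linWeight n σ) :=
  continuous_const.mul
    (Real.continuous_cosh.rpow_const fun t => Or.inl (Real.cosh_pos t).ne')

lemma integrable_linWeight (hσ : 1 < σ) : Integrable (linWeight n σ) :=
  (integrable_cosh_rpow (by linarith)).const_mul _

lemma isFiniteMeasure_linMeasure (hσ : 1 < σ) : IsFiniteMeasure (linMeasure n σ) :=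
  isFiniteMeasure_withDensity_ofReal (integrable_linWeight hσ).2

lemma integral_linMeasure (hσ : 1 < σ) (hn : 2 * σ < n) (g : ℝ → ℝ) :
    ∫ t, g t ∂linMeasure n σ = ∫ t, linWeight n σ t * g t := by
  rw [linMeasure, integral_withDensity_eq_integral_toReal_smul
    (continuous_linWeight.measurable.ennreal_ofReal) (.of_forall fun _ => ENNReal.ofReal_lt_top)]
  refine integral_congr_ae (.of_forall fun t => ?_)
  simp only [ENNReal.toReal_ofReal (linWeight_pos hσ hn t).le, smul_eq_mul]

/-- The kernel `k (t - τ)` symmetrized under `τ ↦ -τ`. -/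
noncomputable def symKernel (k : ℝ → ℝ) (t τ : ℝ) : ℝ := (k (t - τ) + k (t + τ)) / 2

lemma symKernel_comm {k : ℝ → ℝ} (hk : ∀ t, k (-t) = k t) (t τ : ℝ) :
    symKernel k t τ = symKernel k τ t := by
  unfold symKernel
  rw [← hk (t - τ), neg_sub, add_comm t τ]

lemma abs_symKernel_le {k : ℝ → ℝ} {M : ℝ} (hM : ∀ t, |k t| ≤ M) (t τ : ℝ) :
    |symKernel k t τ| ≤ M := by
  have h1 := abs_le.1 (hM (t - τ))
  have h2 := abs_le.1 (hM (t + τ))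
  rw [symKernel, abs_le]
  constructor <;> linarith

lemma isBddKernel_symKernel {k : ℝ → ℝ} {M : ℝ} (hk : Continuous k) (hM : ∀ t, |k t| ≤ M) :
    IsBddKernel (symKernel k) := by
  refine ⟨Continuous.measurable ?_, M, abs_symKernel_le hM⟩
  unfold symKernel Function.uncurry
  fun_prop

lemma exists_abs_rieszKernel_le (hσ : 1 < σ) (hn : 2 * σ < n) :
    ∃ M, 0 < M ∧ ∀ t, |rieszKernel n σ t| ≤ M := by
  obtain ⟨C, hC, h⟩ := exists_rieszKernel_le hσ hn
  refine ⟨C, hC, fun t => ?_⟩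
  rw [abs_of_nonneg (rieszKernel_nonneg hσ hn t)]
  exact (h t).trans (mul_le_of_le_one_right hC.le (cosh_rpow_neg_le_one (fowlerExp_pos hn) t))

lemma isBddKernel_rieszKernel (hσ : 1 < σ) (hn : 2 * σ < n) :
    IsBddKernel (symKernel (rieszKernel n σ)) := by
  obtain ⟨M, -, hM⟩ := exists_abs_rieszKernel_le hσ hn
  exact isBddKernel_symKernel (continuous_rieszKernel hσ hn) hM

lemma continuous_coshPoly (a : ℝ) (P : ℝ[X]) : Continuous (coshPoly a P) :=
  continuous_iff_continuousAt.2 fun t => (hasDerivAt_coshPoly a P t).continuousAt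

/-- The even part of a polynomial. -/
noncomputable def evenPart (P : ℝ[X]) : ℝ[X] := C (1 / 2) * (P + P.comp (-X))

lemma eval_evenPart (P : ℝ[X]) (x : ℝ) : (evenPart P).eval x = (P.eval x + P.eval (-x)) / 2 := by
  simp [evenPart]
  ring

lemma eval_derivative_evenPart (P : ℝ[X]) (x : ℝ) :
    (derivative (evenPart P)).eval x =
      ((derivative P).eval x - (derivative P).eval (-x)) / 2 := by
  simp [evenPart, derivative_comp]
  ring

/-- Since the Riesz kernel is even, symmetrizing it averages the image over $t$ and $-t$. This is
what annihilates the odd translation mode. -/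
lemma kerFun_symKernel_coshPoly (hσ : 1 < σ) (hn : 2 * σ < n) (P : ℝ[X]) (t : ℝ) :
    kerFun (linMeasure n σ) (symKernel (rieszKernel n σ)) (coshPoly (fowlerExp n σ) P) t =
      coshPoly (fowlerExp n σ) (evenPart (linPoly n σ P)) t := by
  obtain ⟨M, -, hM⟩ := exists_abs_rieszKernel_le hσ hn
  have hc := continuous_rieszKernel hσ hn
  obtain ⟨B, hB, h⟩ := exists_abs_coshPoly_le (fowlerExp n σ) P
  have hint : ∀ s, Integrable fun τ => rieszKernel n σ (s - τ) *
      (nonlinConst n σ * critExp n σ *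
        (Real.cosh τ ^ (-(2 * σ)) * coshPoly (fowlerExp n σ) P τ)) := by
    intro s
    refine Integrable.bdd_mul (c := M) ?_ (Continuous.aestronglyMeasurable (by fun_prop))
      (.of_forall fun τ => hM _)
    refine (((integrable_cosh_rpow (a := 2 * σ) (by linarith)).mul_bdd (c := B)
      (continuous_coshPoly _ P).aestronglyMeasurable (.of_forall fun τ => ?_))).const_mul _
    exact (h τ).trans (mul_le_of_le_one_right hB.le
      (cosh_rpow_neg_le_one (fowlerExp_pos hn) τ))
  have e1 := integral_rieszKernel_mul_coshPoly hσ hn P t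
  have e2 := integral_rieszKernel_mul_coshPoly hσ hn P (-t)
  have e3 : coshPoly (fowlerExp n σ) (evenPart (linPoly n σ P)) t =
      (coshPoly (fowlerExp n σ) (linPoly n σ P) t +
        coshPoly (fowlerExp n σ) (linPoly n σ P) (-t)) / 2 := by
    simp only [coshPoly, eval_evenPart, Real.cosh_neg, Real.tanh_neg]
    ring
  rw [e3, ← e1, ← e2, kerFun, integral_linMeasure hσ hn, ← integral_add (hint t) (hint (-t)),
    ← integral_div]
  refine integral_congr_ae (.of_forall fun τ => ?_)
  simp only [symKernel, linWeight]
  rw [show -t - τ = -(t + τ) by ring, rieszKernel_neg]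
  ring

variable [IsFiniteMeasure (linMeasure n σ)]

lemma memLp_coshPoly (hn : 2 * σ < n) (P : ℝ[X]) :
    MemLp (coshPoly (fowlerExp n σ) P) 2 (linMeasure n σ) := by
  obtain ⟨C, hC, h⟩ := exists_abs_coshPoly_le (fowlerExp n σ) P
  exact memLp_of_abs_le (continuous_coshPoly _ _).aestronglyMeasurable fun t =>
    (h t).trans (mul_le_of_le_one_right hC.le (cosh_rpow_neg_le_one (fowlerExp_pos hn) t))

/-- The class of `coshPoly (fowlerExp n σ) P` in `L²`. -/
noncomputable def coshVec (hn : 2 * σ < n) (P : ℝ[X]) : Lp ℝ 2 (linMeasure n σ) :=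
  (memLp_coshPoly hn P).toLp

lemma coshVec_sub_smul (hn : 2 * σ < n) (P : ℝ[X]) (c : ℝ) :
    coshVec hn P - c • coshVec hn 1 = coshVec hn (P - C c) := by
  rw [coshVec, coshVec, coshVec, ← MemLp.toLp_const_smul, ← MemLp.toLp_sub]
  refine MemLp.toLp_congr _ _ (.of_forall fun t => ?_)
  simp [coshPoly]
  ring

/-- The linearized operator at the bubble on even functions. -/
noncomputable def linOp (hσ : 1 < σ) (hn : 2 * σ < n) :
    Lp ℝ 2 (linMeasure n σ) →L[ℝ] Lp ℝ 2 (linMeasure n σ) :=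
  kerOp (linMeasure n σ) (isBddKernel_rieszKernel hσ hn)

lemma linOp_coshVec (hσ : 1 < σ) (hn : 2 * σ < n) (P : ℝ[X]) :
    linOp hσ hn (coshVec hn P) = coshVec hn (evenPart (linPoly n σ P)) :=
  kerOp_toLp _ _ _ (kerFun_symKernel_coshPoly hσ hn P)

lemma linOp_coshVec_one (hσ : 1 < σ) (hn : 2 * σ < n) :
    linOp hσ hn (coshVec hn 1) = critExp n σ • coshVec hn 1 := by
  rw [linOp_coshVec, coshVec, coshVec, ← MemLp.toLp_const_smul]
  refine MemLp.toLp_congr _ _ (.of_forall fun t => ?_)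
  simp [coshPoly, eval_evenPart, linPoly_one hσ hn]
  ring

/-- The orthogonal projection onto the span of the bubble. -/
noncomputable def bubbleProj (hn : 2 * σ < n) :
    Lp ℝ 2 (linMeasure n σ) →L[ℝ] Lp ℝ 2 (linMeasure n σ) :=
  (innerSL ℝ (coshVec hn 1)).smulRight ((‖coshVec (σ := σ) hn 1‖ ^ 2)⁻¹ • coshVec hn 1)

lemma bubbleProj_apply (hn : 2 * σ < n) (φ : Lp ℝ 2 (linMeasure n σ)) :
    bubbleProj hn φ = (⟪coshVec hn 1, φ⟫ * (‖coshVec (σ := σ) hn 1‖ ^ 2)⁻¹) • coshVec hn 1 := by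
  simp [bubbleProj, smul_smul]

lemma bubbleProj_coshVec_one (hn : 2 * σ < n) :
    bubbleProj hn (coshVec hn 1) = coshVec (σ := σ) hn 1 := by
  rw [bubbleProj_apply, real_inner_self_eq_norm_sq]
  rcases eq_or_ne (coshVec (σ := σ) hn 1) 0 with h | h
  · simp [h]
  · rw [mul_inv_cancel₀ (by simpa using h), one_smul]

lemma bubbleProj_mul_self (hn : 2 * σ < n) :
    bubbleProj hn * bubbleProj (σ := σ) hn = bubbleProj hn := by
  ext1 φ
  rw [mul_apply_eq_comp, bubbleProj_apply hn φ, map_smul, bubbleProj_coshVec_one]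

/-- The linearized operator with the direction of the bubble removed. -/
noncomputable def gapOp (hσ : 1 < σ) (hn : 2 * σ < n) :
    Lp ℝ 2 (linMeasure n σ) →L[ℝ] Lp ℝ 2 (linMeasure n σ) :=
  linOp hσ hn - critExp n σ • bubbleProj hn

lemma gapOp_coshVec_one (hσ : 1 < σ) (hn : 2 * σ < n) : gapOp hσ hn (coshVec hn 1) = 0 := by
  rw [gapOp, sub_apply, linOp_coshVec_one, smul_apply, bubbleProj_coshVec_one, sub_self]

lemma gapOp_mul_bubbleProj (hσ : 1 < σ) (hn : 2 * σ < n) :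
    gapOp hσ hn * bubbleProj hn = 0 := by
  ext1 φ
  rw [mul_apply_eq_comp, bubbleProj_apply, map_smul, gapOp_coshVec_one, smul_zero, zero_apply]

lemma inner_gapOp_comm (hσ : 1 < σ) (hn : 2 * σ < n) (φ ψ : Lp ℝ 2 (linMeasure n σ)) :
    ⟪gapOp hσ hn φ, ψ⟫ = ⟪φ, gapOp hσ hn ψ⟫ := by
  have h := inner_kerOp_comm (isBddKernel_rieszKernel hσ hn)
    (symKernel_comm (rieszKernel_neg (n := n) (σ := σ))) φ ψ
  rw [gapOp, sub_apply, sub_apply, inner_sub_left, inner_sub_right, linOp, h, smul_apply,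
    smul_apply, inner_smul_left, inner_smul_right, bubbleProj_apply, bubbleProj_apply,
    inner_smul_left, inner_smul_right, real_inner_comm φ]
  simp only [conj_trivial]
  ring

/-- Removing the bubble component only shifts the polynomial by a constant, which the estimates on
derivatives do not see. -/
lemma gapOp_coshVec (hσ : 1 < σ) (hn : 2 * σ < n) (P : ℝ[X]) :
    ∃ c, gapOp hσ hn (coshVec hn P) = coshVec hn (evenPart (linPoly n σ P) - C c) := by
  refine ⟨critExp n σ * (⟪coshVec hn 1, coshVec hn P⟫ * (‖coshVec (σ := σ) hn 1‖ ^ 2)⁻¹), ?_⟩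
  rw [gapOp, sub_apply, linOp_coshVec, smul_apply, bubbleProj_apply, smul_smul, coshVec_sub_smul]

/-- A strict bound for the spectrum of `gapOp`. -/
noncomputable def gapBound (n : ℕ) (σ : ℝ) : ℝ := max (gapRate n σ) (1 / 2)

/-- The first application makes the polynomial even; each later one contracts the sup norm of its
derivative. The rate is `gapBound` rather than `gapRate` because `norm_le_of_pow_decay` requires a
positive rate. -/
lemma exists_gapOp_pow_coshVec (hσ : 1 < σ) (hn : 2 * σ < n) (P : ℝ[X]) :
    ∃ M, ∀ k : ℕ, ∃ Q : ℝ[X], (gapOp hσ hn ^ (k + 1)) (coshVec hn P) = coshVec hn Q ∧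
      (∀ y, (derivative Q).eval (-y) = -(derivative Q).eval y) ∧
      ∀ y, |y| ≤ 1 → |(derivative Q).eval y| ≤ M * gapBound n σ ^ k := by
  obtain ⟨M, hM⟩ := (isCompact_Icc (a := (-1 : ℝ)) (b := 1)).exists_bound_of_continuousOn
    (derivative (evenPart (linPoly n σ P))).continuous.continuousOn
  refine ⟨M, fun k => ?_⟩
  induction k with
  | zero =>
    obtain ⟨c, hc⟩ := gapOp_coshVec hσ hn P
    refine ⟨_, by simpa using hc, fun y => ?_, fun y hy => ?_⟩
    · simp only [derivative_sub, derivative_C, sub_zero, eval_derivative_evenPart, neg_neg]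
      ring
    · simpa using hM y (abs_le.1 hy)
  | succ k ih =>
    obtain ⟨Q, hQ, hodd, hbd⟩ := ih
    obtain ⟨c, hc⟩ := gapOp_coshVec hσ hn Q
    refine ⟨_, by rw [pow_succ', mul_apply_eq_comp, hQ, hc], fun y => ?_, fun y hy => ?_⟩
    · simp only [derivative_sub, derivative_C, sub_zero, eval_derivative_evenPart, neg_neg]
      ring
    · have h0 : 0 ≤ M * gapBound n σ ^ k := (abs_nonneg _).trans (hbd y hy)
      have h1 := abs_derivative_linPoly_le hσ hn hbd hodd hy
      have h2 := abs_derivative_linPoly_le hσ hn hbd hodd (x := -y) (by simpa using hy)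
      have h3 : gapRate n σ * (M * gapBound n σ ^ k) ≤ M * gapBound n σ ^ (k + 1) := by
        calc _ ≤ gapBound n σ * (M * gapBound n σ ^ k) :=
              mul_le_mul_of_nonneg_right (le_max_left _ _) h0
          _ = _ := by ring
      simp only [derivative_sub, derivative_C, sub_zero, eval_derivative_evenPart]
      rw [abs_le] at h1 h2 ⊢
      constructor <;> linarith

lemma abs_eval_sub_eval_zero_le {Q : ℝ[X]} {M : ℝ}
    (hM : ∀ y, |y| ≤ 1 → |(derivative Q).eval y| ≤ M) {x : ℝ} (hx : |x| ≤ 1) :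
    |Q.eval x - Q.eval 0| ≤ M := by
  have h := (convex_Icc (-1 : ℝ) 1).norm_image_sub_le_of_norm_hasDerivWithin_le
    (f := fun x => Q.eval x) (f' := fun x => (derivative Q).eval x) (C := M) (x := 0) (y := x)
    (fun y _ => (Q.hasDerivAt y).hasDerivWithinAt) (fun y hy => hM y (abs_le.2 hy))
    (mem_Icc.2 (by norm_num)) (mem_Icc.2 (abs_le.1 hx))
  have h0 : 0 ≤ M := (abs_nonneg _).trans (hM 0 (by simp))
  refine h.trans ?_
  rw [sub_zero]
  exact mul_le_of_le_one_right h0 hx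

/-- Orthogonality to the bubble gives $\|VQ\|^2=\langle VQ,V(Q-Q(0))\rangle$, and $|Q-Q(0)|\le M$ on
$[-1,1]$. A bound on the derivative thus becomes an $L^2$ bound. -/
lemma norm_coshVec_le_of_orthogonal (hn : 2 * σ < n) {Q : ℝ[X]} {M : ℝ}
    (hM : ∀ y, |y| ≤ 1 → |(derivative Q).eval y| ≤ M)
    (horth : ⟪coshVec hn 1, coshVec (σ := σ) hn Q⟫ = 0) :
    ‖coshVec (σ := σ) hn Q‖ ≤ M * ‖coshVec (σ := σ) hn 1‖ := by
  have h0 : 0 ≤ M := (abs_nonneg _).trans (hM 0 (by simp))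
  have h1 : ‖coshVec (σ := σ) hn Q‖ ^ 2 =
      ⟪coshVec (σ := σ) hn Q, coshVec hn (Q - C (Q.eval 0))⟫ := by
    rw [← coshVec_sub_smul, inner_sub_right, inner_smul_right, real_inner_comm (coshVec hn 1), horth,
      real_inner_self_eq_norm_sq]
    simp
  have h2 : ‖coshVec (σ := σ) hn (Q - C (Q.eval 0))‖ ≤ M * ‖coshVec (σ := σ) hn 1‖ := by
    refine Lp.norm_le_mul_norm_of_ae_le_mul ?_
    filter_upwards [(memLp_coshPoly hn (Q - C (Q.eval 0))).coeFn_toLp,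
      (memLp_coshPoly hn 1).coeFn_toLp] with t e1 e2
    rw [coshVec, coshVec, e1, e2, coshPoly_one, coshPoly, norm_mul, mul_comm, eval_sub, eval_C]
    exact mul_le_mul_of_nonneg_right
      (abs_eval_sub_eval_zero_le hM (abs_tanh_lt_one t).le) (norm_nonneg _)
  rcases (norm_nonneg (coshVec (σ := σ) hn Q)).eq_or_lt with h | h
  · rw [← h]; positivity
  · refine le_of_mul_le_mul_left ?_ h
    rw [← sq, h1]
    exact (real_inner_le_norm _ _).trans (mul_le_mul_of_nonneg_left h2 h.le)

lemma gapOp_pow_decay (hσ : 1 < σ) (hn : 2 * σ < n) (P : ℝ[X]) :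
    ∃ B, ∀ k : ℕ, ‖(gapOp hσ hn ^ (k + 1)) (coshVec hn P)‖ ≤ B * gapBound n σ ^ k := by
  obtain ⟨M, hM⟩ := exists_gapOp_pow_coshVec hσ hn P
  refine ⟨M * ‖coshVec (σ := σ) hn 1‖, fun k => ?_⟩
  obtain ⟨Q, hQ, -, hbd⟩ := hM k
  have horth : ⟪coshVec hn 1, coshVec (σ := σ) hn Q⟫ = 0 := by
    rw [← hQ, pow_succ', mul_apply_eq_comp, ← inner_gapOp_comm, gapOp_coshVec_one,
      inner_zero_left]
  rw [hQ]
  refine (norm_coshVec_le_of_orthogonal hn hbd horth).trans (le_of_eq ?_)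
  ring

lemma strictMono_tanh : StrictMono Real.tanh := fun a b hab => by
  have h := fun t => abs_lt.1 (abs_tanh_lt_one t)
  rwa [← Real.artanh_lt_artanh_iff (h a) (h b), Real.artanh_tanh, Real.artanh_tanh]

/-- A compactly supported continuous function is uniformly approximated by polynomials in `tanh`. -/
lemma exists_polynomial_tanh_near {u : ℝ → ℝ} (hu : Continuous u) (hs : HasCompactSupport u)
    {ε : ℝ} (hε : 0 < ε) : ∃ P : ℝ[X], ∀ t, |P.eval (Real.tanh t) - u t| < ε := by
  obtain ⟨A, hA0, hA⟩ : ∃ A : ℝ, 0 < A ∧ ∀ t, A ≤ |t| → u t = 0 := by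
    obtain ⟨A, hA⟩ := hs.isCompact.isBounded.subset_closedBall (0 : ℝ)
    refine ⟨max A 0 + 1, by positivity, fun t ht => ?_⟩
    by_contra hne
    have := hA (subset_tsupport u (Function.mem_support.2 hne))
    rw [mem_closedBall_zero_iff, Real.norm_eq_abs] at this
    linarith [le_max_left A 0]
  have hB1 : |Real.tanh A| < 1 := abs_tanh_lt_one A
  rw [abs_lt] at hB1
  have hmono : StrictMono Real.tanh := strictMono_tanh
  have hB0 : 0 < Real.tanh A := by simpa using hmono hA0
  -- Clamping to $[-\tanh A,\tanh A]$ keeps the argument of `artanh` away from $\pm1$. The function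
  -- is unchanged by this, as $u$ vanishes for $|t|\ge A$.
  set cl : ℝ → ℝ := fun x => max (-Real.tanh A) (min (Real.tanh A) x) with hcl
  have hclmem : ∀ x, cl x ∈ Ioo (-1 : ℝ) 1 := fun x =>
    ⟨lt_of_lt_of_le (by linarith) (le_max_left _ _),
      max_lt (by linarith) ((min_le_left _ _).trans_lt hB1.2)⟩
  have hart : ContinuousOn Real.artanh (Ioo (-1) 1) := by
    have h : ContinuousOn (fun x : ℝ => Real.log (Real.sqrt ((1 + x) / (1 - x)))) (Ioo (-1) 1) := by
      refine ContinuousOn.log (Real.continuous_sqrt.comp_continuousOn ?_) ?_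
      · exact ContinuousOn.div (by fun_prop) (by fun_prop) fun x hx => by linarith [hx.2]
      · intro x hx
        exact (Real.sqrt_pos.2 (div_pos (by linarith [hx.1]) (by linarith [hx.2]))).ne'
    exact h
  have hcont : Continuous fun x => u (Real.artanh (cl x)) :=
    hu.comp (hart.comp_continuous (by fun_prop) hclmem)
  obtain ⟨P, hP⟩ := exists_polynomial_near_of_continuousOn (-1) 1 _ hcont.continuousOn ε hε
  refine ⟨P, fun t => ?_⟩
  have h1 := hP (Real.tanh t) (abs_le.1 (abs_tanh_lt_one t).le)
  have h2 : u (Real.artanh (cl (Real.tanh t))) = u t := by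
    rcases le_or_gt t (-A) with h | h
    · have : cl (Real.tanh t) = Real.tanh (-A) := by
        have := hmono.monotone h
        rw [Real.tanh_neg] at this ⊢
        simp only [hcl]
        rw [min_eq_right (by linarith), max_eq_left this]
      rw [this, Real.artanh_tanh, hA _ (by rw [abs_neg]; exact le_abs_self A),
        hA t (by rw [abs_of_neg (by linarith)]; linarith)]
    rcases le_or_gt A t with h' | h'
    · have : cl (Real.tanh t) = Real.tanh A := by
        have := hmono.monotone h'
        simp only [hcl]
        rw [min_eq_left this, max_eq_right (by linarith)]
      rw [this, Real.artanh_tanh, hA _ (le_abs_self A), hA t (h'.trans (le_abs_self t))]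
    · have : cl (Real.tanh t) = Real.tanh t := by
        have e1 := hmono h
        have e2 := hmono h'
        rw [Real.tanh_neg] at e1
        simp only [hcl]
        rw [min_eq_right e2.le, max_eq_right e1.le]
      rw [this, Real.artanh_tanh]
  rwa [h2] at h1

/-- For compactly supported $g$, approximate $g\cosh^{\gamma_\sigma}$ uniformly by polynomials in
$\tanh$ and multiply by the bubble, which lies in $L^2$. -/
lemma dense_range_coshVec (hn : 2 * σ < n) :
    Dense (range fun P : ℝ[X] => coshVec (σ := σ) hn P) := by
  have hV := memLp_coshPoly (n := n) (σ := σ) hn 1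
  rw [Metric.dense_iff]
  intro φ r hr
  obtain ⟨g, hg1, hg2, hg3, hg4⟩ := (Lp.memLp φ).exists_hasCompactSupport_eLpNorm_sub_le
    (by norm_num) (ε := ENNReal.ofReal (r / 4)) (by simpa using hr)
  set N := ‖coshVec (σ := σ) hn 1‖ with hN
  have hN0 : 0 ≤ N := norm_nonneg _
  obtain ⟨P, hP⟩ := exists_polynomial_tanh_near
    (u := fun t => g t * Real.cosh t ^ (fowlerExp n σ))
    (hg3.mul (Real.continuous_cosh.rpow_const fun t => Or.inl (Real.cosh_pos t).ne'))
    hg1.mul_right (ε := r / (4 * (N + 1))) (by positivity)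
  refine ⟨coshVec hn P, ?_, mem_range_self P⟩
  have h1 : ‖φ - hg4.toLp‖ ≤ r / 4 := by
    rw [Lp.norm_def]
    refine ENNReal.toReal_le_of_le_ofReal (by positivity) ?_
    rw [eLpNorm_congr_ae ((Lp.coeFn_sub φ hg4.toLp).trans
      ((EventuallyEq.refl _ _).sub hg4.coeFn_toLp))]
    exact hg2
  have h2 : ‖coshVec hn P - hg4.toLp‖ ≤ r / (4 * (N + 1)) * N := by
    refine Lp.norm_le_mul_norm_of_ae_le_mul ?_
    filter_upwards [Lp.coeFn_sub (coshVec hn P) hg4.toLp, (memLp_coshPoly hn P).coeFn_toLp,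
      hg4.coeFn_toLp, hV.coeFn_toLp] with t e1 e2 e3 e4
    rw [e1, Pi.sub_apply, coshVec, coshVec, e2, e3, e4, coshPoly_one, coshPoly]
    have e5 : g t = Real.cosh t ^ (-fowlerExp n σ) *
        (g t * Real.cosh t ^ (fowlerExp n σ)) := by
      rw [mul_left_comm, ← Real.rpow_add (Real.cosh_pos t), neg_add_cancel, Real.rpow_zero,
        mul_one]
    rw [e5, ← mul_sub, norm_mul, mul_comm]
    exact mul_le_mul_of_nonneg_right (hP t).le (norm_nonneg _)
  have h3 : r / (4 * (N + 1)) * N ≤ r / 4 := by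
    rw [div_mul_eq_mul_div, div_le_div_iff₀ (by positivity) (by positivity)]
    nlinarith
  rw [mem_ball_iff_norm]
  calc ‖coshVec hn P - φ‖ = ‖(coshVec hn P - hg4.toLp) - (φ - hg4.toLp)‖ := by congr 1; abel
    _ ≤ _ := norm_sub_le _ _
    _ < r := by linarith

lemma norm_gapOp_lt_one (hσ : 1 < σ) (hn : 2 * σ < n) : ‖gapOp hσ hn‖ < 1 := by
  have h0 : 0 < gapBound n σ := lt_of_lt_of_le (by norm_num) (le_max_right _ _)
  have h1 : gapBound n σ < 1 := max_lt (gapRate_lt_one hσ hn) (by norm_num)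
  refine (norm_le_of_pow_decay h0 (gapOp hσ hn) (inner_gapOp_comm hσ hn)
    (dense_range_coshVec hn) ?_).trans_lt h1
  rintro _ ⟨P, rfl⟩
  exact gapOp_pow_decay hσ hn P

/-- Nondegeneracy of the bubble among even functions. -/
lemma isUnit_one_sub_linOp (hσ : 1 < σ) (hn : 2 * σ < n) : IsUnit (1 - linOp hσ hn) := by
  have h := isUnit_one_sub_of_rank_one_perturbation (norm_gapOp_lt_one hσ hn)
    (bubbleProj_mul_self hn) (gapOp_mul_bubbleProj hσ hn) (one_lt_critExp hσ hn).ne'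
  rwa [gapOp, sub_add_cancel] at h

end SpectralGap

end Delaunay


/-! ### Stability of invertibility and a quantitative inverse function theorem -/

namespace Delaunay

open Set
open scoped BoundedContinuousFunction

section Abstract

/-- Units form an open set. Within $1/(2K)$ of $a$, half of the lower bound for $a$ absorbs the
perturbation, so a single constant serves the whole ball. -/
lemma exists_isUnit_ball {H : Type*} [NormedAddCommGroup H] [NormedSpace ℝ H] [CompleteSpace H]
    {a : H →L[ℝ] H} (ha : IsUnit a) :
    ∃ δ > 0, ∃ C > 0, ∀ b : H →L[ℝ] H, ‖b - a‖ < δ → IsUnit b ∧ ∀ φ, ‖φ‖ ≤ C * ‖b φ‖ := by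
  obtain ⟨r, hr, hball⟩ := Metric.isOpen_iff.1 (Units.isOpen (R := H →L[ℝ] H)) a ha
  obtain ⟨u, rfl⟩ := ha
  set K := ‖(↑u⁻¹ : H →L[ℝ] H)‖ + 1 with hK
  have hK0 : 0 < K := by positivity
  have hinv : ∀ φ, ‖φ‖ ≤ K * ‖(u : H →L[ℝ] H) φ‖ := by
    intro φ
    have : φ = (↑u⁻¹ : H →L[ℝ] H) ((u : H →L[ℝ] H) φ) := by
      rw [← mul_apply_eq_comp, Units.inv_mul, one_apply_eq_self]
    calc ‖φ‖ = ‖(↑u⁻¹ : H →L[ℝ] H) ((u : H →L[ℝ] H) φ)‖ := by rw [← this]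
      _ ≤ ‖(↑u⁻¹ : H →L[ℝ] H)‖ * ‖(u : H →L[ℝ] H) φ‖ := ContinuousLinearMap.le_opNorm _ _
      _ ≤ _ := by gcongr; linarith
  refine ⟨min r (1 / (2 * K)), by positivity, 2 * K, by positivity, fun b hb => ⟨?_, fun φ => ?_⟩⟩
  · exact hball (by rw [mem_ball_iff_norm]; exact hb.trans_le (min_le_left _ _))
  · have h1 := hinv φ
    have h2 : ‖(u : H →L[ℝ] H) φ‖ ≤ ‖b φ‖ + ‖(b - u) φ‖ := by
      have : (u : H →L[ℝ] H) φ = b φ - (b - u) φ := by simp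
      rw [this]
      exact norm_sub_le _ _
    have h3 : ‖(b - u) φ‖ ≤ 1 / (2 * K) * ‖φ‖ :=
      (ContinuousLinearMap.le_opNorm _ _).trans
        (mul_le_mul_of_nonneg_right (hb.le.trans (min_le_right _ _)) (norm_nonneg _))
    have h4 : K * (1 / (2 * K) * ‖φ‖) = ‖φ‖ / 2 := by field_simp
    have h5 : K * ‖(u : H →L[ℝ] H) φ‖ ≤ K * ‖b φ‖ + ‖φ‖ / 2 := by
      rw [← h4, ← mul_add]
      exact mul_le_mul_of_nonneg_left (h2.trans (by gcongr)) hK0.le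
    linarith

variable {X : Type*} [NormedAddCommGroup X]

lemma fixedPoint_unique {J F : X → X} {K r : ℝ} (hK : 0 < K)
    (hbelow : ∀ a, ‖a‖ ≤ K * ‖a - J a‖)
    (hF : ∀ a b, ‖a‖ ≤ r → ‖b‖ ≤ r → ‖F a - F b - J (a - b)‖ ≤ 1 / (2 * K) * ‖a - b‖)
    {a b : X} (ha : ‖a‖ ≤ r) (hb : ‖b‖ ≤ r) (hFa : F a = a) (hFb : F b = b) : a = b := by
  have h1 := hbelow (a - b)
  have h2 := hF a b ha hb
  rw [hFa, hFb] at h2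
  have h3 : K * ‖a - b - J (a - b)‖ ≤ K * (1 / (2 * K) * ‖a - b‖) :=
    mul_le_mul_of_nonneg_left h2 hK.le
  have h4 : K * (1 / (2 * K) * ‖a - b‖) = ‖a - b‖ / 2 := by field_simp
  have h5 : ‖a - b‖ = 0 := le_antisymm (by linarith) (norm_nonneg _)
  exact sub_eq_zero.1 (norm_eq_zero.1 h5)

/-- A quantitative inverse function theorem: if `1 - J` is boundedly invertible and `F` is close to
`J` in the Lipschitz sense near the origin, then `F` has a fixed point near the origin. -/
lemma exists_fixedPoint [CompleteSpace X] {J F : X → X} {K r : ℝ} (hK : 0 < K)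
    (hJ : ∀ a b, J (a - b) = J a - J b) (hsurj : ∀ h, ∃ a, a - J a = h)
    (hbelow : ∀ a, ‖a‖ ≤ K * ‖a - J a‖)
    (hF : ∀ a b, ‖a‖ ≤ r → ‖b‖ ≤ r → ‖F a - F b - J (a - b)‖ ≤ 1 / (2 * K) * ‖a - b‖)
    (h0 : ‖F 0‖ ≤ r / (2 * K)) : ∃ a, ‖a‖ ≤ 2 * K * ‖F 0‖ ∧ F a = a := by
  choose A hA using hsurj
  have hr : 0 ≤ r := by
    have := (norm_nonneg _).trans h0
    rw [div_nonneg_iff] at this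
    rcases this with h | h
    · exact h.1
    · linarith [h.2]
  have hJ0 : J 0 = 0 := by simpa using hJ 0 0
  have hAlip : ∀ a b, ‖A a - A b‖ ≤ K * ‖a - b‖ := by
    intro a b
    refine (hbelow _).trans (le_of_eq ?_)
    congr 2
    rw [hJ, sub_sub_sub_comm, hA, hA]
  -- Fixed points of $F$ are those of $\Phi=(1-J)^{-1}(F-J)$, a contraction of factor $\frac12$ on
  -- the ball of radius $r$.
  set Φ : X → X := fun a => A (F a - J a) with hΦ
  have hΦlip : ∀ a b, ‖a‖ ≤ r → ‖b‖ ≤ r → ‖Φ a - Φ b‖ ≤ 1 / 2 * ‖a - b‖ := by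
    intro a b ha hb
    calc ‖Φ a - Φ b‖ ≤ K * ‖(F a - J a) - (F b - J b)‖ := hAlip _ _
      _ = K * ‖F a - F b - J (a - b)‖ := by rw [hJ, sub_sub_sub_comm]
      _ ≤ K * (1 / (2 * K) * ‖a - b‖) := mul_le_mul_of_nonneg_left (hF a b ha hb) hK.le
      _ = _ := by field_simp
  have hΦ0 : ‖Φ 0‖ ≤ K * ‖F 0‖ := by
    have h := hbelow (Φ 0)
    rwa [hΦ, hA, hJ0, sub_zero] at h
  have hΦ0r : K * ‖F 0‖ ≤ r / 2 := by
    refine (mul_le_mul_of_nonneg_left h0 hK.le).trans (le_of_eq ?_)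
    field_simp
  have hmaps : MapsTo Φ (Metric.closedBall 0 r) (Metric.closedBall 0 r) := by
    intro a ha
    rw [mem_closedBall_zero_iff] at ha ⊢
    have h1 := hΦlip a 0 ha (by simpa using hr)
    rw [sub_zero] at h1
    calc ‖Φ a‖ = ‖(Φ a - Φ 0) + Φ 0‖ := by rw [sub_add_cancel]
      _ ≤ ‖Φ a - Φ 0‖ + ‖Φ 0‖ := norm_add_le _ _
      _ ≤ r := by linarith
  have hcontr : ContractingWith (1 / 2 : NNReal) (hmaps.restrict Φ _ _) := by
    refine ⟨by rw [← NNReal.coe_lt_coe]; norm_num, LipschitzWith.of_dist_le_mul ?_⟩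
    rintro ⟨a, ha⟩ ⟨b, hb⟩
    rw [mem_closedBall_zero_iff] at ha hb
    simpa [Subtype.dist_eq, dist_eq_norm] using hΦlip a b ha hb
  obtain ⟨a, ha, hfix, -⟩ := hcontr.exists_fixedPoint' Metric.isClosed_closedBall.isComplete hmaps
    (x := 0) (by simpa using hr) (edist_ne_top _ _)
  rw [mem_closedBall_zero_iff] at ha
  refine ⟨a, ?_, ?_⟩
  · have h1 := hΦlip a 0 ha (by simpa using hr)
    rw [sub_zero, hfix.eq] at h1
    have h2 : ‖a‖ ≤ ‖a - Φ 0‖ + ‖Φ 0‖ := by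
      calc ‖a‖ = ‖(a - Φ 0) + Φ 0‖ := by rw [sub_add_cancel]
        _ ≤ _ := norm_add_le _ _
    linarith
  · have h1 := hA (F a - J a)
    have h2 : A (F a - J a) = a := hfix.eq
    rw [h2] at h1
    exact (sub_left_injective h1).symm

end Abstract

/-! ### From $L^2$ to bounded continuous functions -/

section Resolvent

variable {μ : Measure ℝ} {κ : ℝ → ℝ → ℝ}

lemma continuous_kerFun (hκ : IsBddKernel κ) (hc : ∀ τ, Continuous fun t => κ t τ) {φ : ℝ → ℝ}
    (hφ : Integrable φ μ) : Continuous (kerFun μ κ φ) := by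
  obtain ⟨M, hM⟩ := hκ.2
  refine continuous_of_dominated (bound := fun τ => M * |φ τ|)
    (fun t => (hκ.integrable_mul hφ t).aestronglyMeasurable)
    (fun t => .of_forall fun τ => ?_) (hφ.abs.const_mul M)
    (.of_forall fun τ => (hc τ).mul continuous_const)
  rw [norm_mul]
  exact mul_le_mul_of_nonneg_right (hM t τ) (abs_nonneg _)

variable [IsFiniteMeasure μ]

lemma memLp_bcf (φ : ℝ →ᵇ ℝ) : MemLp φ 2 μ :=
  memLp_of_abs_le φ.continuous.aestronglyMeasurable fun t => φ.norm_coe_le_norm t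

lemma norm_toLp_bcf_le (φ : ℝ →ᵇ ℝ) :
    ‖(memLp_bcf (μ := μ) φ).toLp‖ ≤ Real.sqrt (μ.real univ) * ‖φ‖ := by
  refine abs_le_of_sq_le_sq' ?_ (by positivity) |>.2
  rw [mul_pow, Real.sq_sqrt measureReal_nonneg, ← integral_sq_eq_norm_sq,
    integral_congr_ae ((memLp_bcf (μ := μ) φ).coeFn_toLp.mono fun t ht => by
      show _ = φ t ^ 2
      rw [ht])]
  calc ∫ t, φ t ^ 2 ∂μ ≤ ∫ _, ‖φ‖ ^ 2 ∂μ := by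
        refine integral_mono_of_nonneg (.of_forall fun _ => sq_nonneg _) (integrable_const _)
          (.of_forall fun t => ?_)
        show φ t ^ 2 ≤ ‖φ‖ ^ 2
        rw [← sq_abs]
        exact pow_le_pow_left₀ (abs_nonneg _) (φ.norm_coe_le_norm t) 2
    _ = _ := by rw [integral_const, smul_eq_mul]

/-- The operator with kernel `κ` on bounded continuous functions. -/
noncomputable def kerBCF (μ : Measure ℝ) [IsFiniteMeasure μ] (hκ : IsBddKernel κ)
    (hc : ∀ τ, Continuous fun t => κ t τ) (φ : ℝ →ᵇ ℝ) : ℝ →ᵇ ℝ :=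
  BoundedContinuousFunction.ofNormedAddCommGroup (kerFun μ κ φ)
    (continuous_kerFun hκ hc ((memLp_bcf φ).integrable one_le_two))
    (Real.sqrt (μ.real univ) * hκ.2.choose * ‖(memLp_bcf (μ := μ) φ).toLp‖) fun t => by
      rw [← kerFun_congr (memLp_bcf (μ := μ) φ).coeFn_toLp]
      exact abs_kerFun_le hκ hκ.2.choose_spec _ t

variable (hκ : IsBddKernel κ) (hc : ∀ τ, Continuous fun t => κ t τ)

lemma kerBCF_apply (φ : ℝ →ᵇ ℝ) (t : ℝ) : kerBCF μ hκ hc φ t = kerFun μ κ φ t := rfl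

lemma kerBCF_sub (φ ψ : ℝ →ᵇ ℝ) :
    kerBCF μ hκ hc (φ - ψ) = kerBCF μ hκ hc φ - kerBCF μ hκ hc ψ := by
  ext t
  exact kerFun_sub hκ ((memLp_bcf φ).integrable one_le_two) ((memLp_bcf ψ).integrable one_le_two) t

lemma kerOp_toLp_bcf (φ : ℝ →ᵇ ℝ) :
    kerOp μ hκ (memLp_bcf φ).toLp = (memLp_bcf (kerBCF μ hκ hc φ)).toLp :=
  kerOp_toLp _ _ _ fun _ => rfl

/-- Solve first in $L^2$. The right-hand side of $z=h+\kappa z$ is then a continuous bounded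
representative of the solution, and satisfies the equation at every point. -/
lemma exists_sub_kerBCF (hu : IsUnit (1 - kerOp μ hκ)) (h : ℝ →ᵇ ℝ) :
    ∃ ψ, ψ - kerBCF μ hκ hc ψ = h := by
  obtain ⟨M, hM⟩ := hκ.2
  obtain ⟨u, hu⟩ := hu
  set z := (↑u⁻¹ : Lp ℝ 2 μ →L[ℝ] Lp ℝ 2 μ) (memLp_bcf h).toLp with hz
  have hz1 : z - kerOp μ hκ z = (memLp_bcf h).toLp := by
    have : (u : Lp ℝ 2 μ →L[ℝ] Lp ℝ 2 μ) z = (memLp_bcf h).toLp := by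
      rw [hz, ← mul_apply_eq_comp, Units.mul_inv, one_apply_eq_self]
    rw [← this, hu]
    simp
  let ψ : ℝ →ᵇ ℝ := h + BoundedContinuousFunction.ofNormedAddCommGroup (kerFun μ κ z)
    (continuous_kerFun hκ hc (integrable_coeFn z)) _ (abs_kerFun_le hκ hM z)
  have hψz : (ψ : ℝ → ℝ) =ᵐ[μ] z := by
    have e : z = (memLp_bcf h).toLp + kerOp μ hκ z := by rw [← hz1]; abel
    have e' : (z : ℝ → ℝ) =ᵐ[μ] ((memLp_bcf h).toLp + kerOp μ hκ z : Lp ℝ 2 μ) := by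
      conv_lhs => rw [e]
    filter_upwards [e', Lp.coeFn_add (memLp_bcf h).toLp (kerOp μ hκ z), coeFn_kerOp hκ z,
      (memLp_bcf (μ := μ) h).coeFn_toLp] with t e1 e2 e3 e4
    rw [e1, e2, Pi.add_apply, e3, e4]
    rfl
  refine ⟨ψ, ?_⟩
  ext t
  rw [BoundedContinuousFunction.sub_apply, kerBCF_apply, kerFun_congr hψz]
  exact add_sub_cancel_right _ _

/-- Writing $\psi=h+\kappa\psi$, the last term is bounded pointwise by the $L^2$ norm of $\psi$
through Cauchy–Schwarz, and that norm by the $L^2$ norm of $h$. -/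
lemma norm_le_mul_norm_sub_kerBCF {M C : ℝ} (hM : ∀ t τ, |κ t τ| ≤ M) (hC : 0 ≤ C)
    (hb : ∀ φ, ‖φ‖ ≤ C * ‖(1 - kerOp μ hκ) φ‖) (ψ : ℝ →ᵇ ℝ) :
    ‖ψ‖ ≤ (1 + μ.real univ * M * C) * ‖ψ - kerBCF μ hκ hc ψ‖ := by
  have hM0 : 0 ≤ M := (abs_nonneg _).trans (hM 0 0)
  set h := ψ - kerBCF μ hκ hc ψ with hh
  have h1 : ‖(memLp_bcf (μ := μ) ψ).toLp‖ ≤ C * (Real.sqrt (μ.real univ) * ‖h‖) := by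
    refine (hb _).trans (mul_le_mul_of_nonneg_left ?_ hC)
    have : (1 - kerOp μ hκ) (memLp_bcf ψ).toLp = (memLp_bcf (μ := μ) h).toLp := by
      rw [sub_apply, one_apply_eq_self, kerOp_toLp_bcf hκ hc, ← MemLp.toLp_sub]
      rfl
    rw [this]
    exact norm_toLp_bcf_le h
  refine (BoundedContinuousFunction.norm_le (by positivity)).2 fun t => ?_
  have h2 : ψ t = h t + kerFun μ κ ψ t := by
    rw [hh, BoundedContinuousFunction.sub_apply, kerBCF_apply]
    ring
  have h3 := abs_kerFun_le hκ hM (memLp_bcf (μ := μ) ψ).toLp t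
  rw [kerFun_congr (memLp_bcf (μ := μ) ψ).coeFn_toLp] at h3
  have h4 : Real.sqrt (μ.real univ) * M * ‖(memLp_bcf (μ := μ) ψ).toLp‖ ≤
      Real.sqrt (μ.real univ) * M * (C * (Real.sqrt (μ.real univ) * ‖h‖)) :=
    mul_le_mul_of_nonneg_left h1 (by positivity)
  have h5 : Real.sqrt (μ.real univ) * M * (C * (Real.sqrt (μ.real univ) * ‖h‖)) =
      μ.real univ * M * C * ‖h‖ := by
    have := Real.mul_self_sqrt (measureReal_nonneg (μ := μ) (s := univ))
    linear_combination (M * C * ‖h‖) * this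
  rw [h2]
  calc ‖h t + kerFun μ κ ψ t‖ ≤ ‖h t‖ + |kerFun μ κ ψ t| := norm_add_le _ _
    _ ≤ ‖h‖ + μ.real univ * M * C * ‖h‖ :=
        add_le_add (h.norm_coe_le_norm t) (h3.trans (h4.trans h5.le))
    _ = _ := by ring

end Resolvent

end Delaunay


/-! ### The nonlinearity -/

namespace Delaunay

open Set
open scoped BoundedContinuousFunction

section Nonlinearity

variable {n : ℕ} {σ : ℝ}

lemma nonlin_eq (x : ℝ) : nonlin n σ x = nonlinConst n σ * |x| ^ critExp n σ := rfl

/-- The derivative of the nonlinearity. -/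
noncomputable def nonlinDeriv (n : ℕ) (σ x : ℝ) : ℝ :=
  nonlinConst n σ * (critExp n σ * |x| ^ (critExp n σ - 2) * x)

lemma hasDerivAt_nonlin (hσ : 1 < σ) (hn : 2 * σ < n) (x : ℝ) :
    HasDerivAt (nonlin n σ) (nonlinDeriv n σ x) x :=
  (hasDerivAt_abs_rpow x (one_lt_critExp hσ hn)).const_mul _

lemma continuous_nonlin (hσ : 1 < σ) (hn : 2 * σ < n) : Continuous (nonlin n σ) :=
  continuous_iff_continuousAt.2 fun x => (hasDerivAt_nonlin hσ hn x).continuousAt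

lemma continuous_nonlinDeriv (hσ : 1 < σ) (hn : 2 * σ < n) : Continuous (nonlinDeriv n σ) := by
  have h1 : ContDiff ℝ 1 fun x : ℝ => ‖x‖ ^ critExp n σ := contDiff_norm_rpow (one_lt_critExp hσ hn)
  have h2 := (h1.continuous_deriv le_rfl).const_mul (nonlinConst n σ)
  refine h2.congr fun x => ?_
  rw [nonlinDeriv, ← (hasDerivAt_abs_rpow x (one_lt_critExp hσ hn)).deriv]
  rfl

lemma nonlinDeriv_of_pos {x : ℝ} (hx : 0 < x) :
    nonlinDeriv n σ x = nonlinConst n σ * critExp n σ * x ^ (critExp n σ - 1) := by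
  have : x ^ (critExp n σ - 1) = x ^ (critExp n σ - 2) * x := by
    rw [← Real.rpow_add_one hx.ne']
    congr 1
    ring
  rw [nonlinDeriv, abs_of_pos hx, this]
  ring

lemma nonlinDeriv_bubble (hn : 2 * σ < n) (t : ℝ) :
    nonlinDeriv n σ (Real.cosh t ^ (-fowlerExp n σ)) = linWeight n σ t := by
  rw [nonlinDeriv_of_pos (cosh_rpow_neg_pos _ _), linWeight, ← Real.rpow_mul (Real.cosh_pos t).le]
  congr 2
  have h := critExp_mul hn
  unfold fowlerExpDual at h
  unfold fowlerExp at h ⊢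
  linarith

/-- Uniform first order expansion of the nonlinearity. -/
lemma exists_nonlin_expansion (hσ : 1 < σ) (hn : 2 * σ < n) (B : ℝ) {η : ℝ} (hη : 0 < η) :
    ∃ r > 0, ∀ x y z : ℝ, |x| ≤ B → |y| ≤ r → |z| ≤ r →
      |nonlin n σ (x + y) - nonlin n σ (x + z) - nonlinDeriv n σ x * (y - z)| ≤ η * |y - z| := by
  -- The critical exponent may be less than $2$, so $f_\sigma$ is only used as a $C^1$ function.
  -- Uniform continuity of $f_\sigma'$ replaces a quadratic remainder.
  have huc := (isCompact_Icc (a := -(B + 1)) (b := B + 1)).uniformContinuousOn_of_continuous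
    (continuous_nonlinDeriv (n := n) hσ hn).continuousOn
  obtain ⟨d, hd, hdist⟩ := Metric.uniformContinuousOn_iff.1 huc η hη
  refine ⟨min (d / 2) 1, by positivity, fun x y z hx hy hz => ?_⟩
  have hr1 : min (d / 2) 1 ≤ 1 := min_le_right _ _
  have hr2 : min (d / 2) 1 ≤ d / 2 := min_le_left _ _
  have hx' := abs_le.1 hx
  have h := (convex_Icc (-(min (d / 2) 1)) (min (d / 2) 1)).norm_image_sub_le_of_norm_hasDerivWithin_le
    (f := fun u => nonlin n σ (x + u) - nonlinDeriv n σ x * u)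
    (f' := fun u => nonlinDeriv n σ (x + u) - nonlinDeriv n σ x) (C := η) (x := z) (y := y)
    (fun u _ => ((((hasDerivAt_nonlin hσ hn (x + u)).comp_const_add x u)).sub
      ((hasDerivAt_id u).const_mul (nonlinDeriv n σ x)
        |>.congr_deriv (mul_one _))).hasDerivWithinAt)
    (fun u hu => ?_) (mem_Icc.2 (abs_le.1 hz)) (mem_Icc.2 (abs_le.1 hy))
  · rw [Real.norm_eq_abs, Real.norm_eq_abs] at h
    refine le_trans (le_of_eq ?_) h
    congr 1
    ring
  · have hu' := mem_Icc.1 hu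
    refine (hdist _ ?_ _ ?_ ?_).le
    · exact mem_Icc.2 ⟨by linarith, by linarith⟩
    · exact mem_Icc.2 ⟨by linarith, by linarith⟩
    · rw [Real.dist_eq, add_sub_cancel_left, abs_lt]
      constructor <;> linarith

end Nonlinearity

/-! ### The periodic problem near the tower -/

section PeriodicOperator

variable {n : ℕ} {σ L : ℝ}

/-- The nonlinear integral operator of the periodic problem, symmetrized. -/
noncomputable def solOp (n : ℕ) (σ L : ℝ) (v : ℝ → ℝ) (t : ℝ) : ℝ :=
  ∫ τ in (-L)..L, symKernel (rieszKernelPer n σ L) t τ * nonlin n σ (v τ)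

lemma continuous_symKernel {k : ℝ → ℝ} (hk : Continuous k) :
    Continuous (Function.uncurry (symKernel k)) := by
  unfold symKernel Function.uncurry
  fun_prop

lemma continuous_symKernel_per (hσ : 1 < σ) (hn : 2 * σ < n) (hL : 0 < L) :
    Continuous (Function.uncurry (symKernel (rieszKernelPer n σ L))) :=
  continuous_symKernel (continuous_rieszKernelPer hσ hn hL)

lemma continuous_symKernel_per_right (hσ : 1 < σ) (hn : 2 * σ < n) (hL : 0 < L) (t : ℝ) :
    Continuous fun τ => symKernel (rieszKernelPer n σ L) t τ := by
  have hc := continuous_rieszKernelPer hσ hn hL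
  unfold symKernel
  fun_prop

lemma symKernel_per_pos (hσ : 1 < σ) (hn : 2 * σ < n) (hL : 0 < L) (t τ : ℝ) :
    0 < symKernel (rieszKernelPer n σ L) t τ := by
  have h1 := rieszKernelPer_pos hσ hn hL (t - τ)
  have h2 := rieszKernelPer_pos hσ hn hL (t + τ)
  unfold symKernel
  linarith

lemma integral_rieszKernelPer (hσ : 1 < σ) (hn : 2 * σ < n) (hL : 0 < L) (t : ℝ) :
    ∫ τ in (-L)..L, rieszKernelPer n σ L (t - τ) = ∫ τ, rieszKernel n σ τ := by
  have h := lineConv_eq_intervalIntegral hσ hn hL (F := fun _ => 1) (M := 1) continuous_const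
    (by simp) (fun _ => rfl) t
  simp only [one_mul] at h
  rw [← h, lineConv_eq]
  simp

lemma integral_symKernel_per (hσ : 1 < σ) (hn : 2 * σ < n) (hL : 0 < L) (t : ℝ) :
    ∫ τ in (-L)..L, symKernel (rieszKernelPer n σ L) t τ = ∫ τ, rieszKernel n σ τ := by
  have hc := continuous_rieszKernelPer hσ hn hL
  have h1 := integral_rieszKernelPer hσ hn hL t
  have h2 := integral_rieszKernelPer hσ hn hL (-t)
  have h3 : ∀ τ, rieszKernelPer n σ L (-t - τ) = rieszKernelPer n σ L (t + τ) := fun τ => by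
    rw [← rieszKernelPer_neg]
    congr 1
    ring
  simp only [h3] at h2
  simp only [symKernel]
  rw [intervalIntegral.integral_div, intervalIntegral.integral_add
    (Continuous.intervalIntegrable (by fun_prop) _ _)
    (Continuous.intervalIntegrable (by fun_prop) _ _), h1, h2]
  ring

lemma integral_mul_sub_sub {k f g h : ℝ → ℝ} (hk : Continuous k) (hf : Continuous f)
    (hg : Continuous g) (hh : Continuous h) (a b : ℝ) :
    (∫ τ in a..b, k τ * f τ) - (∫ τ in a..b, k τ * g τ) - ∫ τ in a..b, k τ * h τ =
      ∫ τ in a..b, k τ * (f τ - g τ - h τ) := by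
  have h1 : IntervalIntegrable (fun τ => k τ * f τ) volume a b := (hk.mul hf).intervalIntegrable _ _
  have h2 : IntervalIntegrable (fun τ => k τ * g τ) volume a b := (hk.mul hg).intervalIntegrable _ _
  have h3 : IntervalIntegrable (fun τ => k τ * h τ) volume a b := (hk.mul hh).intervalIntegrable _ _
  rw [← intervalIntegral.integral_sub h1 h2, ← intervalIntegral.integral_sub (h1.sub h2) h3]
  simp only [mul_sub]

lemma integral_rieszKernel_nonneg (hσ : 1 < σ) (hn : 2 * σ < n) :
    0 ≤ ∫ τ, rieszKernel n σ τ :=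
  integral_nonneg fun τ => rieszKernel_nonneg hσ hn τ

lemma abs_integral_symKernel_le (hσ : 1 < σ) (hn : 2 * σ < n) (hL : 0 < L) {g : ℝ → ℝ}
    {M : ℝ} (hM : ∀ t, |g t| ≤ M) (t : ℝ) :
    |∫ τ in (-L)..L, symKernel (rieszKernelPer n σ L) t τ * g τ| ≤
      (∫ τ, rieszKernel n σ τ) * M := by
  have hc : Continuous fun τ => symKernel (rieszKernelPer n σ L) t τ :=
    continuous_symKernel_per_right hσ hn hL t
  rw [← integral_symKernel_per hσ hn hL t, ← intervalIntegral.integral_mul_const,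
    ← Real.norm_eq_abs]
  refine intervalIntegral.norm_integral_le_of_norm_le (by linarith)
    (.of_forall fun τ _ => ?_) ((hc.mul continuous_const).intervalIntegrable _ _)
  rw [norm_mul, Real.norm_eq_abs, Real.norm_eq_abs, abs_of_pos (symKernel_per_pos hσ hn hL t τ)]
  exact mul_le_mul_of_nonneg_left (hM τ) (symKernel_per_pos hσ hn hL t τ).le

lemma continuous_solOp (hσ : 1 < σ) (hn : 2 * σ < n) (hL : 0 < L) {v : ℝ → ℝ} (hv : Continuous v) :
    Continuous (solOp n σ L v) := by
  have hc := continuous_symKernel_per hσ hn hL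
  have hf := continuous_nonlin hσ hn
  refine intervalIntegral.continuous_parametric_intervalIntegral_of_continuous' ?_ _ _
  exact hc.mul (hf.comp (hv.comp continuous_snd))

/-- The kernel, with respect to `linMeasure`, of the linearization of `solOp` at the bubble
tower. -/
noncomputable def pertKernel (n : ℕ) (σ L t τ : ℝ) : ℝ :=
  (Ioc (-L) L).indicator (fun τ => symKernel (rieszKernelPer n σ L) t τ *
    (nonlinDeriv n σ (tower (fowlerExp n σ) 1 L τ) / linWeight n σ τ)) τ

lemma exists_tower_le_cosh {a : ℝ} (ha : 0 < a) :
    ∃ C, 0 < C ∧ ∀ L, 1 ≤ L → ∀ t, |t| ≤ L → tower a 1 L t ≤ C * Real.cosh t ^ (-a) := by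
  obtain ⟨C, hC, h⟩ := exists_tower_sub_le ha
  refine ⟨C + 1, by positivity, fun L hL t ht => ?_⟩
  have h1 := h L hL t
  have h2 : Real.exp (-(a * (2 * L - |t|))) ≤ Real.cosh t ^ (-a) := by
    refine le_trans (Real.exp_le_exp.2 ?_) (exp_le_cosh_rpow_neg ha t)
    have := mul_le_mul_of_nonneg_left (show |t| ≤ 2 * L - |t| by linarith) ha.le
    linarith
  have h3 := mul_le_mul_of_nonneg_left h2 hC.le
  linarith

lemma continuous_tower {a : ℝ} (ha : 0 < a) (hL : 0 < L) : Continuous (tower a 1 L) :=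
  (contDiff_tower ha hL 0 1).continuous

lemma exists_linRatio_le (hσ : 1 < σ) (hn : 2 * σ < n) :
    ∃ M, 0 < M ∧ ∀ L, 1 ≤ L → ∀ τ, |τ| ≤ L →
      0 ≤ nonlinDeriv n σ (tower (fowlerExp n σ) 1 L τ) / linWeight n σ τ ∧
      nonlinDeriv n σ (tower (fowlerExp n σ) 1 L τ) / linWeight n σ τ ≤ M := by
  have hg := fowlerExp_pos hn
  have hp := one_lt_critExp hσ hn
  have hc := nonlinConst_pos hσ hn
  obtain ⟨C, hC, h⟩ := exists_tower_le_cosh hg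
  refine ⟨C ^ (critExp n σ - 1), by positivity, fun L hL τ hτ => ?_⟩
  have hW := tower_one_pos hg (show 0 < L by linarith) τ
  have hw := linWeight_pos hσ hn τ
  have hV := cosh_rpow_neg_pos (fowlerExp n σ) τ
  have h1 := nonlinDeriv_of_pos (n := n) (σ := σ) hW
  refine ⟨by rw [h1]; positivity, ?_⟩
  rw [div_le_iff₀ hw, h1, ← nonlinDeriv_bubble hn, nonlinDeriv_of_pos hV]
  have h2 : tower (fowlerExp n σ) 1 L τ ^ (critExp n σ - 1) ≤
      C ^ (critExp n σ - 1) * (Real.cosh τ ^ (-fowlerExp n σ)) ^ (critExp n σ - 1) := by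
    rw [← Real.mul_rpow hC.le hV.le]
    exact Real.rpow_le_rpow hW.le (h L hL τ hτ) (by linarith)
  calc _ ≤ nonlinConst n σ * critExp n σ * _ := mul_le_mul_of_nonneg_left h2 (by positivity)
    _ = _ := by ring

/-- Dividing by the weight of a single bubble makes all periods act on the same space $L^2$. The
ratio stays bounded because on $[-L,L]$ the tower is comparable to its central bubble. -/
lemma exists_abs_pertKernel_le (hσ : 1 < σ) (hn : 2 * σ < n) :
    ∃ M, 0 < M ∧ ∀ L, 1 ≤ L → ∀ t τ, |pertKernel n σ L t τ| ≤ M := by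
  obtain ⟨M₁, hM₁, h1⟩ := exists_rieszKernelPer_le hσ hn
  obtain ⟨M₂, hM₂, h2⟩ := exists_linRatio_le hσ hn
  refine ⟨M₁ * M₂, by positivity, fun L hL t τ => ?_⟩
  unfold pertKernel
  by_cases hτ : τ ∈ Ioc (-L) L
  · rw [indicator_of_mem hτ, abs_mul]
    obtain ⟨h3, h4⟩ := h2 L hL τ (abs_le.2 ⟨hτ.1.le, hτ.2⟩)
    rw [abs_of_nonneg h3]
    refine mul_le_mul (abs_symKernel_le (fun s => ?_) t τ) h4 h3 hM₁.le
    rw [abs_of_pos (rieszKernelPer_pos hσ hn (by linarith) s)]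
    exact h1 L hL s
  · rw [indicator_of_notMem hτ, abs_zero]
    positivity

lemma continuous_linRatio (hσ : 1 < σ) (hn : 2 * σ < n) (hL : 0 < L) :
    Continuous fun τ => nonlinDeriv n σ (tower (fowlerExp n σ) 1 L τ) / linWeight n σ τ :=
  ((continuous_nonlinDeriv hσ hn).comp (continuous_tower (fowlerExp_pos hn) hL)).div
    continuous_linWeight fun τ => (linWeight_pos hσ hn τ).ne'

lemma isBddKernel_pertKernel (hσ : 1 < σ) (hn : 2 * σ < n) (hL : 1 ≤ L) :
    IsBddKernel (pertKernel n σ L) := by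
  have hL0 : 0 < L := by linarith
  obtain ⟨M, -, hM⟩ := exists_abs_pertKernel_le hσ hn
  refine ⟨?_, M, hM L hL⟩
  have hcont : Continuous fun z : ℝ × ℝ => symKernel (rieszKernelPer n σ L) z.1 z.2 *
      (nonlinDeriv n σ (tower (fowlerExp n σ) 1 L z.2) / linWeight n σ z.2) :=
    (continuous_symKernel_per hσ hn hL0).mul ((continuous_linRatio hσ hn hL0).comp continuous_snd)
  have hm : MeasurableSet (Prod.snd ⁻¹' Ioc (-L) L : Set (ℝ × ℝ)) :=
    measurable_snd measurableSet_Ioc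
  exact hcont.measurable.indicator hm

lemma continuous_pertKernel (hσ : 1 < σ) (hn : 2 * σ < n) (hL : 0 < L) (τ : ℝ) :
    Continuous fun t => pertKernel n σ L t τ := by
  unfold pertKernel
  by_cases hτ : τ ∈ Ioc (-L) L
  · simp only [indicator_of_mem hτ]
    exact ((continuous_symKernel_per hσ hn hL).comp
      (by fun_prop : Continuous fun t : ℝ => (t, τ))).mul continuous_const
  · simp only [indicator_of_notMem hτ]
    exact continuous_const

lemma tendsto_pertKernel (hσ : 1 < σ) (hn : 2 * σ < n) (t τ : ℝ) :
    Tendsto (fun L => pertKernel n σ L t τ) atTop (𝓝 (symKernel (rieszKernel n σ) t τ)) := by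
  have h1 : Tendsto (fun L => symKernel (rieszKernelPer n σ L) t τ) atTop
      (𝓝 (symKernel (rieszKernel n σ) t τ)) :=
    ((tendsto_rieszKernelPer hσ hn _).add (tendsto_rieszKernelPer hσ hn _)).div_const 2
  have h2 : Tendsto (fun L => nonlinDeriv n σ (tower (fowlerExp n σ) 1 L τ) / linWeight n σ τ) atTop
      (𝓝 1) := by
    rw [← div_self (linWeight_pos hσ hn τ).ne']
    refine Tendsto.div_const ?_ _
    conv_rhs => rw [← nonlinDeriv_bubble hn]
    exact ((continuous_nonlinDeriv hσ hn).tendsto _).comp (tendsto_tower (fowlerExp_pos hn) τ)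
  have h3 := h1.mul h2
  rw [mul_one] at h3
  refine h3.congr' ?_
  filter_upwards [eventually_gt_atTop |τ|] with L hL
  rw [pertKernel, indicator_of_mem]
  exact ⟨(abs_lt.1 hL).1, (abs_lt.1 hL).2.le⟩

lemma kerFun_pertKernel (hσ : 1 < σ) (hn : 2 * σ < n) (hL : 0 < L) (φ : ℝ → ℝ) (t : ℝ) :
    kerFun (linMeasure n σ) (pertKernel n σ L) φ t = ∫ τ in (-L)..L,
      symKernel (rieszKernelPer n σ L) t τ *
        (nonlinDeriv n σ (tower (fowlerExp n σ) 1 L τ) * φ τ) := by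
  rw [kerFun, integral_linMeasure hσ hn, intervalIntegral.integral_of_le (by linarith),
    ← integral_indicator measurableSet_Ioc]
  refine integral_congr_ae (.of_forall fun τ => ?_)
  have hw := (linWeight_pos hσ hn τ).ne'
  simp only [pertKernel, indicator_apply]
  split_ifs
  · field_simp
  · simp

/-- Uniform invertibility of the linearization at the bubble tower. -/
lemma exists_uniform_inverse (hσ : 1 < σ) (hn : 2 * σ < n) [IsFiniteMeasure (linMeasure n σ)] :
    ∃ L₀, 1 ≤ L₀ ∧ ∃ C > 0, ∀ L, L₀ ≤ L → ∀ hκ : IsBddKernel (pertKernel n σ L),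
      IsUnit (1 - kerOp (linMeasure n σ) hκ) ∧
      ∀ φ, ‖φ‖ ≤ C * ‖(1 - kerOp (linMeasure n σ) hκ) φ‖ := by
  obtain ⟨δ, hδ, C, hC, h⟩ := exists_isUnit_ball (isUnit_one_sub_linOp hσ hn)
  obtain ⟨M, hM, hbd⟩ := exists_abs_pertKernel_le hσ hn
  -- The kernels are known to be bounded only for periods with $L\ge1$; replacing $L$ by $\max(L,1)$
  -- gives a family indexed by all reals.
  have htop : Tendsto (fun L : ℝ => max L 1) atTop atTop :=
    tendsto_atTop_mono (fun L => le_max_left _ _) tendsto_id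
  have hlim := tendsto_norm_kerOp_sub (μ := linMeasure n σ) (l := atTop)
    (κ' := fun L : ℝ => pertKernel n σ (max L 1)) (isBddKernel_rieszKernel hσ hn)
    (fun L => isBddKernel_pertKernel hσ hn (le_max_right _ _))
    (.of_forall fun L => hbd _ (le_max_right _ _))
    (fun t τ => (tendsto_pertKernel hσ hn t τ).comp htop)
  obtain ⟨L₁, hL₁⟩ := eventually_atTop.1 (hlim.eventually_lt_const hδ)
  refine ⟨max L₁ 1, le_max_right _ _, C, hC, fun L hL hκ => ?_⟩
  have hL1 : max L 1 = L := max_eq_left ((le_max_right _ _).trans hL)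
  have key : ∀ L', L' = L → ∀ hκ' : IsBddKernel (pertKernel n σ L'),
      kerOp (linMeasure n σ) hκ' = kerOp (linMeasure n σ) hκ := by
    rintro _ rfl hκ'
    rfl
  have h1 := hL₁ L ((le_max_left _ _).trans hL)
  rw [key _ hL1] at h1
  refine h _ ?_
  rw [linOp, sub_sub_sub_cancel_left, norm_sub_rev]
  exact h1

/-- Solvability near the bubble tower, uniformly in the period. -/
theorem exists_solution_near_tower (hσ : 1 < σ) (hn : 2 * σ < n) :
    ∃ L₀, 1 ≤ L₀ ∧ ∃ r > 0, ∃ K > 0, ∀ L, L₀ ≤ L →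
      (∀ ε, ε ≤ r / K →
        (∀ t, |solOp n σ L (tower (fowlerExp n σ) 1 L) t - tower (fowlerExp n σ) 1 L t| ≤ ε) →
        ∃ ψ : ℝ → ℝ, Continuous ψ ∧ (∀ t, |ψ t| ≤ K * ε) ∧
          ∀ t, solOp n σ L (fun τ => tower (fowlerExp n σ) 1 L τ + ψ τ) t =
            tower (fowlerExp n σ) 1 L t + ψ t) ∧
      ∀ ψ₁ ψ₂ : ℝ → ℝ, Continuous ψ₁ → Continuous ψ₂ → (∀ t, |ψ₁ t| ≤ r) → (∀ t, |ψ₂ t| ≤ r) →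
        (∀ t, solOp n σ L (fun τ => tower (fowlerExp n σ) 1 L τ + ψ₁ τ) t =
            tower (fowlerExp n σ) 1 L t + ψ₁ t) →
        (∀ t, solOp n σ L (fun τ => tower (fowlerExp n σ) 1 L τ + ψ₂ τ) t =
            tower (fowlerExp n σ) 1 L t + ψ₂ t) → ψ₁ = ψ₂ := by
  have hg := fowlerExp_pos hn
  have hfin := isFiniteMeasure_linMeasure (n := n) hσ
  obtain ⟨L₀, hL₀, C, hC, hinv⟩ := exists_uniform_inverse hσ hn
  obtain ⟨M, hM, hMb⟩ := exists_abs_pertKernel_le hσ hn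
  obtain ⟨B, hB, hBb⟩ := exists_tower_le hg
  set A := (linMeasure n σ).real univ with hA
  have hA0 : 0 ≤ A := measureReal_nonneg
  set K := 1 + A * M * C with hK
  have hK0 : 0 < K := by positivity
  set I := ∫ τ, rieszKernel n σ τ with hI
  have hI0 : 0 ≤ I := integral_rieszKernel_nonneg hσ hn
  -- The periodized kernel has total mass $I$, so this tolerance makes the Lipschitz constant of the
  -- nonlinear remainder at most $1/(2K)$.
  obtain ⟨r, hr, hexp⟩ := exists_nonlin_expansion hσ hn B
    (η := 1 / (2 * K * (I + 1))) (by positivity)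
  refine ⟨L₀, hL₀, r, hr, 2 * K, by positivity, fun L hL => ?_⟩
  have hL1 : 1 ≤ L := hL₀.trans hL
  have hLpos : 0 < L := by linarith
  set W := tower (fowlerExp n σ) 1 L with hW
  have hWc : Continuous W := continuous_tower hg hLpos
  have hWB : ∀ t, |W t| ≤ B := fun t => by
    rw [abs_of_pos (tower_one_pos hg hLpos t)]
    exact hBb L hL1 t
  have hκ := isBddKernel_pertKernel (n := n) hσ hn hL1
  have hκc := continuous_pertKernel (n := n) hσ hn hLpos
  obtain ⟨hunit, hbelow⟩ := hinv L hL hκ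
  have hfc := continuous_nonlin (n := n) hσ hn
  have hbdd : ∀ ψ : ℝ →ᵇ ℝ, ∃ D, ∀ t, |solOp n σ L (fun τ => W τ + ψ τ) t - W t| ≤ D := by
    intro ψ
    obtain ⟨D, hD⟩ := (isCompact_Icc (a := -(B + ‖ψ‖)) (b := B + ‖ψ‖)).exists_bound_of_continuousOn
      hfc.continuousOn
    refine ⟨I * D + B, fun t => (abs_sub _ _).trans (add_le_add ?_ (hWB t))⟩
    refine abs_integral_symKernel_le hσ hn hLpos (fun τ => hD _ ?_) t
    exact mem_Icc.2 (abs_le.1 ((abs_add_le _ _).trans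
      (add_le_add (hWB τ) (ψ.norm_coe_le_norm τ))))
  choose D hD using hbdd
  let F : (ℝ →ᵇ ℝ) → (ℝ →ᵇ ℝ) := fun ψ =>
    BoundedContinuousFunction.ofNormedAddCommGroup (fun t => solOp n σ L (fun τ => W τ + ψ τ) t - W t)
      ((continuous_solOp hσ hn hLpos (hWc.add ψ.continuous)).sub hWc) (D ψ) (hD ψ)
  have hFapp : ∀ ψ t, F ψ t = solOp n σ L (fun τ => W τ + ψ τ) t - W t := fun _ _ => rfl
  set J := kerBCF (linMeasure n σ) hκ hκc with hJ
  have hJb : ∀ a, ‖a‖ ≤ K * ‖a - J a‖ := norm_le_mul_norm_sub_kerBCF hκ hκc (hMb L hL1) hC.le hbelow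
  have hJs : ∀ h, ∃ a, a - J a = h := exists_sub_kerBCF hκ hκc hunit
  have hF : ∀ a b : ℝ →ᵇ ℝ, ‖a‖ ≤ r → ‖b‖ ≤ r →
      ‖F a - F b - J (a - b)‖ ≤ 1 / (2 * K) * ‖a - b‖ := by
    intro a b ha hb
    refine (BoundedContinuousFunction.norm_le (by positivity)).2 fun t => ?_
    have hsc : Continuous fun τ => symKernel (rieszKernelPer n σ L) t τ :=
      continuous_symKernel_per_right hσ hn hLpos t
    have hdc : Continuous fun τ => nonlinDeriv n σ (W τ) := (continuous_nonlinDeriv hσ hn).comp hWc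
    have hac : Continuous fun τ => nonlin n σ (W τ + a τ) := hfc.comp (hWc.add a.continuous)
    have hbc : Continuous fun τ => nonlin n σ (W τ + b τ) := hfc.comp (hWc.add b.continuous)
    have e : (F a - F b - J (a - b)) t = ∫ τ in (-L)..L, symKernel (rieszKernelPer n σ L) t τ *
        (nonlin n σ (W τ + a τ) - nonlin n σ (W τ + b τ) -
          nonlinDeriv n σ (W τ) * (a τ - b τ)) := by
      simp only [BoundedContinuousFunction.sub_apply, hFapp, hJ, kerBCF_apply]
      rw [kerFun_pertKernel hσ hn hLpos]
      simp only [solOp]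
      rw [sub_sub_sub_cancel_right]
      exact integral_mul_sub_sub hsc hac hbc (hdc.mul (a.continuous.sub b.continuous)) _ _
    rw [e]
    refine (abs_integral_symKernel_le hσ hn hLpos
      (M := 1 / (2 * K * (I + 1)) * ‖a - b‖) (fun τ => ?_) t).trans ?_
    · refine (hexp _ _ _ (hWB τ) ((a.norm_coe_le_norm τ).trans ha)
        ((b.norm_coe_le_norm τ).trans hb)).trans ?_
      exact mul_le_mul_of_nonneg_left ((a - b).norm_coe_le_norm τ) (by positivity)
    · rw [← mul_assoc]
      refine mul_le_mul_of_nonneg_right ?_ (norm_nonneg _)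
      rw [mul_one_div, div_le_div_iff₀ (by positivity) (by positivity)]
      nlinarith
  refine ⟨fun ε hε hres => ?_, fun ψ₁ ψ₂ hc₁ hc₂ hr₁ hr₂ h₁ h₂ => ?_⟩
  · have hε0 : 0 ≤ ε := (abs_nonneg _).trans (hres 0)
    have hF0 : ‖F 0‖ ≤ ε := (BoundedContinuousFunction.norm_le hε0).2 fun t => by
      rw [hFapp]
      simpa using hres t
    obtain ⟨ψ, hψ, hfix⟩ := exists_fixedPoint hK0 (kerBCF_sub hκ hκc) hJs hJb hF (hF0.trans hε)
    refine ⟨ψ, ψ.continuous, fun t => (ψ.norm_coe_le_norm t).trans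
      (hψ.trans (mul_le_mul_of_nonneg_left hF0 (by positivity))), fun t => ?_⟩
    have := hFapp ψ t
    rw [hfix] at this
    rw [this]
    ring
  · let a : ℝ →ᵇ ℝ := BoundedContinuousFunction.ofNormedAddCommGroup ψ₁ hc₁ r hr₁
    let b : ℝ →ᵇ ℝ := BoundedContinuousFunction.ofNormedAddCommGroup ψ₂ hc₂ r hr₂
    have hab : a = b := by
      refine fixedPoint_unique hK0 hJb hF ((BoundedContinuousFunction.norm_le hr.le).2 hr₁)
        ((BoundedContinuousFunction.norm_le hr.le).2 hr₂) ?_ ?_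
      · ext t
        rw [hFapp]
        exact sub_eq_of_eq_add' (h₁ t)
      · ext t
        rw [hFapp]
        exact sub_eq_of_eq_add' (h₂ t)
    funext t
    exact DFunLike.congr_fun hab t

end PeriodicOperator

end Delaunay


/-! ### The residual of the tower -/

namespace Delaunay

open Set

section PeriodicCalculus

lemma _root_.Function.Periodic.iteratedDeriv {f : ℝ → ℝ} {c : ℝ} (hf : Function.Periodic f c) (i : ℕ) :
    Function.Periodic (iteratedDeriv i f) c := by
  intro t
  have h := congrFun (iteratedDeriv_comp_add_const i f c) t
  rw [show (fun z => f (z + c)) = f from funext hf] at h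
  exact h.symm

lemma iteratedDeriv_le_of_periodic {u : ℝ → ℝ} {L M : ℝ} (hL : 0 < L)
    (hu : Function.Periodic u (2 * L)) (i : ℕ)
    (h : ∀ t, |t| ≤ L → |iteratedDeriv i u t| ≤ M) (t : ℝ) : |iteratedDeriv i u t| ≤ M := by
  obtain ⟨j, hj⟩ := exists_abs_sub_period_le hL t
  rw [← (hu.iteratedDeriv i).sub_two_mul_int t j]
  exact h _ hj

end PeriodicCalculus

section Residual

variable {n : ℕ} {σ : ℝ}

/-- The gain `ξ` in the decay rate of the error. -/
noncomputable def rateGain (n : ℕ) (σ : ℝ) : ℝ := min 1 (critExp n σ - 1)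

/-- The size of the error of the bubble tower. -/
noncomputable def errScale (n : ℕ) (σ L : ℝ) : ℝ :=
  Real.exp (-(fowlerExp n σ * L * (1 + rateGain n σ)))

lemma rateGain_pos (hσ : 1 < σ) (hn : 2 * σ < n) : 0 < rateGain n σ :=
  lt_min one_pos (by linarith [one_lt_critExp hσ hn])

lemma errScale_pos (L : ℝ) : 0 < errScale n σ L := Real.exp_pos _

lemma tendsto_exp_neg_mul {a : ℝ} (ha : 0 < a) :
    Tendsto (fun L : ℝ => Real.exp (-(a * L))) atTop (𝓝 0) :=
  Real.tendsto_exp_neg_atTop_nhds_zero.comp (tendsto_id.const_mul_atTop ha)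

lemma errScale_eq (L : ℝ) : errScale n σ L =
    Real.exp (-(fowlerExp n σ * rateGain n σ * L)) * Real.exp (-(fowlerExp n σ * L)) := by
  rw [errScale, ← Real.exp_add]
  congr 1
  ring

/-- The error is small even relative to the minimum of the tower; this is what keeps the corrected
solution positive. -/
lemma errScale_le_tower (hn : 2 * σ < n) {L : ℝ} (hL : 0 < L) (t : ℝ) :
    errScale n σ L ≤ Real.exp (-(fowlerExp n σ * rateGain n σ * L)) *
      tower (fowlerExp n σ) 1 L t := by
  rw [errScale_eq]
  exact mul_le_mul_of_nonneg_left (exp_le_tower (fowlerExp_pos hn) hL t) (Real.exp_pos _).le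

/-- The window exceeds $[-L,L]$ by one on each side, so that derivatives at $\pm L$ are taken inside
an open set. -/
lemma exists_tower_sub_le_near {a : ℝ} (ha : 0 < a) :
    ∃ C, 0 < C ∧ ∀ L, 1 ≤ L → ∀ t ∈ Ioo (-(L + 1)) (L + 1),
      tower a 1 L t - Real.cosh t ^ (-a) ≤ C * Real.exp (-(a * (2 * L - |t|))) ∧
      tower a 1 L t ≤ C * Real.cosh t ^ (-a) := by
  obtain ⟨C, hC, h⟩ := exists_tower_sub_le ha
  refine ⟨C * Real.exp (2 * a) + 1, by positivity, fun L hL t ht => ?_⟩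
  have ht' : |t| ≤ L + 1 := (abs_lt.2 ht).le
  have h1 := h L hL t
  have he : 1 ≤ Real.exp (2 * a) := Real.one_le_exp (by linarith)
  have hV := cosh_rpow_neg_pos a t
  refine ⟨h1.trans (mul_le_mul_of_nonneg_right (by nlinarith) (Real.exp_pos _).le), ?_⟩
  have h2 : Real.exp (-(a * (2 * L - |t|))) ≤ Real.exp (2 * a) * Real.cosh t ^ (-a) := by
    refine le_trans ?_ (mul_le_mul_of_nonneg_left (exp_le_cosh_rpow_neg ha t) (Real.exp_pos _).le)
    rw [← Real.exp_add]
    refine Real.exp_le_exp.2 ?_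
    have := mul_le_mul_of_nonneg_left (show |t| ≤ 2 * L - |t| + 2 by linarith) ha.le
    linarith
  have h3 := mul_le_mul_of_nonneg_left h2 hC.le
  linarith

/-- The difference is of size $V^{p-1}(W-V)\lesssim e^{-\gamma_\sigma(2L-(2-p)|t|)}$. For $p\le2$
the worst points are $|t|=L$, giving $e^{-p\gamma_\sigma L}$; for $p\ge2$ it is $t=0$, giving
$e^{-2\gamma_\sigma L}$. Hence $\xi=\min(1,p-1)$. -/
lemma derivBound_tower_rpow_sub (hσ : 1 < σ) (hn : 2 * σ < n) (k : ℕ) :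
    ∃ C, 0 < C ∧ ∀ L, 1 ≤ L → DerivBound (Ioo (-(L + 1)) (L + 1)) k
      (fun t => tower (fowlerExp n σ) 1 L t ^ critExp n σ -
        (Real.cosh t ^ (-fowlerExp n σ)) ^ critExp n σ) (fun _ => C * errScale n σ L) := by
  have hg := fowlerExp_pos hn
  have hp := one_lt_critExp hσ hn
  set a := fowlerExp n σ with ha
  set p := critExp n σ with hpdef
  obtain ⟨C₁, hC₁, h1⟩ := derivBound_tower hg k 1
  obtain ⟨C₂, hC₂, h2⟩ := exists_tower_sub_le_near hg
  obtain ⟨C₃, hC₃, h3⟩ := DerivBound.rpow_sub_rpow k (K := C₁ * C₂ + C₁ + 1) (by positivity) p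
  refine ⟨C₃ * (2 ^ (a * (p - 1)) * (C₁ * (C₂ * Real.exp (a * |2 - p|)))), by positivity,
    fun L hL => ?_⟩
  have hL0 : 0 < L := by linarith
  obtain ⟨hW, hWV, hV⟩ := h1 L hL0
  have hVpos : ∀ t, 0 < Real.cosh t ^ (-a) := cosh_rpow_neg_pos a
  have hle : ∀ t, Real.cosh t ^ (-a) ≤ tower a 1 L t := fun t => by
    simpa using cosh_le_tower hg hL0 t 0
  have hK1 : 1 ≤ C₁ * C₂ + C₁ + 1 := by nlinarith
  have hcV : coshPoly a 1 = fun t => Real.cosh t ^ (-a) := funext fun t => coshPoly_one a t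
  rw [hcV] at hWV hV
  have h4 := h3 (Ioo (-(L + 1)) (L + 1)) (tower a 1 L) (fun t => Real.cosh t ^ (-a))
    (fun t => Real.cosh t ^ (-a))
    (fun t => C₁ * (tower a 1 L t - Real.cosh t ^ (-a))) (fun t _ => hVpos t)
    (fun t _ => (hle t).trans (le_mul_of_one_le_left ((hVpos t).le.trans (hle t)) hK1))
    (fun t _ => le_mul_of_one_le_left (hVpos t).le hK1)
    ((hW.mono_set (subset_univ _)).mono fun t ht => by
      have := mul_le_mul_of_nonneg_left (h2 L hL t ht).2 hC₁.le
      have h5 := hVpos t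
      nlinarith)
    ((hV.mono_set (subset_univ _)).mono fun t ht => by
      have h5 := hVpos t
      have : 0 < C₁ * C₂ := by positivity
      nlinarith)
    (hWV.mono_set (subset_univ _))
  refine h4.mono fun t ht => ?_
  have ht' : |t| ≤ L + 1 := (abs_lt.2 ht).le
  have e1 : (Real.cosh t ^ (-a)) ^ (p - 1) ≤ 2 ^ (a * (p - 1)) * Real.exp (-(a * (p - 1) * |t|)) := by
    rw [← Real.rpow_mul (Real.cosh_pos t).le, neg_mul]
    exact cosh_rpow_neg_le (mul_pos hg (by linarith)) t
  have e2 : Real.exp (-(a * (p - 1) * |t|)) * Real.exp (-(a * (2 * L - |t|))) ≤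
      Real.exp (a * |2 - p|) * errScale n σ L := by
    rw [errScale, ← Real.exp_add, ← Real.exp_add, ← ha]
    refine Real.exp_le_exp.2 ?_
    -- The extra $|2-p|$ pays for $|t|$ reaching $L+1$ instead of $L$.
    have key : (2 - p) * |t| + L * (1 + rateGain n σ) ≤ 2 * L + |2 - p| := by
      rcases le_total p 2 with hp2 | hp2
      · have : rateGain n σ = p - 1 := min_eq_right (by linarith)
        rw [this, abs_of_nonneg (show 0 ≤ 2 - p by linarith)]
        nlinarith [mul_le_mul_of_nonneg_left ht' (show 0 ≤ 2 - p by linarith)]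
      · have : rateGain n σ = 1 := min_eq_left (by linarith)
        rw [this]
        nlinarith [abs_nonneg t, abs_nonneg (2 - p)]
    have := mul_le_mul_of_nonneg_left key hg.le
    linarith
  have e3 := (h2 L hL t ht).1
  calc C₃ * ((Real.cosh t ^ (-a)) ^ (p - 1) * (C₁ * (tower a 1 L t - Real.cosh t ^ (-a))))
      ≤ C₃ * ((2 ^ (a * (p - 1)) * Real.exp (-(a * (p - 1) * |t|))) *
        (C₁ * (C₂ * Real.exp (-(a * (2 * L - |t|)))))) := by
        have := sub_nonneg.2 (hle t)
        gcongr
    _ = C₃ * (2 ^ (a * (p - 1)) * (C₁ * (C₂ * (Real.exp (-(a * (p - 1) * |t|)) *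
          Real.exp (-(a * (2 * L - |t|))))))) := by ring
    _ ≤ C₃ * (2 ^ (a * (p - 1)) * (C₁ * (C₂ * (Real.exp (a * |2 - p|) * errScale n σ L)))) := by
        gcongr
    _ = _ := by ring

/-- As $V^p=\cosh^{-\gamma'_\sigma}$, the residual splits into $W^p-V^p$ and the nonlinearities of
the distant bubbles. The latter are of order $e^{-\gamma'_\sigma L}=e^{-p\gamma_\sigma L}$, within
the error scale. -/
lemma derivBound_residual (hσ : 1 < σ) (hn : 2 * σ < n) (k : ℕ) :
    ∃ C, 0 < C ∧ ∀ L, 1 ≤ L → DerivBound (Ioo (-(L + 1)) (L + 1)) k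
      (fun t => tower (fowlerExp n σ) 1 L t ^ critExp n σ - tower (fowlerExpDual n σ) 1 L t)
      (fun _ => C * errScale n σ L) := by
  have hg := fowlerExp_pos hn
  have hp := one_lt_critExp hσ hn
  have hpm := critExp_mul hn
  have hg' : 0 < fowlerExpDual n σ := by rw [← hpm]; positivity
  obtain ⟨C₁, hC₁, h1⟩ := derivBound_tower_rpow_sub hσ hn k
  obtain ⟨C₂, hC₂, h2⟩ := derivBound_tower hg' k 1
  obtain ⟨C₃, hC₃, h3⟩ := exists_tower_sub_le_near hg'
  refine ⟨C₁ + C₂ * (C₃ * Real.exp (fowlerExpDual n σ)), by positivity, fun L hL => ?_⟩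
  have h4 := (h1 L hL).sub (((h2 L (by linarith)).2.1).mono_set (subset_univ (Ioo (-(L + 1)) (L + 1))))
  have e : (fun t => tower (fowlerExp n σ) 1 L t ^ critExp n σ - tower (fowlerExpDual n σ) 1 L t) =
      fun t => (tower (fowlerExp n σ) 1 L t ^ critExp n σ -
        (Real.cosh t ^ (-fowlerExp n σ)) ^ critExp n σ) -
        (tower (fowlerExpDual n σ) 1 L t - coshPoly (fowlerExpDual n σ) 1 t) := by
    funext t
    rw [coshPoly_one, ← Real.rpow_mul (Real.cosh_pos t).le, ← hpm]
    rw [show -fowlerExp n σ * critExp n σ = -(critExp n σ * fowlerExp n σ) by ring]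
    ring
  rw [e]
  refine h4.mono fun t ht => ?_
  have ht' : |t| ≤ L + 1 := (abs_lt.2 ht).le
  have e1 := (h3 L hL t ht).1
  have e2 : Real.exp (-(fowlerExpDual n σ * (2 * L - |t|))) ≤
      Real.exp (fowlerExpDual n σ) * errScale n σ L := by
    rw [errScale, ← Real.exp_add]
    refine Real.exp_le_exp.2 ?_
    have h5 : rateGain n σ ≤ critExp n σ - 1 := min_le_right _ _
    have h6 : fowlerExp n σ * L * (1 + rateGain n σ) ≤ fowlerExpDual n σ * L := by
      rw [← hpm]
      have : 0 < fowlerExp n σ * L := mul_pos hg (by linarith)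
      nlinarith
    nlinarith
  calc _ ≤ C₁ * errScale n σ L +
        C₂ * (C₃ * Real.exp (-(fowlerExpDual n σ * (2 * L - |t|)))) := by gcongr
    _ ≤ C₁ * errScale n σ L + C₂ * (C₃ * (Real.exp (fowlerExpDual n σ) * errScale n σ L)) := by
        gcongr
    _ = _ := by ring

/-- The residual of the bubble tower. -/
noncomputable def residual (n : ℕ) (σ L t : ℝ) : ℝ :=
  nonlin n σ (tower (fowlerExp n σ) 1 L t) - nonlinConst n σ * tower (fowlerExpDual n σ) 1 L t

lemma fowlerExpDual_pos (hσ : 1 < σ) (hn : 2 * σ < n) : 0 < fowlerExpDual n σ := by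
  have hp := one_lt_critExp hσ hn
  have hg := fowlerExp_pos hn
  rw [← critExp_mul hn]
  positivity

lemma nonlin_of_pos {x : ℝ} (hx : 0 < x) : nonlin n σ x = nonlinConst n σ * x ^ critExp n σ := by
  rw [nonlin_eq, abs_of_pos hx]

lemma contDiff_nonlin_comp {k : ℕ} {v : ℝ → ℝ} (hv : ContDiff ℝ k v) (hpos : ∀ t, 0 < v t) :
    ContDiff ℝ k fun t => nonlin n σ (v t) := by
  have : (fun t => nonlin n σ (v t)) = fun t => nonlinConst n σ * v t ^ critExp n σ :=
    funext fun t => nonlin_of_pos (hpos t)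
  rw [this]
  exact contDiff_const.mul (hv.rpow_const_of_ne fun t => (hpos t).ne')

lemma contDiff_residual (hσ : 1 < σ) (hn : 2 * σ < n) {L : ℝ} (hL : 0 < L) (k : ℕ) :
    ContDiff ℝ k (residual n σ L) :=
  (contDiff_nonlin_comp (contDiff_tower (fowlerExp_pos hn) hL k 1)
    (tower_one_pos (fowlerExp_pos hn) hL)).sub
    (contDiff_const.mul (contDiff_tower (fowlerExpDual_pos hσ hn) hL k 1))

lemma residual_periodic (L : ℝ) : Function.Periodic (residual n σ L) (2 * L) := fun t => by
  simp only [residual, tower_periodic _ _ L t]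

lemma exists_iteratedDeriv_residual_le (hσ : 1 < σ) (hn : 2 * σ < n) (k : ℕ) :
    ∃ C, 0 < C ∧ ∀ L, 1 ≤ L → ∀ i ≤ k, ∀ t,
      |iteratedDeriv i (residual n σ L) t| ≤ C * errScale n σ L := by
  have hc := nonlinConst_pos hσ hn
  obtain ⟨C, hC, h⟩ := derivBound_residual hσ hn k
  refine ⟨nonlinConst n σ * C, by positivity, fun L hL i hi => ?_⟩
  have hL0 : 0 < L := by linarith
  refine iteratedDeriv_le_of_periodic hL0 (residual_periodic L) i fun t ht => ?_
  have h1 := (h L hL).const_mul (nonlinConst n σ)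
  have e : residual n σ L = fun t => nonlinConst n σ *
      (tower (fowlerExp n σ) 1 L t ^ critExp n σ - tower (fowlerExpDual n σ) 1 L t) := by
    funext t
    rw [residual, nonlin_of_pos (tower_one_pos (fowlerExp_pos hn) hL0 t)]
    ring
  rw [e]
  have ht' := abs_le.1 ht
  refine (h1.iteratedDeriv_le isOpen_Ioo hi ⟨by linarith, by linarith⟩).trans (le_of_eq ?_)
  simp only [abs_of_pos hc]
  ring

end Residual

/-! ### Fixed points of the symmetrized operator and the bootstrap -/

section SolutionOperator

variable {n : ℕ} {σ L : ℝ}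

lemma symKernel_neg_left {k : ℝ → ℝ} (hk : ∀ t, k (-t) = k t) (t τ : ℝ) :
    symKernel k (-t) τ = symKernel k t τ := by
  unfold symKernel
  rw [← hk (-t - τ), ← hk (-t + τ), add_comm (k _)]
  congr 3 <;> ring

/-- No symmetry of $v$ is required: together with `solOp_periodic` this makes every fixed point even
and periodic automatically. -/
lemma solOp_neg (v : ℝ → ℝ) (t : ℝ) : solOp n σ L v (-t) = solOp n σ L v t := by
  unfold solOp
  simp only [symKernel_neg_left (rieszKernelPer_neg L)]

lemma solOp_periodic (v : ℝ → ℝ) : Function.Periodic (solOp n σ L v) (2 * L) := fun t => by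
  unfold solOp symKernel
  have h1 : ∀ τ, rieszKernelPer n σ L (t + 2 * L - τ) = rieszKernelPer n σ L (t - τ) := fun τ => by
    rw [← rieszKernelPer_periodic L (t - τ)]
    congr 1
    ring
  have h2 : ∀ τ, rieszKernelPer n σ L (t + 2 * L + τ) = rieszKernelPer n σ L (t + τ) := fun τ => by
    rw [← rieszKernelPer_periodic L (t + τ)]
    congr 1
    ring
  simp only [h1, h2]

lemma integral_symKernel_of_even (hσ : 1 < σ) (hn : 2 * σ < n) (hL : 0 < L) {F : ℝ → ℝ}
    (hF : Continuous F) (heven : ∀ t, F (-t) = F t) (t : ℝ) :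
    ∫ τ in (-L)..L, symKernel (rieszKernelPer n σ L) t τ * F τ =
      ∫ τ in (-L)..L, F τ * rieszKernelPer n σ L (t - τ) := by
  have hc := continuous_rieszKernelPer (n := n) hσ hn hL
  have h1 : ∫ τ in (-L)..L, F τ * rieszKernelPer n σ L (t + τ) =
      ∫ τ in (-L)..L, F τ * rieszKernelPer n σ L (t - τ) := by
    have := intervalIntegral.integral_comp_neg (a := -L) (b := L)
      (fun τ => F τ * rieszKernelPer n σ L (t - τ))
    rw [neg_neg] at this
    rw [← this]
    simp only [heven, sub_neg_eq_add]
  have i1 : IntervalIntegrable (fun τ => F τ * rieszKernelPer n σ L (t - τ)) volume (-L) L :=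
    Continuous.intervalIntegrable (by fun_prop) _ _
  have i2 : IntervalIntegrable (fun τ => F τ * rieszKernelPer n σ L (t + τ)) volume (-L) L :=
    Continuous.intervalIntegrable (by fun_prop) _ _
  have h2 := intervalIntegral.integral_add i1 i2
  rw [h1] at h2
  have h3 : ∫ τ in (-L)..L, symKernel (rieszKernelPer n σ L) t τ * F τ =
      (∫ τ in (-L)..L, (F τ * rieszKernelPer n σ L (t - τ) +
        F τ * rieszKernelPer n σ L (t + τ))) / 2 := by
    rw [← intervalIntegral.integral_div]
    refine intervalIntegral.integral_congr fun τ _ => ?_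
    simp only [symKernel]
    ring
  rw [h3, h2]
  ring

lemma solOp_eq_intervalIntegral (hσ : 1 < σ) (hn : 2 * σ < n) (hL : 0 < L) {v : ℝ → ℝ}
    (hv : Continuous v) (heven : ∀ t, v (-t) = v t) (t : ℝ) :
    solOp n σ L v t = ∫ τ in (-L)..L, nonlin n σ (v τ) * rieszKernelPer n σ L (t - τ) :=
  integral_symKernel_of_even hσ hn hL ((continuous_nonlin hσ hn).comp hv)
    (fun t => congrArg (nonlin n σ) (heven t)) t

lemma exists_abs_le_of_periodic {F : ℝ → ℝ} (hL : 0 < L) (hF : Continuous F)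
    (hper : Function.Periodic F (2 * L)) : ∃ M, ∀ t, |F t| ≤ M := by
  obtain ⟨M, hM⟩ := (isCompact_Icc (a := -L) (b := L)).exists_bound_of_continuousOn hF.continuousOn
  refine ⟨M, fun t => ?_⟩
  obtain ⟨j, hj⟩ := exists_abs_sub_period_le hL t
  rw [← hper.sub_two_mul_int t j]
  exact hM _ (mem_Icc.2 (abs_le.1 hj))

lemma solOp_eq_lineConv (hσ : 1 < σ) (hn : 2 * σ < n) (hL : 0 < L) {v : ℝ → ℝ}
    (hv : Continuous v) (heven : ∀ t, v (-t) = v t) (hper : Function.Periodic v (2 * L)) (t : ℝ) :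
    solOp n σ L v t = lineConv (rieszKernel n σ) (fun τ => nonlin n σ (v τ)) t := by
  have hc : Continuous fun τ => nonlin n σ (v τ) := (continuous_nonlin hσ hn).comp hv
  have hp : Function.Periodic (fun τ => nonlin n σ (v τ)) (2 * L) := fun t => by
    simp only [hper t]
  obtain ⟨M, hM⟩ := exists_abs_le_of_periodic hL hc hp
  rw [solOp_eq_intervalIntegral hσ hn hL hv heven, lineConv_eq_intervalIntegral hσ hn hL hc hM hp]

lemma lineConv_sub {k F G : ℝ → ℝ} {M M' : ℝ} (hk : Integrable k) (hF : Continuous F)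
    (hM : ∀ t, |F t| ≤ M) (hG : Continuous G) (hM' : ∀ t, |G t| ≤ M') (t : ℝ) :
    lineConv k F t - lineConv k G t = lineConv k (fun τ => F τ - G τ) t := by
  simp only [lineConv, sub_mul]
  exact (integral_sub (integrable_lineConv hk hF hM t) (integrable_lineConv hk hG hM' t)).symm

/-- For an even periodic `v`, the defect of `v` and the tower under `solOp` is a convolution. -/
lemma solOp_sub_tower (hσ : 1 < σ) (hn : 2 * σ < n) (hL : 0 < L) {v : ℝ → ℝ}
    (hv : Continuous v) (heven : ∀ t, v (-t) = v t) (hper : Function.Periodic v (2 * L)) (t : ℝ) :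
    solOp n σ L v t - tower (fowlerExp n σ) 1 L t = lineConv (rieszKernel n σ)
      (fun τ => nonlin n σ (v τ) - nonlinConst n σ * tower (fowlerExpDual n σ) 1 L τ) t := by
  have hc : Continuous fun τ => nonlin n σ (v τ) := (continuous_nonlin hσ hn).comp hv
  have hp : Function.Periodic (fun τ => nonlin n σ (v τ)) (2 * L) := fun t => by
    simp only [hper t]
  obtain ⟨M, hM⟩ := exists_abs_le_of_periodic hL hc hp
  have hc' : Continuous fun τ => nonlinConst n σ * tower (fowlerExpDual n σ) 1 L τ :=
    continuous_const.mul (continuous_tower (fowlerExpDual_pos hσ hn) hL)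
  obtain ⟨M', hM'⟩ := exists_abs_le_of_periodic hL hc' fun t => by
    simp only [tower_periodic _ _ L t]
  rw [solOp_eq_lineConv hσ hn hL hv heven hper, ← lineConv_tower hσ hn hL]
  exact lineConv_sub (integrable_rieszKernel hσ hn) hc hM hc' hM' t

lemma exists_abs_solOp_tower_sub_le (hσ : 1 < σ) (hn : 2 * σ < n) :
    ∃ C, 0 < C ∧ ∀ L, 1 ≤ L → ∀ t,
      |solOp n σ L (tower (fowlerExp n σ) 1 L) t - tower (fowlerExp n σ) 1 L t| ≤
        C * errScale n σ L := by
  obtain ⟨C, hC, h⟩ := exists_iteratedDeriv_residual_le hσ hn 0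
  have h0 : 0 ≤ ∫ s, |rieszKernel n σ s| := integral_nonneg fun _ => abs_nonneg _
  refine ⟨((∫ s, |rieszKernel n σ s|) + 1) * C, by positivity, fun L hL t => ?_⟩
  have hL0 : 0 < L := by linarith
  rw [solOp_sub_tower hσ hn hL0 (continuous_tower (fowlerExp_pos hn) hL0) (tower_one_even _ L)
    (tower_periodic _ _ L)]
  have h1 := abs_lineConv_le (k := rieszKernel n σ) (F := residual n σ L)
    (integrable_rieszKernel hσ hn) (fun t => by simpa using h L hL 0 le_rfl t) t
  refine h1.trans ?_
  have := mul_nonneg hC.le (errScale_pos (n := n) (σ := σ) L).le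
  nlinarith

/-- Derivative estimates for a correction of the bubble tower, by bootstrapping. -/
lemma exists_iteratedDeriv_correction_le (hσ : 1 < σ) (hn : 2 * σ < n) {K : ℝ} (hK : 0 < K) (j : ℕ) :
    ∃ C, 0 < C ∧ ∀ L, 1 ≤ L → ∀ ψ : ℝ → ℝ, Continuous ψ → (∀ t, |ψ t| ≤ K * errScale n σ L) →
      (∀ t, |ψ t| ≤ tower (fowlerExp n σ) 1 L t / 2) →
      (∀ t, solOp n σ L (fun τ => tower (fowlerExp n σ) 1 L τ + ψ τ) t =
        tower (fowlerExp n σ) 1 L t + ψ t) →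
      ContDiff ℝ j ψ ∧ ∀ i ≤ j, ∀ t, |iteratedDeriv i ψ t| ≤ C * errScale n σ L := by
  have hg := fowlerExp_pos hn
  have hp := one_lt_critExp hσ hn
  have hc := nonlinConst_pos hσ hn
  induction j with
  | zero =>
    refine ⟨K, hK, fun L hL ψ hψ hb _ _ => ⟨by simpa using hψ, fun i hi t => ?_⟩⟩
    obtain rfl : i = 0 := by omega
    simpa using hb t
  | succ j ih =>
    obtain ⟨C₁, hC₁, h1⟩ := ih
    obtain ⟨C₂, hC₂, h2⟩ := derivBound_tower hg j 1
    -- This comparability constant dominates $2$, from $W\le2v$, and $C_1+C_2$, from the bounds on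
    -- $W$, $\psi$ and their derivatives.
    obtain ⟨C₃, hC₃, h3⟩ := DerivBound.rpow_sub_rpow j (K := C₁ + C₂ + 2) (by positivity)
      (critExp n σ)
    obtain ⟨C₄, hC₄, h4⟩ := exists_iteratedDeriv_residual_le hσ hn j
    obtain ⟨B, hB, hWB⟩ := exists_tower_le hg
    have hI : 0 ≤ (∫ s, |rieszKernel n σ s|) + ∫ s, |rieszKernelDeriv n σ s| :=
      add_nonneg (integral_nonneg fun _ => abs_nonneg _) (integral_nonneg fun _ => abs_nonneg _)
    set C₅ := nonlinConst n σ * (C₃ * (B ^ (critExp n σ - 1) * C₁)) with hC₅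
    refine ⟨((∫ s, |rieszKernel n σ s|) + (∫ s, |rieszKernelDeriv n σ s|) + 1) * (C₅ + C₄),
      by positivity, fun L hL ψ hψ hb hhalf heq => ?_⟩
    have hL0 : 0 < L := by linarith
    set W := tower (fowlerExp n σ) 1 L with hW
    set ε := errScale n σ L with hε
    have hε0 : 0 < ε := errScale_pos L
    obtain ⟨hcd, hder⟩ := h1 L hL ψ hψ hb hhalf heq
    have hWpos : ∀ t, 0 < W t := tower_one_pos hg hL0
    have hWc : ContDiff ℝ j W := contDiff_tower hg hL0 j 1
    set v := fun t => W t + ψ t with hv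
    have hvc : ContDiff ℝ j v := hWc.add hcd
    have hvW : ∀ t, W t ≤ 2 * v t := fun t => by
      have := (abs_le.1 (hhalf t)).1
      simp only [hv]
      linarith
    have hvpos : ∀ t, 0 < v t := fun t => by linarith [hvW t, hWpos t]
    have heven : ∀ t, v (-t) = v t := fun t => by
      simp only [hv]
      rw [← heq, ← heq, solOp_neg]
    have hper : Function.Periodic v (2 * L) := fun t => by
      simp only [hv]
      rw [← heq, ← heq, solOp_periodic]
    set F := fun τ => nonlin n σ (v τ) - nonlinConst n σ * tower (fowlerExpDual n σ) 1 L τ with hF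
    -- The tower is itself a potential, so the correction is the potential of
    -- $f_\sigma(W+\psi)-\sum_jf_\sigma(V_j)$, a small source.
    have hψF : ψ = lineConv (rieszKernel n σ) F := by
      funext t
      rw [← solOp_sub_tower hσ hn hL0 hvc.continuous heven hper, heq]
      ring
    have hFc : ContDiff ℝ j F := (contDiff_nonlin_comp hvc hvpos).sub
      (contDiff_const.mul (contDiff_tower (fowlerExpDual_pos hσ hn) hL0 j 1))
    -- This absorbs the derivatives of $\psi$ into the weight $W$, so that $v$ is comparable to $W$
    -- with constants independent of the period.
    have hεW : ∀ t, ε ≤ W t := fun t => by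
      refine (errScale_le_tower hn hL0 t).trans (mul_le_of_le_one_left (hWpos t).le ?_)
      have : 0 < fowlerExp n σ * rateGain n σ * L :=
        mul_pos (mul_pos hg (rateGain_pos hσ hn)) hL0
      exact Real.exp_le_one_iff.2 (by linarith)
    have hψD : DerivBound univ j ψ (fun _ => C₁ * ε) :=
      DerivBound.of_contDiff hcd fun i hi t _ => hder i hi t
    have hWD : DerivBound univ j W (fun t => C₂ * W t) := (h2 L hL0).1
    have hvD : DerivBound univ j v (fun t => (C₁ + C₂ + 2) * W t) :=
      (hWD.add hψD).mono fun t _ => by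
        have := mul_le_mul_of_nonneg_left (hεW t) hC₁.le
        have := hWpos t
        nlinarith
    have hdiff : DerivBound univ j (fun t => v t ^ critExp n σ - W t ^ critExp n σ)
        (fun t => C₃ * (W t ^ (critExp n σ - 1) * (C₁ * ε))) := by
      refine h3 univ v W W _ (fun t _ => hWpos t) (fun t _ => (hvW t).trans ?_) (fun t _ => ?_)
        hvD (hWD.mono fun t _ => ?_) ?_
      · exact mul_le_mul_of_nonneg_right (by linarith) (hvpos t).le
      · have := hWpos t
        nlinarith
      · exact mul_le_mul_of_nonneg_right (by linarith) (hWpos t).le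
      · simpa [hv] using hψD
    have hres : DerivBound univ j (residual n σ L) (fun _ => C₄ * ε) :=
      DerivBound.of_contDiff (contDiff_residual hσ hn hL0 j) fun i hi t _ => h4 L hL i hi t
    -- The source is the sum of $f_\sigma(v)-f_\sigma(W)$, small because $\psi$ is, and of the
    -- residual of the tower.
    have hFD : DerivBound univ j F (fun _ => (C₅ + C₄) * ε) := by
      have e : F = fun t => nonlinConst n σ * (v t ^ critExp n σ - W t ^ critExp n σ) +
          residual n σ L t := by
        funext t
        simp only [hF, residual, ← hW]
        rw [nonlin_of_pos (hvpos t), nonlin_of_pos (hWpos t)]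
        ring
      rw [e]
      refine ((hdiff.const_mul (nonlinConst n σ)).add hres).mono fun t _ => ?_
      have hWp : W t ^ (critExp n σ - 1) ≤ B ^ (critExp n σ - 1) :=
        Real.rpow_le_rpow (hWpos t).le (hWB L hL t) (by linarith)
      rw [abs_of_pos hc, add_mul, hC₅]
      have : nonlinConst n σ * (C₃ * (W t ^ (critExp n σ - 1) * (C₁ * ε))) ≤
          nonlinConst n σ * (C₃ * (B ^ (critExp n σ - 1) * (C₁ * ε))) := by gcongr
      linarith
    have hfinal := contDiff_lineConv (continuous_rieszKernel hσ hn) (integrable_rieszKernel hσ hn)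
      (integrable_rieszKernelDeriv hσ hn) (fun s hs => hasDerivAt_rieszKernel hσ hn hs) j hFc
      (M := (C₅ + C₄) * ε) (fun i hi t => hFD.iteratedDeriv_le isOpen_univ hi (mem_univ t))
    rw [← hψF] at hfinal
    refine ⟨hfinal.1, fun i hi t => (hfinal.2 i hi t).trans ?_⟩
    rw [mul_assoc]
    refine mul_le_mul_of_nonneg_right (by linarith) (by positivity)

/-- Existence, local uniqueness and smallness of the correction of the bubble tower. -/
theorem exists_correction (hσ : 1 < σ) (hn : 2 * σ < n) :
    ∃ L₀, 1 ≤ L₀ ∧ ∃ r > 0, ∃ D : ℕ → ℝ, (∀ j, 0 < D j) ∧ ∃ ψ : ℝ → ℝ → ℝ, ∀ L, L₀ ≤ L →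
      (∀ t, 0 < tower (fowlerExp n σ) 1 L t + ψ L t) ∧
      (∀ t, solOp n σ L (fun τ => tower (fowlerExp n σ) 1 L τ + ψ L τ) t =
        tower (fowlerExp n σ) 1 L t + ψ L t) ∧
      (∀ j : ℕ, ContDiff ℝ j (ψ L)) ∧
      (∀ j, ∀ i ≤ j, ∀ t, |iteratedDeriv i (ψ L) t| ≤ D j * errScale n σ L) ∧
      ∀ w : ℝ → ℝ, Continuous w → (∀ t, |w t - tower (fowlerExp n σ) 1 L t| ≤ r) →
        (∀ t, solOp n σ L w t = w t) → ∀ t, w t = tower (fowlerExp n σ) 1 L t + ψ L t := by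
  have hg := fowlerExp_pos hn
  have hξ := rateGain_pos hσ hn
  obtain ⟨L₁, hL₁, r, hr, K, hK, hsol⟩ := exists_solution_near_tower hσ hn
  obtain ⟨C, hC, hres⟩ := exists_abs_solOp_tower_sub_le hσ hn
  choose D hD hreg using fun j => exists_iteratedDeriv_correction_le hσ hn (K := K * C)
    (by positivity) j
  have hdec := tendsto_exp_neg_mul (mul_pos hg hξ)
  have hdec' : Tendsto (fun L => errScale n σ L) atTop (𝓝 0) := by
    have := hdec.mul (tendsto_exp_neg_mul hg)
    rw [mul_zero] at this
    exact this.congr fun L => (errScale_eq L).symm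
  -- Two smallness requirements on the period: the error must fit into the ball of the contraction,
  -- and the correction must stay below half of the tower.
  have hev1 : ∀ᶠ L in atTop, errScale n σ L < r / K / C :=
    hdec'.eventually_lt_const (by positivity)
  have hev2 : ∀ᶠ L in atTop, Real.exp (-(fowlerExp n σ * rateGain n σ * L)) < 1 / (2 * (K * C)) :=
    hdec.eventually_lt_const (by positivity)
  obtain ⟨L₂, hL₂⟩ := eventually_atTop.1 (hev1.and hev2)
  have key : ∀ L, max L₁ L₂ ≤ L → ∃ ψ : ℝ → ℝ, Continuous ψ ∧
      (∀ t, |ψ t| ≤ K * C * errScale n σ L) ∧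
      (∀ t, |ψ t| ≤ tower (fowlerExp n σ) 1 L t / 2) ∧
      ∀ t, solOp n σ L (fun τ => tower (fowlerExp n σ) 1 L τ + ψ τ) t =
        tower (fowlerExp n σ) 1 L t + ψ t := by
    intro L hL
    have hLL₁ : L₁ ≤ L := (le_max_left _ _).trans hL
    obtain ⟨hs1, hs2⟩ := hL₂ L ((le_max_right _ _).trans hL)
    have hL0 : 0 < L := by linarith
    obtain ⟨ψ, hψ, hb, heq⟩ := (hsol L hLL₁).1 (C * errScale n σ L)
      (by rw [lt_div_iff₀ hC] at hs1; linarith) (hres L (hL₁.trans hLL₁))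
    refine ⟨ψ, hψ, fun t => (hb t).trans (le_of_eq (by ring)), fun t => (hb t).trans ?_, heq⟩
    have hW := tower_one_pos hg hL0 t
    have h1 := errScale_le_tower hn hL0 t
    have h2 : K * (C * errScale n σ L) ≤ K * C * (1 / (2 * (K * C)) *
        tower (fowlerExp n σ) 1 L t) := by
      rw [← mul_assoc]
      refine mul_le_mul_of_nonneg_left (h1.trans ?_) (by positivity)
      exact mul_le_mul_of_nonneg_right hs2.le hW.le
    refine h2.trans (le_of_eq ?_)
    field_simp
  choose! ψ hψc hψb hψh hψe using key
  refine ⟨max L₁ L₂, hL₁.trans (le_max_left _ _), r, hr, D, hD, ψ, fun L hL => ?_⟩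
  have hLL₁ : L₁ ≤ L := (le_max_left _ _).trans hL
  have hL1 : 1 ≤ L := hL₁.trans hLL₁
  have hL0 : 0 < L := by linarith
  have hψr : ∀ t, |ψ L t| ≤ r := fun t => by
    have := (hL₂ L ((le_max_right _ _).trans hL)).1
    refine (hψb L hL t).trans ?_
    rw [lt_div_iff₀ hC, lt_div_iff₀ hK] at this
    linarith
  refine ⟨fun t => ?_, hψe L hL,
    fun j => (hreg j L hL1 _ (hψc L hL) (hψb L hL) (hψh L hL) (hψe L hL)).1,
    fun j => (hreg j L hL1 _ (hψc L hL) (hψb L hL) (hψh L hL) (hψe L hL)).2,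
    fun w hw hwr hwe t => ?_⟩
  · have h1 := (abs_le.1 (hψh L hL t)).1
    have h2 := tower_one_pos hg hL0 t
    linarith
  · have hWc := continuous_tower hg hL0
    have := (hsol L hLL₁).2 (fun t => w t - tower (fowlerExp n σ) 1 L t) (ψ L) (hw.sub hWc)
      (hψc L hL) hwr hψr (fun t => by simpa using hwe t) (hψe L hL)
    rw [← this]
    ring

end SolutionOperator

end Delaunay


/-! ### Hölder norms from bounds on derivatives -/

namespace Delaunay

open Set

section Holder

lemma abs_iteratedDeriv_sub_le {u : ℝ → ℝ} {k : ℕ} {M : ℝ} (hu : ContDiff ℝ (k + 1 : ℕ) u)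
    (hM : ∀ t, |iteratedDeriv (k + 1) u t| ≤ M) (t τ : ℝ) :
    |iteratedDeriv k u t - iteratedDeriv k u τ| ≤ M * |t - τ| := by
  have hd : ∀ x, HasDerivAt (iteratedDeriv k u) (iteratedDeriv (k + 1) u x) x := fun x => by
    rw [iteratedDeriv_succ]
    exact ((hu.differentiable_iteratedDeriv k (by exact_mod_cast Nat.lt_succ_self k)) x).hasDerivAt
  exact convex_univ.norm_image_sub_le_of_norm_hasDerivWithin_le (fun x _ => (hd x).hasDerivWithinAt)
    (fun x _ => hM x) (mem_univ τ) (mem_univ t)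

/-- For $|t-\tau|\le1$ use the mean value inequality, otherwise the sup bound. -/
lemma abs_iteratedDeriv_sub_le_rpow {u : ℝ → ℝ} {k : ℕ} {M α : ℝ} (hα0 : 0 ≤ α) (hα1 : α ≤ 1)
    (hu : ContDiff ℝ (k + 1 : ℕ) u) (hM : ∀ i ≤ k + 1, ∀ t, |iteratedDeriv i u t| ≤ M) {t τ : ℝ}
    (hne : t ≠ τ) : |iteratedDeriv k u t - iteratedDeriv k u τ| ≤ 2 * M * |t - τ| ^ α := by
  have hM0 : 0 ≤ M := (abs_nonneg _).trans (hM 0 (Nat.zero_le _) 0)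
  have hd : 0 < |t - τ| := abs_pos.2 (sub_ne_zero.2 hne)
  rcases le_total |t - τ| 1 with h | h
  · have h1 := abs_iteratedDeriv_sub_le hu (hM (k + 1) le_rfl) t τ
    have h2 : |t - τ| ≤ |t - τ| ^ α := by
      simpa using Real.rpow_le_rpow_of_exponent_ge hd h hα1
    have h3 := mul_le_mul_of_nonneg_left h2 hM0
    have h4 : 0 ≤ M * |t - τ| ^ α := by positivity
    linarith
  · have h1 : |iteratedDeriv k u t - iteratedDeriv k u τ| ≤ M + M :=
      (abs_sub _ _).trans (add_le_add (hM k (Nat.le_succ k) t) (hM k (Nat.le_succ k) τ))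
    have h2 : 1 ≤ |t - τ| ^ α := Real.one_le_rpow h hα0
    have h3 := mul_le_mul_of_nonneg_left h2 hM0
    linarith

lemma holderNorm_le {r M : ℝ} (hr : 0 ≤ r) {u : ℝ → ℝ} (hu : ContDiff ℝ (⌊r⌋₊ + 1 : ℕ) u)
    (hM : ∀ i ≤ ⌊r⌋₊ + 1, ∀ t, |iteratedDeriv i u t| ≤ M) :
    holderNorm r u ≤ ENNReal.ofReal ((⌊r⌋₊ + 3) * M) := by
  have hM0 : 0 ≤ M := (abs_nonneg _).trans (hM 0 (Nat.zero_le _) 0)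
  have h1 : ∑ l ∈ Finset.range (⌊r⌋₊ + 1), ⨆ t : ℝ, ‖iteratedDeriv l u t‖ₑ ≤
      ENNReal.ofReal ((⌊r⌋₊ + 1) * M) := by
    calc _ ≤ ∑ l ∈ Finset.range (⌊r⌋₊ + 1), ENNReal.ofReal M := by
          refine Finset.sum_le_sum fun l hl => iSup_le fun t => ?_
          rw [← ofReal_norm]
          exact ENNReal.ofReal_le_ofReal (hM l (Finset.mem_range.1 hl).le t)
      _ = _ := by
          rw [Finset.sum_const, Finset.card_range, nsmul_eq_mul, ENNReal.ofReal_mul (by positivity)]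
          congr 1
          rw [← Nat.cast_succ, ENNReal.ofReal_natCast]
  have h2 : ⨆ (t : ℝ) (τ : ℝ) (_ : t ≠ τ),
      ‖iteratedDeriv ⌊r⌋₊ u t - iteratedDeriv ⌊r⌋₊ u τ‖ₑ /
        ENNReal.ofReal (|t - τ| ^ (r - (⌊r⌋₊ : ℝ))) ≤ ENNReal.ofReal (2 * M) := by
    refine iSup_le fun t => iSup_le fun τ => iSup_le fun hne => ?_
    have hd : 0 < |t - τ| := abs_pos.2 (sub_ne_zero.2 hne)
    rw [← ofReal_norm, ← ENNReal.ofReal_div_of_pos (by positivity)]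
    refine ENNReal.ofReal_le_ofReal ?_
    rw [div_le_iff₀ (by positivity)]
    exact abs_iteratedDeriv_sub_le_rpow (sub_nonneg.2 (Nat.floor_le hr))
      (by linarith [Nat.lt_floor_add_one r]) hu hM hne
  calc holderNorm r u ≤ ENNReal.ofReal ((⌊r⌋₊ + 1) * M) + ENNReal.ofReal (2 * M) := add_le_add h1 h2
    _ = _ := by
      rw [← ENNReal.ofReal_add (by positivity) (by positivity)]
      congr 1
      ring

lemma exists_abs_iteratedDeriv_le_of_periodic {L : ℝ} (hL : 0 < L) {u : ℝ → ℝ}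
    (hper : Function.Periodic u (2 * L)) (k : ℕ) (hu : ContDiff ℝ k u) :
    ∃ M, ∀ i ≤ k, ∀ t, |iteratedDeriv i u t| ≤ M := by
  have h : ∀ i : Fin (k + 1), ∃ M, ∀ t, |iteratedDeriv (i : ℕ) u t| ≤ M := fun i =>
    exists_abs_le_of_periodic hL
      (hu.continuous_iteratedDeriv i (by exact_mod_cast Nat.lt_succ_iff.1 i.2))
      (hper.iteratedDeriv i)
  choose M hM using h
  refine ⟨∑ i, |M i|, fun i hi t => ?_⟩
  refine (hM ⟨i, Nat.lt_succ_iff.2 hi⟩ t).trans ((le_abs_self _).trans ?_)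
  exact Finset.single_le_sum (f := fun i => |M i|) (fun j _ => abs_nonneg _) (Finset.mem_univ _)

lemma memHolder_of_periodic {r L : ℝ} (hr : 0 ≤ r) (hL : 0 < L) {u : ℝ → ℝ}
    (hper : Function.Periodic u (2 * L)) (hu : ContDiff ℝ (⌊r⌋₊ + 1 : ℕ) u) : MemHolder r u := by
  obtain ⟨M, hM⟩ := exists_abs_iteratedDeriv_le_of_periodic hL hper _ hu
  exact ⟨hu.of_le (by exact_mod_cast Nat.le_succ _),
    (holderNorm_le hr hu hM).trans_lt ENNReal.ofReal_lt_top⟩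

end Holder

/-! ### The kernel of the fractional Laplacian -/

section FractionalKernel

variable {n : ℕ} {σ s L : ℝ}

lemma sq_div_two_le_cosh_sub_one (r : ℝ) : r ^ 2 / 2 ≤ Real.cosh r - 1 := by
  have h1 : Real.cosh r = 1 + 2 * Real.sinh (r / 2) ^ 2 := by
    have := Real.cosh_two_mul (r / 2)
    rw [Real.cosh_sq, mul_div_cancel₀ _ (two_ne_zero' ℝ)] at this
    linarith
  have h2 : |r / 2| ≤ |Real.sinh (r / 2)| := by
    rw [Real.abs_sinh]
    exact Real.self_le_sinh_iff.2 (abs_nonneg _)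
  have h3 := sq_le_sq.2 h2
  nlinarith

lemma integral_sub_rpow_le {c e : ℝ} (hc : 1 < c) (he : e ≤ -(3 / 2)) :
    ∫ ζ in (-1 : ℝ)..1, (c - ζ) ^ e ≤ 2 * (c - 1) ^ (e + 1) := by
  rw [intervalIntegral.integral_comp_sub_left (fun x => x ^ e) c, integral_rpow (Or.inr
    ⟨by linarith, by rw [uIcc_of_le (by linarith)]; exact fun h => by linarith [h.1]⟩)]
  have h1 : 0 < (c - 1) ^ (e + 1) := Real.rpow_pos_of_pos (by linarith) _
  have h2 : 0 < (c - -1) ^ (e + 1) := Real.rpow_pos_of_pos (by linarith) _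
  rw [div_le_iff_of_neg (by linarith)]
  nlinarith

/-- Bounding $1-\zeta^2$ by $2(\cosh r-\zeta)$ reduces the integrand to a multiple of $(\cosh
r-\zeta)^{-3/2-s}$. It is integrated exactly, and $\cosh r-1\ge r^2/2$ finishes. -/
lemma abs_angularKernel_le (hn : (3 : ℝ) ≤ n) (hs : 0 ≤ s) {r : ℝ} (hr : r ≠ 0) :
    |∫ ζ in (-1 : ℝ)..1, (1 - ζ ^ 2) ^ (((n : ℝ) - 3) / 2) *
      |Real.cosh r - ζ| ^ (-fowlerExpDual n s)| ≤
      2 ^ (((n : ℝ) - 3) / 2) * (2 * (2 ^ (1 / 2 + s) * |r| ^ (-1 - 2 * s))) := by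
  set b := ((n : ℝ) - 3) / 2 with hb
  have hb0 : 0 ≤ b := by rw [hb]; linarith
  set c := Real.cosh r with hc
  have hr2 : 0 < r ^ 2 := by positivity
  have hc1 := sq_div_two_le_cosh_sub_one r
  have hc' : 1 < c := by linarith
  have he : b + -fowlerExpDual n s = -(3 / 2) - s := by rw [hb, fowlerExpDual]; ring
  have hcont : ContinuousOn (fun ζ : ℝ => 2 ^ b * (c - ζ) ^ (-(3 / 2) - s)) (uIcc (-1) 1) := by
    refine continuousOn_const.mul (ContinuousOn.rpow_const (by fun_prop) fun ζ hζ => Or.inl ?_)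
    rw [uIcc_of_le (by norm_num)] at hζ
    linarith [hζ.2]
  have h1 : |∫ ζ in (-1 : ℝ)..1, (1 - ζ ^ 2) ^ b * |c - ζ| ^ (-fowlerExpDual n s)| ≤
      ∫ ζ in (-1 : ℝ)..1, 2 ^ b * (c - ζ) ^ (-(3 / 2) - s) := by
    rw [← Real.norm_eq_abs]
    refine intervalIntegral.norm_integral_le_of_norm_le (by norm_num) (.of_forall fun ζ hζ => ?_)
      hcont.intervalIntegrable
    have p1 : 0 < c - ζ := by linarith [hζ.2]
    have p2 : 0 ≤ 1 - ζ ^ 2 := by nlinarith [hζ.1, hζ.2]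
    rw [norm_mul, Real.norm_of_nonneg (by positivity), Real.norm_of_nonneg (by positivity),
      abs_of_pos p1, ← he, Real.rpow_add p1, ← mul_assoc, ← Real.mul_rpow (by norm_num) p1.le]
    refine mul_le_mul_of_nonneg_right (Real.rpow_le_rpow p2 ?_ hb0) (by positivity)
    nlinarith [hζ.1, hζ.2]
  refine h1.trans ?_
  rw [intervalIntegral.integral_const_mul]
  refine mul_le_mul_of_nonneg_left ?_ (by positivity)
  refine (integral_sub_rpow_le hc' (by linarith)).trans ?_
  refine mul_le_mul_of_nonneg_left ?_ (by norm_num)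
  calc (c - 1) ^ (-(3 / 2) - s + 1) ≤ (r ^ 2 / 2) ^ (-(3 / 2) - s + 1) :=
        Real.rpow_le_rpow_of_nonpos (by positivity) hc1 (by linarith)
    _ = 2 ^ (1 / 2 + s) * |r| ^ (-1 - 2 * s) := by
        rw [← sq_abs, Real.div_rpow (by positivity) (by norm_num), ← Real.rpow_natCast |r| 2,
          ← Real.rpow_mul (abs_nonneg r), show -(3 / 2) - s + 1 = -(1 / 2 + s) by ring,
          Real.rpow_neg (by norm_num : (0 : ℝ) ≤ 2), div_inv_eq_mul, mul_comm]
        congr 2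
        push_cast
        ring

lemma exists_fracKernel_le (hn : (3 : ℝ) ≤ n) (hs : 0 ≤ s) :
    ∃ C, 0 ≤ C ∧ ∀ r, r ≠ 0 → fracKernel n s r ≤ C * |r| ^ (-1 - 2 * s) := by
  refine ⟨|fracConst n s * ((2 : ℝ) ^ (-fowlerExpDual n s) * sphereArea n)| *
    (2 ^ (((n : ℝ) - 3) / 2) * (2 * 2 ^ (1 / 2 + s))), by positivity, fun r hr => ?_⟩
  have h := abs_angularKernel_le hn hs hr
  rw [fracKernel, angularKernel, ← mul_assoc]
  refine (le_abs_self _).trans ?_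
  rw [abs_mul]
  refine (mul_le_mul_of_nonneg_left h (abs_nonneg _)).trans (le_of_eq ?_)
  ring

lemma integrable_of_even {f : ℝ → ℝ} (hf : ∀ t, f (-t) = f t) (h : IntegrableOn f (Ioi 0)) :
    Integrable f := by
  have h2 : IntegrableOn f (Iio 0) := by
    have := h.comp_neg
    simpa [hf] using this
  rw [← integrableOn_univ, ← Iio_union_Ici (a := (0 : ℝ)), integrableOn_union,
    integrableOn_Ici_iff_integrableOn_Ioi]
  exact ⟨h2, h⟩

lemma integrable_min_sq_mul_rpow (hs0 : 0 < s) (hs1 : s < 1) :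
    Integrable fun r : ℝ => min 4 (r ^ 2) * |r| ^ (-1 - 2 * s) := by
  have hmeas : Measurable fun r : ℝ => min 4 (r ^ 2) * |r| ^ (-1 - 2 * s) := by fun_prop
  refine integrable_of_even (fun r => by simp only [abs_neg, neg_sq]) ?_
  rw [← Ioc_union_Ioi_eq_Ioi (zero_le_one (α := ℝ)), integrableOn_union]
  constructor
  · have h1 : IntegrableOn (fun r : ℝ => r ^ (1 - 2 * s)) (Ioc 0 1) :=
      (intervalIntegrable_iff_integrableOn_Ioc_of_le zero_le_one).1
        (intervalIntegral.intervalIntegrable_rpow' (by linarith))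
    refine h1.mono' hmeas.aestronglyMeasurable ?_
    filter_upwards [ae_restrict_mem measurableSet_Ioc] with r hr
    rw [abs_of_pos hr.1, Real.norm_of_nonneg (mul_nonneg (by positivity)
      (Real.rpow_nonneg hr.1.le _))]
    have e : r ^ (1 - 2 * s) = r ^ 2 * r ^ (-1 - 2 * s) := by
      rw [← Real.rpow_natCast r 2, ← Real.rpow_add hr.1]
      congr 1
      push_cast
      ring
    rw [e]
    exact mul_le_mul_of_nonneg_right (min_le_right _ _) (Real.rpow_nonneg hr.1.le _)
  · have h1 : IntegrableOn (fun r : ℝ => 4 * r ^ (-1 - 2 * s)) (Ioi 1) :=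
      (integrableOn_Ioi_rpow_of_lt (by linarith) one_pos).const_mul 4
    refine h1.mono' hmeas.aestronglyMeasurable ?_
    filter_upwards [ae_restrict_mem measurableSet_Ioi] with r hr
    have hr0 : 0 < r := one_pos.trans hr
    rw [abs_of_pos hr0, Real.norm_of_nonneg (mul_nonneg (by positivity)
      (Real.rpow_nonneg hr0.le _))]
    exact mul_le_mul_of_nonneg_right (min_le_left _ _) (Real.rpow_nonneg hr0.le _)

/-- This is the integrability condition of a Lévy kernel, against $\min(4,r^2)$: with
$K\lesssim|r|^{-1-2s}$ it needs $s<1$ at the origin and $s>0$ at infinity. At $s=0$ the kernel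
vanishes. -/
lemma exists_fracKernel_majorant (hn : (3 : ℝ) ≤ n) (hs0 : 0 ≤ s) (hs1 : s < 1) :
    ∃ h : ℝ → ℝ≥0∞, Measurable h ∧ ∫⁻ r, h r < ∞ ∧
      ∀ r, ENNReal.ofReal (min 4 (r ^ 2)) * ENNReal.ofReal (fracKernel n s r) ≤ h r := by
  rcases hs0.eq_or_lt with rfl | hs
  · refine ⟨fun _ => 0, measurable_const, by simp, fun r => ?_⟩
    simp [fracKernel, fracConst]
  · obtain ⟨C, hC, hb⟩ := exists_fracKernel_le hn hs0
    have hi := (integrable_min_sq_mul_rpow hs hs1).const_mul C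
    refine ⟨fun r => ENNReal.ofReal (C * (min 4 (r ^ 2) * |r| ^ (-1 - 2 * s))), by fun_prop,
      ?_, fun r => ?_⟩
    · exact (lintegral_ofReal_le_lintegral_enorm _).trans_lt hi.2
    · rcases eq_or_ne r 0 with rfl | hr
      · simp
      · rw [← ENNReal.ofReal_mul (by positivity)]
        refine ENNReal.ofReal_le_ofReal ?_
        have := mul_le_mul_of_nonneg_left (hb r hr) (show 0 ≤ min 4 (r ^ 2) by positivity)
        linarith

lemma tsum_lintegral_shift (hL : 0 < L) (h : ℝ → ℝ≥0∞) (t : ℝ) :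
    ∑' j : ℤ, ∫⁻ τ in Ioo (-L) L, h (t - τ - 2 * (j : ℝ) * L) = ∫⁻ r, h r := by
  have hp : 0 < 2 * L := by linarith
  have e : ∀ j : ℤ, ∫⁻ τ in Ioo (-L) L, h (t - τ - 2 * (j : ℝ) * L) =
      ∫⁻ τ in Ioc (-L + j • (2 * L)) (-L + (j + 1) • (2 * L)), h (t - τ) := by
    intro j
    have e1 : -L + j • (2 * L) = -L + 2 * (j : ℝ) * L := by simp; ring
    have e2 : -L + (j + 1) • (2 * L) = L + 2 * (j : ℝ) * L := by simp; ring
    have h1 := (measurePreserving_add_right volume (2 * (j : ℝ) * L)).setLIntegral_comp_preimage_emb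
      (measurableEmbedding_addRight _) (fun τ => h (t - τ))
      (Ioc (-L + 2 * (j : ℝ) * L) (L + 2 * (j : ℝ) * L))
    rw [preimage_add_const_Ioc, add_sub_cancel_right, add_sub_cancel_right] at h1
    rw [e1, e2, ← h1, setLIntegral_congr Ioo_ae_eq_Ioc]
    simp only [sub_sub]
  simp only [e]
  rw [← lintegral_iUnion (fun _ => measurableSet_Ioc) (pairwise_disjoint_Ioc_add_zsmul (-L) (2 * L)),
    iUnion_Ioc_add_zsmul hp, Measure.restrict_univ, lintegral_sub_left_eq_self (fun r => h r) t]

end FractionalKernel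

/-! ### The Sobolev norm, uniformly in the period -/

section Sobolev

variable {n : ℕ} {σ : ℝ}

/-- By periodicity, in the $j$-th term $D(\tau)$ may be replaced by $D(\tau+2jL)$. The increment
then matches the argument of the kernel, and the Lipschitz bound cancels the singularity of every
translate. -/
lemma enorm_sub_sq_mul_fracKernelPer_le {s L M : ℝ} {h : ℝ → ℝ≥0∞}
    (hh : ∀ r, ENNReal.ofReal (min 4 (r ^ 2)) * ENNReal.ofReal (fracKernel n s r) ≤ h r)
    {D : ℝ → ℝ} (hper : Function.Periodic D (2 * L)) (hM : ∀ t, |D t| ≤ M)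
    (hlip : ∀ t τ, |D t - D τ| ≤ M * |t - τ|) (t τ : ℝ) :
    ‖D t - D τ‖ₑ ^ 2 * fracKernelPer n s L (t - τ) ≤
      ∑' j : ℤ, ENNReal.ofReal (M ^ 2) * h (t - τ - 2 * (j : ℝ) * L) := by
  have hM0 : 0 ≤ M := (abs_nonneg _).trans (hM 0)
  rw [fracKernelPer, ← ENNReal.tsum_mul_left]
  refine ENNReal.tsum_le_tsum fun j => ?_
  have e : D τ = D (τ + 2 * (j : ℝ) * L) := by
    rw [← hper.sub_two_mul_int (τ + 2 * (j : ℝ) * L) j]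
    congr 1
    ring
  have h1 : (D t - D τ) ^ 2 ≤ M ^ 2 * min 4 ((t - τ - 2 * (j : ℝ) * L) ^ 2) := by
    rw [mul_min_of_nonneg _ _ (sq_nonneg M), le_min_iff]
    constructor
    · have : |D t - D τ| ≤ |2 * M| := by
        rw [abs_of_nonneg (show 0 ≤ 2 * M by linarith)]
        refine (abs_sub _ _).trans ?_
        linarith [hM t, hM τ]
      have := sq_le_sq.2 this
      linarith
    · have h2 := hlip t (τ + 2 * (j : ℝ) * L)
      rw [← e, show t - (τ + 2 * (j : ℝ) * L) = t - τ - 2 * (j : ℝ) * L by ring] at h2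
      rw [← mul_pow]
      refine sq_le_sq.2 ?_
      rwa [abs_mul, abs_of_nonneg hM0]
  calc ‖D t - D τ‖ₑ ^ 2 * ENNReal.ofReal (fracKernel n s (t - τ - 2 * (j : ℝ) * L))
      ≤ ENNReal.ofReal (M ^ 2 * min 4 ((t - τ - 2 * (j : ℝ) * L) ^ 2)) *
        ENNReal.ofReal (fracKernel n s (t - τ - 2 * (j : ℝ) * L)) := by
        refine mul_le_mul_left ?_ _
        rw [← ofReal_norm, ← ENNReal.ofReal_pow (norm_nonneg _), Real.norm_eq_abs, sq_abs]
        exact ENNReal.ofReal_le_ofReal h1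
    _ = ENNReal.ofReal (M ^ 2) * (ENNReal.ofReal (min 4 ((t - τ - 2 * (j : ℝ) * L) ^ 2)) *
        ENNReal.ofReal (fracKernel n s (t - τ - 2 * (j : ℝ) * L))) := by
        rw [ENNReal.ofReal_mul (sq_nonneg M), mul_assoc]
    _ ≤ _ := mul_le_mul_right (hh _) _

/-- The only dependence on the period is the square root of the length of the interval, which the
exponential smallness of the correction absorbs. -/
lemma exists_sobolevNorm_le (hσ : 1 < σ) (hn : 2 * σ < n) :
    ∃ C, 0 < C ∧ ∀ L, 0 < L → ∀ (u : ℝ → ℝ) (M : ℝ), Function.Periodic u (2 * L) →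
      ContDiff ℝ (⌊σ⌋₊ + 1 : ℕ) u → (∀ i ≤ ⌊σ⌋₊ + 1, ∀ t, |iteratedDeriv i u t| ≤ M) →
      sobolevNorm n σ L u ≤ ENNReal.ofReal (C * L ^ (1 / 2 : ℝ) * M) := by
  have h3 := three_le_dim hσ hn
  obtain ⟨h, hmeas, hfin, hh⟩ := exists_fracKernel_majorant h3
    (sub_nonneg.2 (Nat.floor_le (by linarith : 0 ≤ σ)))
    (by linarith [Nat.lt_floor_add_one σ] : σ - (⌊σ⌋₊ : ℝ) < 1)
  set A := (∫⁻ r, h r).toReal with hA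
  have hA0 : 0 ≤ A := ENNReal.toReal_nonneg
  set Q := 2 * ((⌊σ⌋₊ + 1 : ℝ) + A) with hQ
  have hQ0 : 0 < Q := by positivity
  refine ⟨Q ^ (1 / 2 : ℝ), by positivity, fun L hL u M hper hu hM => ?_⟩
  have hM0 : 0 ≤ M := (abs_nonneg _).trans (hM 0 (Nat.zero_le _) 0)
  have hvol : ∀ c : ℝ≥0∞, ∫⁻ _ in Ioo (-L) L, c = c * ENNReal.ofReal (2 * L) := fun c => by
    rw [lintegral_const, Measure.restrict_apply_univ, Real.volume_Ioo]
    congr 2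
    ring
  have h1 : ∑ l ∈ Finset.range (⌊σ⌋₊ + 1), ∫⁻ t in Ioo (-L) L, ‖iteratedDeriv l u t‖ₑ ^ 2 ≤
      ENNReal.ofReal ((⌊σ⌋₊ + 1) * (M ^ 2 * (2 * L))) := by
    calc _ ≤ ∑ l ∈ Finset.range (⌊σ⌋₊ + 1), ENNReal.ofReal (M ^ 2 * (2 * L)) := by
          refine Finset.sum_le_sum fun l hl => ?_
          rw [ENNReal.ofReal_mul (sq_nonneg M), ← hvol]
          refine lintegral_mono fun t => ?_
          rw [← ofReal_norm, ← ENNReal.ofReal_pow (norm_nonneg _)]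
          exact ENNReal.ofReal_le_ofReal
            (pow_le_pow_left₀ (norm_nonneg _) (hM l (Finset.mem_range.1 hl).le t) 2)
      _ = _ := by
          rw [Finset.sum_const, Finset.card_range, nsmul_eq_mul,
            ENNReal.ofReal_mul (p := (⌊σ⌋₊ + 1 : ℝ)) (by positivity)]
          congr 1
          rw [← Nat.cast_succ, ENNReal.ofReal_natCast]
  have h2 : ∫⁻ t in Ioo (-L) L, ∫⁻ τ in Ioo (-L) L,
      ‖iteratedDeriv ⌊σ⌋₊ u t - iteratedDeriv ⌊σ⌋₊ u τ‖ₑ ^ 2 *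
        fracKernelPer n (σ - (⌊σ⌋₊ : ℝ)) L (t - τ) ≤ ENNReal.ofReal (A * (M ^ 2 * (2 * L))) := by
    calc _ ≤ ∫⁻ _ in Ioo (-L) L, ENNReal.ofReal (M ^ 2) * ∫⁻ r, h r := by
          refine lintegral_mono fun t => ?_
          rw [← tsum_lintegral_shift hL h t, ← ENNReal.tsum_mul_left]
          calc _ ≤ ∫⁻ τ in Ioo (-L) L,
                ∑' j : ℤ, ENNReal.ofReal (M ^ 2) * h (t - τ - 2 * (j : ℝ) * L) :=
                lintegral_mono fun τ => enorm_sub_sq_mul_fracKernelPer_le hh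
                  (hper.iteratedDeriv _) (hM _ (Nat.le_succ _))
                  (abs_iteratedDeriv_sub_le hu (hM _ le_rfl)) t τ
            _ = ∑' j : ℤ, ∫⁻ τ in Ioo (-L) L,
                ENNReal.ofReal (M ^ 2) * h (t - τ - 2 * (j : ℝ) * L) :=
                lintegral_tsum fun j => Measurable.aemeasurable (by fun_prop)
            _ = _ := by
                refine tsum_congr fun j => ?_
                rw [lintegral_const_mul _ (by fun_prop)]
      _ = _ := by
          rw [hvol, ← ENNReal.ofReal_toReal hfin.ne, ← hA, ← ENNReal.ofReal_mul (sq_nonneg M),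
            ← ENNReal.ofReal_mul (by positivity)]
          congr 1
          ring
  unfold sobolevNorm
  calc _ ≤ (ENNReal.ofReal ((⌊σ⌋₊ + 1) * (M ^ 2 * (2 * L))) +
        ENNReal.ofReal (A * (M ^ 2 * (2 * L)))) ^ (1 / 2 : ℝ) :=
        ENNReal.rpow_le_rpow (add_le_add h1 h2) (by norm_num)
    _ = ENNReal.ofReal (Q ^ (1 / 2 : ℝ) * L ^ (1 / 2 : ℝ) * M) := by
        rw [← ENNReal.ofReal_add (by positivity) (by positivity),
          ENNReal.ofReal_rpow_of_nonneg (by positivity) (by norm_num)]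
        congr 1
        rw [show (⌊σ⌋₊ + 1 : ℝ) * (M ^ 2 * (2 * L)) + A * (M ^ 2 * (2 * L)) = Q * L * M ^ 2 by
          rw [hQ]; ring, Real.mul_rpow (by positivity) (by positivity),
          Real.mul_rpow hQ0.le hL.le, ← Real.rpow_natCast M 2, ← Real.rpow_mul hM0]
        norm_num

lemma memSobolev_of_contDiff (hσ : 1 < σ) (hn : 2 * σ < n) {L : ℝ} (hL : 0 < L) {u : ℝ → ℝ}
    (hper : Function.Periodic u (2 * L)) (hu : ∀ j : ℕ, ContDiff ℝ j u) : MemSobolev n σ L u := by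
  obtain ⟨C, -, h⟩ := exists_sobolevNorm_le hσ hn
  obtain ⟨M, hM⟩ := exists_abs_iteratedDeriv_le_of_periodic hL hper (⌊σ⌋₊ + 1) (hu _)
  exact ⟨memHolder_of_periodic (by linarith) hL hper (hu _), hper,
    (h L hL u M hper (hu _) hM).trans_lt ENNReal.ofReal_lt_top⟩

/-- The Sobolev embedding, uniformly in the period. -/
lemma abs_le_of_sobolevNorm_lt (hσ : 1 < σ) {L δ : ℝ} (hL : 1 ≤ L) (hδ : 0 < δ) {u : ℝ → ℝ}
    (hper : Function.Periodic u (2 * L)) (hu : ContDiff ℝ 1 u)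
    (h : sobolevNorm n σ L u < ENNReal.ofReal δ) (t : ℝ) : |u t| ≤ 2 * δ := by
  have hL0 : 0 < L := by linarith
  have huc := hu.continuous
  have hdc := hu.continuous_deriv le_rfl
  have hder : ∀ x, HasDerivAt u (deriv u x) x := fun x =>
    (hu.differentiable (by norm_num) x).hasDerivAt
  have hcq : Continuous fun x => u x ^ 2 + deriv u x ^ 2 := by fun_prop
  set A := ∫ x in (-L)..L, (u x ^ 2 + deriv u x ^ 2) with hA
  have hm : 1 ≤ ⌊σ⌋₊ := Nat.le_floor (by exact_mod_cast hσ.le)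
  have hAle : A ≤ δ ^ 2 := by
    have e1 : ENNReal.ofReal A = ∫⁻ x in Ioo (-L) L, ENNReal.ofReal (u x ^ 2 + deriv u x ^ 2) := by
      rw [hA, intervalIntegral.integral_of_le (by linarith), integral_Ioc_eq_integral_Ioo]
      exact ofReal_integral_eq_lintegral_ofReal
        ((hcq.integrableOn_Icc (a := -L) (b := L)).mono_set Ioo_subset_Icc_self)
        (.of_forall fun x => by positivity)
    have e2 : ∫⁻ x in Ioo (-L) L, ENNReal.ofReal (u x ^ 2 + deriv u x ^ 2) =
        ∑ l ∈ Finset.range 2, ∫⁻ x in Ioo (-L) L, ‖iteratedDeriv l u x‖ₑ ^ 2 := by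
      rw [Finset.sum_range_succ, Finset.sum_range_one, ← lintegral_add_left
        (by simpa using (huc.measurable.enorm.pow_const 2))]
      refine lintegral_congr fun x => ?_
      rw [ENNReal.ofReal_add (sq_nonneg _) (sq_nonneg _), iteratedDeriv_zero, iteratedDeriv_one,
        ← ofReal_norm, ← ofReal_norm, ← ENNReal.ofReal_pow (norm_nonneg _),
        ← ENNReal.ofReal_pow (norm_nonneg _), Real.norm_eq_abs, Real.norm_eq_abs, sq_abs, sq_abs]
    have e3 : ∑ l ∈ Finset.range 2, ∫⁻ x in Ioo (-L) L, ‖iteratedDeriv l u x‖ₑ ^ 2 ≤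
        sobolevNorm n σ L u ^ 2 := by
      rw [sobolevNorm, ← ENNReal.rpow_natCast, ← ENNReal.rpow_mul]
      norm_num
      refine le_add_right (Finset.sum_le_sum_of_subset ?_)
      intro l hl
      rw [Finset.mem_range] at hl ⊢
      omega
    have e4 : ENNReal.ofReal A ≤ ENNReal.ofReal (δ ^ 2) := by
      rw [e1, e2, ENNReal.ofReal_pow hδ.le]
      exact e3.trans (pow_le_pow_left' h.le 2)
    exact (ENNReal.ofReal_le_ofReal_iff (by positivity)).1 e4
  have hA0 : 0 ≤ A := intervalIntegral.integral_nonneg (by linarith) fun x _ => by positivity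
  -- From $u(x)^2-u(y)^2=\int_y^x2uu'\le\int_{-L}^{L}(u^2+u'^2)$.
  have key : ∀ x ∈ Icc (-L) L, ∀ y ∈ Icc (-L) L, u x ^ 2 ≤ u y ^ 2 + A := by
    intro x hx y hy
    have hc2 : Continuous fun z => 2 * u z * deriv u z := by fun_prop
    have f1 : ∫ z in y..x, 2 * u z * deriv u z = u x ^ 2 - u y ^ 2 := by
      refine intervalIntegral.integral_eq_sub_of_hasDerivAt (f := fun z => u z ^ 2) (fun z _ => ?_)
        (hc2.intervalIntegrable _ _)
      refine ((hder z).pow 2).congr_deriv ?_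
      simp
    have f2 : |∫ z in y..x, 2 * u z * deriv u z| ≤ |∫ z in y..x, (u z ^ 2 + deriv u z ^ 2)| := by
      rw [← Real.norm_eq_abs]
      refine intervalIntegral.norm_integral_le_abs_of_norm_le (.of_forall fun z => ?_)
        (hcq.intervalIntegrable _ _)
      rw [Real.norm_eq_abs, abs_le]
      constructor <;> nlinarith [sq_nonneg (u z + deriv u z), sq_nonneg (u z - deriv u z)]
    have f3 : |∫ z in y..x, (u z ^ 2 + deriv u z ^ 2)| ≤ A := by
      have hnn : ∀ z, 0 ≤ u z ^ 2 + deriv u z ^ 2 := fun z => by positivity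
      have mono : ∀ a b, -L ≤ a → a ≤ b → b ≤ L → |∫ z in a..b, (u z ^ 2 + deriv u z ^ 2)| ≤ A := by
        intro a b ha hab hb
        rw [abs_of_nonneg (intervalIntegral.integral_nonneg hab fun z _ => hnn z)]
        exact intervalIntegral.integral_mono_interval ha hab hb (.of_forall hnn)
          (hcq.intervalIntegrable _ _)
      rcases le_total y x with hxy | hxy
      · exact mono y x hy.1 hxy hx.2
      · rw [intervalIntegral.integral_symm, abs_neg]
        exact mono x y hx.1 hxy hy.2
    have f4 := (le_abs_self _).trans (f2.trans f3)
    rw [f1] at f4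
    linarith
  -- Averaging over $y$ gives $u(x)^2\le A/(2L)+A\le2A$, as $L\ge1$.
  have main : ∀ x ∈ Icc (-L) L, u x ^ 2 ≤ 2 * A := by
    intro x hx
    have g1 : ∫ y in (-L)..L, u x ^ 2 ≤ ∫ y in (-L)..L, (u y ^ 2 + deriv u y ^ 2 + A) := by
      refine intervalIntegral.integral_mono_on (by linarith) (by simp)
        ((hcq.add continuous_const).intervalIntegrable _ _) fun y hy => ?_
      have := key x hx y hy
      nlinarith [sq_nonneg (deriv u y)]
    rw [intervalIntegral.integral_add (hcq.intervalIntegrable _ _) (by simp), ← hA,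
      intervalIntegral.integral_const, intervalIntegral.integral_const, smul_eq_mul,
      smul_eq_mul] at g1
    nlinarith
  obtain ⟨j, hj⟩ := exists_abs_sub_period_le hL0 t
  rw [← hper.sub_two_mul_int t j]
  have h5 := main _ (mem_Icc.2 (abs_le.1 hj))
  refine abs_le_of_sq_le_sq ?_ (by linarith)
  nlinarith

end Sobolev

end Delaunay


/-! ### Equivalence of the two problems with the fixed-point equation -/

namespace Delaunay

open Set

section Solutions

variable {n : ℕ} {σ L : ℝ}

/-- An odd-order derivative of an even function is odd, while periodicity makes its values at $-L$
and $L$ agree; hence both vanish. -/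
lemma iteratedDeriv_eq_zero_of_even {u : ℝ → ℝ} (heven : ∀ t, u (-t) = u t)
    (hper : Function.Periodic u (2 * L)) {l : ℕ} (hl : Odd l) :
    iteratedDeriv l u (-L) = 0 ∧ iteratedDeriv l u L = 0 := by
  have h1 := iteratedDeriv_comp_neg l u L
  rw [show (fun x => u (-x)) = u from funext heven, hl.neg_one_pow, smul_eq_mul] at h1
  have h2 := hper.iteratedDeriv l (-L)
  rw [show -L + 2 * L = L by ring] at h2
  constructor <;> linarith

lemma IsAdmissible.contDiff_one (hσ : 1 < σ) {w : ℝ → ℝ} (hw : IsAdmissible n σ L w) :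
    ContDiff ℝ 1 w := by
  refine hw.1.1.1.of_le ?_
  have : 1 ≤ ⌊2 * σ⌋₊ := Nat.le_floor (by push_cast; linarith)
  exact_mod_cast this

lemma IsCylindricalSolution.solOp_eq (hσ : 1 < σ) (hn : 2 * σ < n) (hL : 0 < L) {w : ℝ → ℝ}
    (hw : IsCylindricalSolution n σ L w) (t : ℝ) : solOp n σ L w t = w t := by
  rw [solOp_eq_lineConv hσ hn hL (hw.1.contDiff_one hσ).continuous hw.1.2.2 hw.1.1.2.1, hw.2 t]
  rfl

/-- The equation on the open interval extends to its closure by continuity, then to the line by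
periodicity. -/
lemma IsBoundaryValueSolution.solOp_eq (hσ : 1 < σ) (hn : 2 * σ < n) (hL : 0 < L) {w : ℝ → ℝ}
    (hw : IsBoundaryValueSolution n σ L w) (t : ℝ) : solOp n σ L w t = w t := by
  have hc := (hw.1.contDiff_one hσ).continuous
  have h1 : EqOn (solOp n σ L w) w (Ioo (-L) L) := fun x hx => by
    rw [solOp_eq_intervalIntegral hσ hn hL hc hw.1.2.2, hw.2.1 x hx]
  have h2 := h1.closure (continuous_solOp hσ hn hL hc) hc
  rw [closure_Ioo (by linarith)] at h2
  obtain ⟨j, hj⟩ := exists_abs_sub_period_le hL t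
  rw [← (solOp_periodic w).sub_two_mul_int t j, ← hw.1.1.2.1.sub_two_mul_int t j]
  exact h2 (mem_Icc.2 (abs_le.1 hj))

variable {w : ℝ → ℝ}

lemma isAdmissible_of_solOp_eq (hσ : 1 < σ) (hn : 2 * σ < n) (hL : 0 < L)
    (hpos : ∀ t, 0 < w t) (hsm : ∀ j : ℕ, ContDiff ℝ j w) (heq : ∀ t, solOp n σ L w t = w t) :
    IsAdmissible n σ L w := by
  have hper : Function.Periodic w (2 * L) := fun t => by
    rw [← heq, ← heq, solOp_periodic]
  exact ⟨memSobolev_of_contDiff hσ hn hL hper hsm, hpos, fun t => by rw [← heq, ← heq, solOp_neg]⟩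

lemma isCylindricalSolution_of_solOp_eq (hσ : 1 < σ) (hn : 2 * σ < n) (hL : 0 < L)
    (hpos : ∀ t, 0 < w t) (hsm : ∀ j : ℕ, ContDiff ℝ j w) (heq : ∀ t, solOp n σ L w t = w t) :
    IsCylindricalSolution n σ L w := by
  have hadm := isAdmissible_of_solOp_eq hσ hn hL hpos hsm heq
  refine ⟨hadm, fun t => ?_⟩
  rw [← heq, solOp_eq_lineConv hσ hn hL (hsm 0).continuous hadm.2.2 hadm.1.2.1]
  rfl

lemma isBoundaryValueSolution_of_solOp_eq (hσ : 1 < σ) (hn : 2 * σ < n) (hL : 0 < L)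
    (hpos : ∀ t, 0 < w t) (hsm : ∀ j : ℕ, ContDiff ℝ j w) (heq : ∀ t, solOp n σ L w t = w t) :
    IsBoundaryValueSolution n σ L w := by
  have hadm := isAdmissible_of_solOp_eq hσ hn hL hpos hsm heq
  refine ⟨hadm, fun t _ => ?_, fun l hl _ => iteratedDeriv_eq_zero_of_even hadm.2.2 hadm.1.2.1 hl⟩
  rw [← heq, solOp_eq_intervalIntegral hσ hn hL (hsm 0).continuous hadm.2.2]

lemma tendsto_rpow_mul_errScale (hσ : 1 < σ) (hn : 2 * σ < n) (K : ℝ) :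
    Tendsto (fun L => ENNReal.ofReal (K * (L ^ (1 / 2 : ℝ) * errScale n σ L))) atTop (𝓝 0) := by
  have hb : 0 < fowlerExp n σ * (1 + rateGain n σ) :=
    mul_pos (fowlerExp_pos hn) (by linarith [rateGain_pos hσ hn])
  have h := (tendsto_rpow_mul_exp_neg_mul_atTop_nhds_zero (1 / 2) _ hb).const_mul K
  rw [mul_zero] at h
  have h2 := ENNReal.tendsto_ofReal h
  rw [ENNReal.ofReal_zero] at h2
  refine h2.congr fun L => ?_
  rw [errScale]
  congr 4
  ring_nf

end Solutions

end Delaunay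

theorem mainTheorem5 (n : ℕ) (σ : ℝ) (hσ : 1 < σ) (hn : 2 * σ < (n : ℝ)) :
    ∃ L₀ : ℝ, 0 < L₀ ∧ ∃ δ : ℝ, 0 < δ ∧ ∃ C : ℝ, 0 < C ∧ ∃ ξ : ℝ, 0 < ξ ∧
      ∃ v ψ : ℝ → ℝ → ℝ,
        (∀ L : ℝ, L₀ ≤ L →
          Delaunay.IsBoundaryValueSolution n σ L (v L) ∧
          Delaunay.IsCylindricalSolution n σ L (v L) ∧
          Delaunay.MemSobolev n σ L (ψ L) ∧
          (∀ t : ℝ, v L t = Delaunay.bubbleTower n σ L t + ψ L t) ∧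
          Delaunay.sobolevNorm n σ L (ψ L) < ENNReal.ofReal δ ∧
          (∀ w : ℝ → ℝ, Delaunay.IsBoundaryValueSolution n σ L w →
            Delaunay.sobolevNorm n σ L (fun t => w t - Delaunay.bubbleTower n σ L t)
              < ENNReal.ofReal δ →
            w = v L) ∧
          (∀ w : ℝ → ℝ, Delaunay.IsCylindricalSolution n σ L w →
            Delaunay.sobolevNorm n σ L (fun t => w t - Delaunay.bubbleTower n σ L t)
              < ENNReal.ofReal δ →
            w = v L) ∧
          Delaunay.holderNorm (2 * σ) (ψ L)
            ≤ ENNReal.ofReal (C * Real.exp (-(Delaunay.fowlerExp n σ * L * (1 + ξ))))) ∧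
        Filter.Tendsto (fun L : ℝ => Delaunay.sobolevNorm n σ L (ψ L)) Filter.atTop
          (nhds 0) := by
  open Delaunay in
  have hg := fowlerExp_pos hn
  obtain ⟨L₁, hL₁, r, hr, D, hD, ψ, hψ⟩ := exists_correction hσ hn
  obtain ⟨C, hC, hsob⟩ := exists_sobolevNorm_le hσ hn
  have hper : ∀ L, L₁ ≤ L → Function.Periodic (ψ L) (2 * L) := fun L hL t => by
    obtain ⟨-, heq, -⟩ := hψ L hL
    have h1 := heq (t + 2 * L)
    rw [solOp_periodic, heq, tower_periodic] at h1
    linarith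
  have hnorm : ∀ L, L₁ ≤ L → sobolevNorm n σ L (ψ L) ≤
      ENNReal.ofReal (C * D (⌊σ⌋₊ + 1) * (L ^ (1 / 2 : ℝ) * errScale n σ L)) := fun L hL => by
    obtain ⟨-, -, hsm, hb, -⟩ := hψ L hL
    refine (hsob L (by linarith) _ _ (hper L hL) (hsm _) (hb (⌊σ⌋₊ + 1))).trans (le_of_eq ?_)
    congr 1
    ring
  have hlim : Tendsto (fun L : ℝ => sobolevNorm n σ L (ψ L)) atTop (𝓝 0) :=
    tendsto_of_tendsto_of_tendsto_of_le_of_le' tendsto_const_nhds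
      (tendsto_rpow_mul_errScale hσ hn (C * D (⌊σ⌋₊ + 1))) (.of_forall fun _ => zero_le)
      (eventually_atTop.2 ⟨L₁, hnorm⟩)
  obtain ⟨L₂, hL₂⟩ := eventually_atTop.1
    (hlim.eventually_lt_const (u := ENNReal.ofReal (r / 2)) (by simpa using hr))
  -- The radius $\delta=r/2$ compensates the factor $2$ in the Sobolev embedding: a function within
  -- $\delta$ of the tower in $H^\sigma_L$ is within $r$ of it uniformly. The constant for the
  -- Hölder norm is the one in `holderNorm_le`.
  refine ⟨max L₁ L₂, by linarith [le_max_left L₁ L₂], r / 2, by positivity,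
    (⌊2 * σ⌋₊ + 3) * D (⌊2 * σ⌋₊ + 1), mul_pos (by positivity) (hD _), rateGain n σ,
    rateGain_pos hσ hn, fun L t => tower (fowlerExp n σ) 1 L t + ψ L t, ψ,
    fun L hL => ?_, hlim⟩
  have hLL₁ : L₁ ≤ L := (le_max_left _ _).trans hL
  have hL1 : 1 ≤ L := hL₁.trans hLL₁
  have hL0 : 0 < L := by linarith
  obtain ⟨hpos, heq, hsm, hb, huniq⟩ := hψ L hLL₁
  have hvsm : ∀ j : ℕ, ContDiff ℝ j fun t => tower (fowlerExp n σ) 1 L t + ψ L t := fun j =>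
    (contDiff_tower hg hL0 j 1).add (hsm j)
  have huniq' : ∀ w : ℝ → ℝ, IsAdmissible n σ L w → (∀ t, solOp n σ L w t = w t) →
      sobolevNorm n σ L (fun t => w t - bubbleTower n σ L t) < ENNReal.ofReal (r / 2) →
      w = fun t => tower (fowlerExp n σ) 1 L t + ψ L t := by
    intro w hw hwe hlt
    rw [bubbleTower_eq_tower] at hlt
    have hw1 := hw.contDiff_one hσ
    refine funext (huniq w hw1.continuous (fun t => ?_) hwe)
    have h := abs_le_of_sobolevNorm_lt hσ hL1 (by positivity)
      (fun t => by rw [hw.1.2.1 t, tower_periodic]) (hw1.sub (contDiff_tower hg hL0 1 1)) hlt t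
    linarith
  refine ⟨isBoundaryValueSolution_of_solOp_eq hσ hn hL0 hpos hvsm heq,
    isCylindricalSolution_of_solOp_eq hσ hn hL0 hpos hvsm heq,
    memSobolev_of_contDiff hσ hn hL0 (hper L hLL₁) hsm,
    fun t => by rw [bubbleTower_eq_tower], hL₂ L ((le_max_right _ _).trans hL),
    fun w hw => huniq' w hw.1 (hw.solOp_eq hσ hn hL0),
    fun w hw => huniq' w hw.1 (hw.solOp_eq hσ hn hL0), ?_⟩
  refine (holderNorm_le (by linarith) (hsm _) (hb (⌊2 * σ⌋₊ + 1))).trans (le_of_eq ?_)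
  unfold errScale
  congr 1
  ring
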